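/- Let $n\ge 2$, let $K$ be a field of characteristic $0$ and let $q\in K^\times$ have a fourth root $q^{1/4}\in K$ that is not a root of unity. Put $[x]=\frac{q^x-q^{-x}}{q-q^{-1}}$ and $[a,b]_v=ab-v\,ba$. Let $\varepsilon_1,\dots,\varepsilon_n$ satisfy $(\varepsilon_i|\varepsilon_j)=\frac12\delta_{ij}$, let $P=\bigoplus\mathbb Z\varepsilon_i$, $\lambda_1=\varepsilon_1$, $\lambda_n=\varepsilon_1+\dots+\varepsilon_n$, $\alpha_i=\varepsilon_i-\varepsilon_{i+1}$ $(i<n)$, $\alpha_n=2\varepsilon_n$, $Q=\bigoplus\mathbb Z\alpha_i$, $d_i=(\alpha_i|\alpha_i)/2$. *Fock space.* Let $a_i(m),b_i(m)$ $(1\le i\le n,\ m\ne0)$ satisfy $[a_i(m),a_j(l)]=\delta_{m+l,0}\frac{[m(\alpha_i|\alpha_j)][-m/2]}{m}$, $[b_i(m),b_j(l)]=m\delta_{ij}\delta_{m+l,0}$, $[a_i(m),b_j(l)]=0$, and let $\widetilde{\mathcal F}=\bigoplus_{\alpha\in P+\frac12\mathbb Z\lambda_n,\ \beta\in P}\mathcal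 F_{\alpha,\beta}$, where $\mathcal F_{\alpha,\beta}$ is freely generated by the $a_i(-k),b_i(-k)$, $k\ge1$, from a vacuum $|\alpha,\beta\rangle$ killed by all $a_i(k),b_i(k)$, $k\ge 1$. On $\mathcal F_{\alpha,\beta}$ let $a_i(0)=(\alpha_i|\alpha)$, $b_i(0)=(2\varepsilon_i|\beta)$; let $e^{\gamma}$ map $|\alpha,\beta\rangle$ to $|\alpha+\gamma,\beta\rangle$ and $e^{b_i}$ map it to $|\alpha,\beta+\varepsilon_i\rangle$, both commuting with the $a_j(m)$, $b_j(m)$, $m\neq 0$. Put $$Y_i^{-}(z)=\exp\Big(-\sum_{k\ge1}\tfrac{a_i(-k)}{[-k/2]}q^{-k/4}z^k\Big)\exp\Big(\sum_{k\ge1}\tfrac{a_i(k)}{[-k/2]}q^{-k/4}z^{-k}\Big)e^{-\alpha_i}z^{2a_i(0)},$$ $$Z_i^{\pm}(z)=\exp\Big(\pm\sum_{k\ge1}\tfrac{b_i(-k)}kz^k\Big)\exp\Big(\mp\sum_{k\ge1}\tfrac{b_i(k)}kz^{-k}\Big)e^{\pm b_i}z^{\pm b_i(0)},\qquad \partial f(z)=\frac{f(q^{1/2}z)-f(q^{-1/2}z)}{(q^{1/2}-q^{-1/2})z},$$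 and define $x_i^-(m)$ by $\sum_m x_i^-(m)z^{-m-1}=Z_i^-(z)\,(\partial Z_{i+1}^+)(z)\,Y_i^-(z)$ for $i<n$ and $\sum_m x_n^-(m)z^{-m-1}=\frac{1}{q^{1/2}+q^{-1/2}}:Z_n^-(q^{1/2}z)Z_n^-(q^{-1/2}z):Y_n^-(z)$. Put $f_i=x_i^-(0)$. With $[b_1,\dots,b_N]_{v_1\cdots v_{N-1}}=[b_1,[b_2,\dots,b_N]_{v_1\cdots v_{N-2}}]_{v_{N-1}}$ put $$\hat e_0=[x_1^-(0),\dots,x_n^-(0),x_{n-1}^-(0),\dots,x_2^-(0),x_1^-(1)]_{q^{-1/2}\cdots q^{-1/2}\,q^{-1}\,q^{-1/2}\cdots q^{-1/2}\,1}$$ (both blocks $q^{-1/2}\cdots q^{-1/2}$ of length $n-2$), and $e_0=\frac{(-1)^n}{q^{1/2}+q^{-1/2}}\,\hat e_0K_\theta^{-1}$, $t_0=q^{-1/2}K_\theta^{-1}$, where $K_\theta$ acts on $\mathcal F_{\alpha,\beta}$ by $q^{(2\varepsilon_1|\alpha)}$. *Vertex operator.* For $k\neq0$ put $$a_{\bar1}(k)=\sum_{i=1}^n\frac{k}{[k/2]^2}\,\frac{[(n+1-i)k]\,[d_1(n+1)k]}{[d_i(n+1-i)k]\,[(n+1)k]}\,a_i(k)$$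 (so that $[a_j(k),a_{\bar1}(l)]=\delta_{j1}\delta_{k,-l}$), and $$\Phi_{\bar1}(z)=c\,\exp\Big(\sum_{k\ge1}\tfrac{[k/2]}kq^{(n+1/4)k}a_{\bar1}(-k)z^k\Big)\exp\Big(\sum_{k\ge1}\tfrac{[k/2]}kq^{-(n+3/4)k}a_{\bar1}(k)z^{-k}\Big)e^{\lambda_1}(q^{n+1/2}z)^{-2(\lambda_1|\alpha)+\kappa}\,(\partial Z_1^+)(q^{n+1/2}z)$$ on $\mathcal F_{\alpha,\beta}$, where the constants $c\in K$ and $\kappa\in\frac12\mathbb Z$ depend only on the coset $\alpha+Q$, and are arbitrary up to the condition that $-2(\lambda_1|\alpha)+\kappa$ be an integer (when $\alpha$ has half-integral coordinates, a fixed power $q^{\pm(n+1/2)/2}$ is absorbed in $c$). Put $\Phi_{\overline{i+1}}(z)=-[\Phi_{\bar i}(z),f_i]_{q^{1/2}}$ for $i=1,\dots,n-1$, $\Phi_n(z)=[\Phi_{\bar n}(z),f_n]_q$, and $\Phi_i(z)=[\Phi_{i+1}(z),f_i]_{q^{1/2}}$ for $i=n-1,\dots,1$. **Then**, as formal series in $z^{\pm1}$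 of operators on $\widetilde{\mathcal F}$, $$[\Phi_{\bar1}(z),\hat e_0]_{q^{-1}}=(-1)^{n-1}(1+q)\,z\,\Phi_1(z),\qquad [\Phi_{\bar1}(z),e_0]=-z\,t_0\,\Phi_1(z).$$ Equivalently, the operators $\Psi_{\bar1}(z)=\Phi_{\bar1}(-z)$ and $\Psi_1(z)$, which is obtained from $\Psi_{\bar1}(z)$ by the same recursion, satisfy $$[\Psi_{\bar1}(z),\hat e_0]_{q^{-1}}=(-1)^{n}(1+q)\,z\,\Psi_1(z),\qquad [\Psi_{\bar1}(z),e_0]=z\,t_0\,\Psi_1(z).$$ -/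

import Mathlib

noncomputable section

namespace QSymp

/-! Throughout, `K` is a field, `s` plays the role of `q^{1/4}` (so `q = s ^ 4`), and `n` is the
rank. Nodes `1, …, n` of the finite Dynkin diagram of type `C_n` are the elements `0, …, n - 1` of
`Fin n`. The form is normalised by `(ε_i | ε_j) = δ_ij / 2`. -/

/-- The quantum integer of a half-integer: `qHalf s k = [k / 2]`, where
`[x] = (q ^ x - q ^ (-x)) / (q - q⁻¹)` and `q = s ^ 4`. -/
def qHalf {K : Type*} [Field K] (s : K) (k : ℤ) : K :=
  (s ^ (2 * k) - s ^ (-(2 * k))) / (s ^ (4 : ℤ) - s ^ (-4 : ℤ))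

/-- The coefficient of `ε_j` in the simple root `α_i`: `α_i = ε_i - ε_{i+1}` for `i < n`, and
`α_n = 2 ε_n`. -/
def simpleRoot {n : ℕ} (i j : Fin n) : ℤ :=
  if (i : ℕ) + 1 = n then (if j = i then 2 else 0)
  else if j = i then 1 else if (j : ℕ) = (i : ℕ) + 1 then -1 else 0

/-- `2 (α_i | α_j)`. -/
def twoForm {n : ℕ} (i j : Fin n) : ℤ := ∑ l, simpleRoot i l * simpleRoot j l

/-- `2 d_i`, where `d_i = (α_i | α_i) / 2`; so `d_i = 1 / 2` for `i < n` and `d_n = 1`. -/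
def twoD {n : ℕ} (i : Fin n) : ℤ := if (i : ℕ) + 1 = n then 2 else 1

/-- Labels of the vacuum vectors `|α, β⟩`, `α ∈ P + ½ ℤ λ_n`, `β ∈ P`, where
`P = ⊕ ℤ ε_i` and `λ_n = ε_1 + ⋯ + ε_n`:
`α = ∑ (fst i + h / 2) ε_i` with `h = 1` if `half` is true and `h = 0` otherwise, and
`β = ∑ (snd i) ε_i`. -/
@[ext] structure Charge (n : ℕ) where
  fst : Fin n → ℤ
  half : Bool
  snd : Fin n → ℤ

/-- `h = 0` or `1`. -/
def Charge.h {n : ℕ} (c : Charge n) : ℤ := if c.half then 1 else 0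

/-- The coset of `α` modulo the root lattice `Q = ⊕ ℤ α_i`. There are four of them. -/
def Charge.coset {n : ℕ} (c : Charge n) : ZMod 2 × Bool := (((∑ i, c.fst i : ℤ) : ZMod 2), c.half)

/-- Labels of the creation operators: `Sum.inl (i, k)` for `a_i(-k)` and
`Sum.inr (i, k)` for `b_i(-k)`, `k ≥ 1`. -/
abbrev Osc (n : ℕ) := (Fin n × ℕ+) ⊕ (Fin n × ℕ+)

/-- The polynomial algebra in the creation operators. -/
abbrev Pol (K : Type*) [Field K] (n : ℕ) := MvPolynomial (Osc n) K

/-- The total Fock space `⨁_{α, β} F_{α, β}`, where `F_{α, β}` is freely generated from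
`|α, β⟩` by the creation operators. -/
abbrev Fock (K : Type*) [Field K] (n : ℕ) := Charge n →₀ Pol K n

/-- The creation operator `a_i(-k)`. -/
def aNeg (K : Type*) [Field K] {n : ℕ} (i : Fin n) (k : ℕ+) : Module.End K (Pol K n) :=
  LinearMap.mulLeft K (MvPolynomial.X (Sum.inl (i, k)))

/-- The creation operator `b_i(-k)`. -/
def bNeg (K : Type*) [Field K] {n : ℕ} (i : Fin n) (k : ℕ+) : Module.End K (Pol K n) :=
  LinearMap.mulLeft K (MvPolynomial.X (Sum.inr (i, k)))

/-- The annihilation operator `a_i(k)`: it kills the vacuum and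
`[a_i(k), a_j(-l)] = δ_kl [k (α_i | α_j)] [-k / 2] / k`, `[a_i(k), b_j(-l)] = 0`. -/
def aPos {K : Type*} [Field K] (s : K) {n : ℕ} (i : Fin n) (k : ℕ+) : Module.End K (Pol K n) :=
  (MvPolynomial.mkDerivation K (fun o : Osc n =>
    match o with
    | Sum.inl (j, l) =>
        if k = l then
          MvPolynomial.C (qHalf s ((k : ℤ) * twoForm i j) * qHalf s (-(k : ℤ)) / ((k : ℕ) : K))
        else 0
    | Sum.inr _ => (0 : Pol K n)) : Derivation K (Pol K n) (Pol K n)).toLinearMap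

/-- The annihilation operator `b_i(k)`: it kills the vacuum and
`[b_i(k), b_j(-l)] = k δ_ij δ_kl`, `[b_i(k), a_j(-l)] = 0`. -/
def bPos (K : Type*) [Field K] {n : ℕ} (i : Fin n) (k : ℕ+) : Module.End K (Pol K n) :=
  (MvPolynomial.mkDerivation K (fun o : Osc n =>
    match o with
    | Sum.inl _ => (0 : Pol K n)
    | Sum.inr (j, l) => if i = j ∧ k = l then MvPolynomial.C ((k : ℕ) : K) else 0) :
    Derivation K (Pol K n) (Pol K n)).toLinearMap

/-- The coefficient of `z ^ m` in `exp (∑_{k ≥ 1} A_k z ^ k) = ∑_j (∑_{k ≥ 1} A_k z ^ k) ^ j / j!`;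
only the terms with `j ≤ m` contribute. -/
def expCoeff {K : Type*} [Field K] {n : ℕ} (A : ℕ+ → Module.End K (Pol K n)) (m : ℕ) :
    Module.End K (Pol K n) :=
  ∑ j ∈ Finset.range (m + 1), ((j.factorial : K)⁻¹) •
    PowerSeries.coeff m
      ((PowerSeries.mk fun k => if hk : 0 < k then A ⟨k, hk⟩ else 0) ^ j)

/-- The degree of a monomial, where `a_i(-k)` and `b_i(-k)` have degree `k`. -/
def monDegree {n : ℕ} (d : Osc n →₀ ℕ) : ℕ :=
  d.sum fun o e => e * (Sum.elim (fun p => (p.2 : ℕ)) (fun p => (p.2 : ℕ)) o)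

/-- The coefficient of `z ^ r` in
`exp (∑_{k ≥ 1} A_k z ^ k) exp (∑_{k ≥ 1} B_k z ^ (-k))`, where the `A_k` are linear combinations
of creation operators of degree `k` and the `B_k` are linear combinations of annihilation
operators of degree `k`: on a monomial of degree `D`, the coefficient of `z ^ (-m)` of the
second factor vanishes for `m > D`, so that the sum over `m` is finite. -/
def expMode {K : Type*} [Field K] {n : ℕ} (A B : ℕ+ → Module.End K (Pol K n)) (r : ℤ) :
    Module.End K (Pol K n) :=
  (MvPolynomial.basisMonomials (Osc n) K).constr K fun d =>
    ∑ m ∈ Finset.range (monDegree d + 1),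
      if 0 ≤ r + m then
        expCoeff A (r + m).toNat (expCoeff B m (MvPolynomial.monomial d 1))
      else 0

/-- A normally ordered exponential
`exp (∑ up_k z ^ k) exp (∑ dn_k z ^ (-k)) e^{shift} · (coef z ^ expo)`,
where `coef z ^ expo` acts on the sector of `|α, β⟩` by a scalar multiple of a power of `z` and
`e^{shift}` then moves `|α, β⟩` to `|α + shift.1, β + shift.2⟩`. -/
structure NExp (K : Type*) [Field K] (n : ℕ) where
  up : ℕ+ → Module.End K (Pol K n)
  dn : ℕ+ → Module.End K (Pol K n)
  shift : (Fin n → ℤ) × (Fin n → ℤ)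
  expo : Charge n → ℤ
  coef : Charge n → K

/-- The normally ordered product of two normally ordered exponentials. If the factors involve
mutually commuting operators, this is their ordinary product. -/
def NExp.mul {K : Type*} [Field K] {n : ℕ} (U V : NExp K n) : NExp K n where
  up k := U.up k + V.up k
  dn k := U.dn k + V.dn k
  shift := U.shift + V.shift
  expo c := U.expo c + V.expo c
  coef c := U.coef c * V.coef c

/-- Replaces `z` by `u z`. -/
def NExp.rescale {K : Type*} [Field K] {n : ℕ} (u : K) (U : NExp K n) : NExp K n where
  up k := (u ^ (k : ℕ)) • U.up k
  dn k := ((u ^ (k : ℕ))⁻¹) • U.dn k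
  shift := U.shift
  expo := U.expo
  coef c := U.coef c * u ^ U.expo c

/-- Formal distributions in `z` with values in operators on the Fock space:
`F` stands for `∑_r F r z ^ r`. -/
abbrev FormalDist (K : Type*) [Field K] (n : ℕ) := ℤ → Module.End K (Fock K n)

/-- The formal distribution defined by a normally ordered exponential. -/
def NExp.field {K : Type*} [Field K] {n : ℕ} (U : NExp K n) : FormalDist K n := fun r =>
  Finsupp.lsum K fun c : Charge n =>
    (Finsupp.lsingle (⟨c.fst + U.shift.1, c.half, c.snd + U.shift.2⟩ : Charge n)).comp
      (U.coef c • expMode U.up U.dn (r - U.expo c))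

/-- `Z_i^σ(z)` for `σ = ±1`:
`exp (σ ∑ b_i(-k) z^k / k) exp (-σ ∑ b_i(k) z^{-k} / k) e^{σ b_i} z^{σ b_i(0)}`,
where `e^{b_i}` moves `β` to `β + ε_i` and `b_i(0)` acts by `(2 ε_i | β)`. -/
def Zop (K : Type*) [Field K] {n : ℕ} (σ : ℤ) (i : Fin n) : NExp K n where
  up k := ((σ : K) / ((k : ℕ) : K)) • bNeg K i k
  dn k := (-(σ : K) / ((k : ℕ) : K)) • bPos K i k
  shift := (0, Pi.single i σ)
  expo c := σ * c.snd i
  coef _ := 1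

/-- `2 a_i(0)`, acting on `|α, β⟩` by `2 (α_i | α)`. -/
def twoA0 {n : ℕ} (i : Fin n) (c : Charge n) : ℤ :=
  ∑ j, simpleRoot i j * c.fst j + (if (i : ℕ) + 1 = n then c.h else 0)

/-- `Y_i^σ(z)` for `σ = ±1`:
`exp (σ ∑ a_i(-k) q^{σ k/4} z^k / [-k/2]) exp (-σ ∑ a_i(k) q^{σ k/4} z^{-k} / [-k/2])
e^{σ α_i} z^{-2 σ a_i(0)}`. -/
def Yop {K : Type*} [Field K] (s : K) {n : ℕ} (σ : ℤ) (i : Fin n) : NExp K n where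
  up k := ((σ : K) * s ^ (σ * (k : ℤ)) / qHalf s (-(k : ℤ))) • aNeg K i k
  dn k := (-(σ : K) * s ^ (σ * (k : ℤ)) / qHalf s (-(k : ℤ))) • aPos s i k
  shift := (fun j => σ * simpleRoot i j, 0)
  expo c := -σ * twoA0 i c
  coef _ := 1

/-- `x_i^-(m)`, defined by `X_i^-(z) = ∑ x_i^-(m) z^{-m-1}` with
`X_i^-(z) = Z_i^-(z) (∂ Z_{i+1}^+)(z) Y_i^-(z)` for `i < n`, and
`X_n^-(z) = (q^{1/2} + q^{-1/2})⁻¹ :Z_n^-(q^{1/2} z) Z_n^-(q^{-1/2} z): Y_n^-(z)`, where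
`∂ f(z) = (f(q^{1/2} z) - f(q^{-1/2} z)) / ((q^{1/2} - q^{-1/2}) z)`. -/
def xMinus {K : Type*} [Field K] (s : K) {n : ℕ} (i : Fin n) (m : ℤ) :
    Module.End K (Fock K n) :=
  if h : (i : ℕ) + 1 < n then
    let V : K → NExp K n := fun u =>
      ((Zop K (-1) i).mul ((Zop K 1 (⟨(i : ℕ) + 1, h⟩ : Fin n)).rescale u)).mul (Yop s (-1) i)
    (s ^ (2 : ℤ) - s ^ (-2 : ℤ))⁻¹ •
      ((V (s ^ (2 : ℤ))).field (-m) - (V (s ^ (-2 : ℤ))).field (-m))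
  else
    (s ^ (2 : ℤ) + s ^ (-2 : ℤ))⁻¹ •
      ((((Zop K (-1) i).rescale (s ^ (2 : ℤ))).mul
        ((Zop K (-1) i).rescale (s ^ (-2 : ℤ)))).mul (Yop s (-1) i)).field (-m - 1)

/-- The coefficient of `a_i(k)` in the element `a_{\bar 1}(k)` of the Heisenberg algebra:
`(k / [k/2]^2) ([(n+1-i)k] / [d_i (n+1-i) k]) ([d_1 (n+1) k] / [(n+1) k])`
(with `i` running from `1` to `n`). For `n ≥ 2` and generic `q` it is characterised by
`[a_j(k), a_{\bar 1}(l)] = δ_{j1} δ_{k,-l}`. -/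
def abarCoeff {K : Type*} [Field K] (s : K) {n : ℕ} [NeZero n] (i : Fin n) (k : ℤ) : K :=
  (k : K) / qHalf s k ^ 2 *
    (qHalf s (2 * ((n : ℤ) - (i : ℕ)) * k) / qHalf s (twoD i * ((n : ℤ) - (i : ℕ)) * k)) *
    (qHalf s (twoD (0 : Fin n) * ((n : ℤ) + 1) * k) / qHalf s (2 * ((n : ℤ) + 1) * k))

/-- `a_{\bar 1}(-k)`, `k ≥ 1`. -/
def abarNeg {K : Type*} [Field K] (s : K) {n : ℕ} [NeZero n] (k : ℕ+) :
    Module.End K (Pol K n) :=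
  ∑ i : Fin n, abarCoeff s i (-(k : ℤ)) • aNeg K i k

/-- `a_{\bar 1}(k)`, `k ≥ 1`. -/
def abarPos {K : Type*} [Field K] (s : K) {n : ℕ} [NeZero n] (k : ℕ+) :
    Module.End K (Pol K n) :=
  ∑ i : Fin n, abarCoeff s i (k : ℤ) • aPos s i k

/-- The `a`-part of the vertex operator component (`n ≥ 2`):
`exp (∑ ([k/2]/k) q^{(n+1/4)k} a_{\bar 1}(-k) z^k) exp (∑ ([k/2]/k) q^{-(n+3/4)k} a_{\bar 1}(k) z^{-k})
e^{λ_1} (q^{n+1/2} z)^{-2 (λ_1 | α) + const}` times a constant. On each coset of `α` modulo `Q`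
the additive constant in the exponent is chosen such that the exponent is an integer: if
`α = ∑ (m_i + h/2) ε_i`, the exponent is `-m_1 + κ`, with `κ` depending only on the coset, and so
does the multiplicative constant `c`. -/
def phiA {K : Type*} [Field K] (s : K) {n : ℕ} [NeZero n]
    (κ : ZMod 2 × Bool → ℤ) (c : ZMod 2 × Bool → K) : NExp K n where
  up k := (qHalf s (k : ℤ) / ((k : ℕ) : K) * s ^ ((4 * (n : ℤ) + 1) * (k : ℤ))) • abarNeg s k
  dn k := (qHalf s (k : ℤ) / ((k : ℕ) : K) * s ^ (-((4 * (n : ℤ) + 3) * (k : ℤ)))) • abarPos s k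
  shift := (Pi.single 0 1, 0)
  expo γ := -γ.fst 0 + κ γ.coset
  coef γ := c γ.coset * (s ^ (4 * (n : ℤ) + 2)) ^ (-γ.fst 0 + κ γ.coset)

/-- `Φ_{\bar 1}(z)`: the product of the `a`-part and of `(∂ Z_1^+)(q^{n+1/2} z)`. -/
def phiBarOne {K : Type*} [Field K] (s : K) {n : ℕ} [NeZero n]
    (κ : ZMod 2 × Bool → ℤ) (c : ZMod 2 × Bool → K) : FormalDist K n := fun r =>
  let W : K → NExp K n := fun u =>
    (phiA s κ c).mul ((Zop K 1 (0 : Fin n)).rescale (u * s ^ (4 * (n : ℤ) + 2)))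
  ((s ^ (2 : ℤ) - s ^ (-2 : ℤ)) * s ^ (4 * (n : ℤ) + 2))⁻¹ •
    ((W (s ^ (2 : ℤ))).field (r + 1) - (W (s ^ (-2 : ℤ))).field (r + 1))

/-- The `q`-commutator `[a, b]_v = a b - v b a`. -/
def qComm {K R : Type*} [Field K] [Ring R] [Algebra K R] (v : K) (a b : R) : R :=
  a * b - v • (b * a)

/-- `[b_1, …, b_N]_{v_1 ⋯ v_{N-1}} = [b_1, [b_2, …, b_N]_{v_1 ⋯ v_{N-2}}]_{v_{N-1}}`. -/
def nestedComm {K R : Type*} [Field K] [Ring R] [Algebra K R] : List R → List K → R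
  | [], _ => 0
  | [b], _ => b
  | b :: b' :: bs, vs => qComm (vs.getLastD 1) b (nestedComm (b' :: bs) vs.dropLast)

/-- `f_i = x_i^-(0)`, with `i` counted from `0`, i.e. `fOp s n i` is the generator of the
node `i + 1`. -/
def fOp {K : Type*} [Field K] (s : K) (n : ℕ) [NeZero n] (i : ℕ) : Module.End K (Fock K n) :=
  xMinus s (Fin.ofNat n i) 0

/-- Given `Φ_{\bar 1}(z)`, the component `phiBar s F i = Φ_{\overline{i+1}}(z)`, where
`Φ_{\overline{i+1}}(z) = -[Φ_{\bar i}(z), f_i]_{q^{1/2}}` for `i = 1, …, n - 1`. -/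
def phiBar {K : Type*} [Field K] (s : K) {n : ℕ} [NeZero n] (F : FormalDist K n) : ℕ → FormalDist K n
  | 0 => F
  | i + 1 => fun r => -qComm (s ^ 2) (phiBar s F i r) (fOp s n i)

/-- Given `Φ_{\bar 1}(z)`, the component `phiDown s F k = Φ_{n-k}(z)`, where
`Φ_n(z) = [Φ_{\bar n}(z), f_n]_q` and `Φ_i(z) = [Φ_{i+1}(z), f_i]_{q^{1/2}}`
for `i = n - 1, …, 1`. -/
def phiDown {K : Type*} [Field K] (s : K) {n : ℕ} [NeZero n] (F : FormalDist K n) : ℕ → FormalDist K n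
  | 0 => fun r => qComm (s ^ 4) (phiBar s F (n - 1) r) (fOp s n (n - 1))
  | k + 1 => fun r => qComm (s ^ 2) (phiDown s F k r) (fOp s n (n - 2 - k))

/-- `Φ_1(z)`. -/
def phiOne {K : Type*} [Field K] (s : K) {n : ℕ} [NeZero n] (F : FormalDist K n) : FormalDist K n :=
  phiDown s F (n - 1)

/-- `[x_1^-(0), …, x_n^-(0), x_{n-1}^-(0), …, x_2^-(0), x_1^-(1)]` with subscripts
`q^{-1/2} ⋯ q^{-1/2} q^{-1} q^{-1/2} ⋯ q^{-1/2} 1`, both blocks of `q^{-1/2}` having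
length `n - 2`. -/
def eZeroHat {K : Type*} [Field K] (s : K) (n : ℕ) [NeZero n] : Module.End K (Fock K n) :=
  nestedComm
    ((List.finRange n).map (fun i => xMinus s i 0) ++
      ((List.finRange n).drop 1).dropLast.reverse.map (fun i => xMinus s i 0) ++
      [xMinus s (0 : Fin n) 1])
    (List.replicate (n - 2) ((s ^ 2)⁻¹) ++ [(s ^ 4)⁻¹] ++
      List.replicate (n - 2) ((s ^ 2)⁻¹) ++ [1])

/-- `K_θ^{-1}` with `θ = 2 α_1 + ⋯ + 2 α_{n-1} + α_n = 2 ε_1`, acting on the sector of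
`|α, β⟩` by `q^{-(θ | α)}`. -/
def KthetaInv {K : Type*} [Field K] (s : K) (n : ℕ) [NeZero n] : Module.End K (Fock K n) :=
  Finsupp.lsum K fun c : Charge n =>
    (s ^ (-(4 * c.fst 0 + 2 * c.h))) • Finsupp.lsingle c

/-- `t_0 = q^{-1/2} K_θ^{-1}`. -/
def tZero {K : Type*} [Field K] (s : K) (n : ℕ) [NeZero n] : Module.End K (Fock K n) :=
  ((s ^ 2)⁻¹) • KthetaInv s n

/-- `e_0 = ((-1)^n / [2]_1) \hat e_0 K_θ^{-1}`, with `[2]_1 = q^{1/2} + q^{-1/2}` (`n ≥ 2`). -/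
def eZero {K : Type*} [Field K] (s : K) (n : ℕ) [NeZero n] : Module.End K (Fock K n) :=
  ((-1) ^ n / (s ^ 2 + (s ^ 2)⁻¹)) • (eZeroHat s n * KthetaInv s n)

/-- `F(-z)`. -/
def reflect {K : Type*} [Field K] {n : ℕ} (F : FormalDist K n) : FormalDist K n := fun r =>
  ((-1 : K) ^ r) • F r

end QSymp

end

-- Write `p = q^{1/2}`, count nodes from 1, and let `Φ` stand for `Φ_{\bar 1}`. The proof separates
-- an algebraic part, which uses only a few relations between modes, from a vertex operator part,
-- which proves these relations.
--
-- Algebra. One has `ê_0 = [f_1, A]`, where `A` is `x_1^-(1)` surrounded by the palindrome `f_2, …,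
-- f_n, …, f_2`. A relation quadratic in nature between `Φ`, `f_1` and `A` (`QuadRel`) rewrites `[Φ,
-- [f_1, A]]_{q^{-1}}` as `-(1 + q^{-1}) [[Φ, A]_{p^{-1}}, f_1]_p` (`QuadRel.qComm_eq`). Since `Φ`
-- commutes with `f_2, …, f_n`, the inner bracket falls on `x_1^-(1)`, where the exchange relation
-- gives `[Φ_r, x_1^-(1)]_{p^{-1}} = q^n [Φ_{r-1}, f_1]_p`; this is the source of the factor `z`.
-- The palindrome applied to `Φ_{\bar 2}` is the recursion defining `Φ_2`, up to `(-1)^{n-1}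
-- q^{-(n-1)}` (`core_phiBar`), and the last bracket with `f_1` yields `Φ_1`. This is
-- `qComm_eZeroHat`.
--
-- `QuadRel` itself is proved by induction along the diagram (`CurrentRels.quadRel`). The exchange
-- relations of the currents move the mode 1 from node `i` to node `i + 1`, and `f_i` then plays the
-- role of `Φ` for the shorter diagram. The inputs are the cubic Serre relation of `Φ` with `f_1`
-- and of `f_i` with `f_{i+1}`.
--
-- Vertex operators. Every field is a normally ordered exponential or a difference of two. A product
-- `U(z) V(w)` is `κ (z - a w) / (z - b w)` times the normally ordered product
-- (`NExp.OPE.field_mul`), so exchange relations are read off from the constants `a, b, κ`. The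
-- Serre relation does not follow formally: the exchange relations only show that the Serre
-- expression vanishes after multiplication by two linear factors. The factors are stripped by
-- truncation, because on each vector sufficiently low modes of one of the fields vanish
-- (`ShortPair.serreRel`).
--
-- Finally, `K_θ` scales `Φ` and `Φ_1` by opposite powers of `q`, which turns the `q`-commutator
-- with `ê_0` into the commutator with `e_0` (`commutator_eZero`); the replacement of `z` by `-z`
-- only changes signs.

noncomputable section
namespace QSymp

-- Cubic Serre relations from exchange relations and truncation.

section Serre

variable {K : Type*} [Field K] {V : Type*} [AddCommGroup V] [Module K V]

/-- `(w - p y) X(w) Y(y) = (p w - y) Y(y) X(w)` for formal distributions `X`, `Y`. -/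
def ExchangeRel (p : K) (X Y : ℤ → Module.End K V) : Prop :=
  ∀ i r, X (i - 1) * Y r - p • (X i * Y (r - 1)) = p • (Y r * X (i - 1)) - Y (r - 1) * X i

/-- `(w - p⁻² w') X(w) X'(w') = - (w' - p⁻² w) X'(w') X(w)`. -/
def FermiRel (p : K) (X X' : ℤ → Module.End K V) : Prop :=
  ∀ i j, X (i - 1) * X' j - (p ^ 2)⁻¹ • (X i * X' (j - 1)) =
    (p ^ 2)⁻¹ • (X' j * X (i - 1)) - X' (j - 1) * X i

/-- The symmetrised Serre expression. -/
def serreExpr (p : K) (X X' Y : ℤ → Module.End K V) (i j r : ℤ) : Module.End K V :=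
  X i * X' j * Y r + X' j * X i * Y r - (p + p⁻¹) • (X i * Y r * X' j + X' j * Y r * X i)
    + Y r * X i * X' j + Y r * X' j * X i

/-- Multiplication by `(w - p y)(w' - p y)` allows `Y` to be moved to the far left in every term.
The coefficient of `Y(y) X(w) X'(w')` then collapses to `p (p² - 1) y (w - p⁻² w')`, and the Fermi
relation cancels it against the term with `X` and `X'` interchanged. -/
theorem ExchangeRel.serreExpr_left {p : K} (hp : p ≠ 0) {X X' Y : ℤ → Module.End K V}
    (hX : ExchangeRel p X Y) (hX' : ExchangeRel p X' Y) (hF : FermiRel p X X') (i j r : ℤ) :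
    serreExpr p X X' Y (i - 1) (j - 1) r - p • serreExpr p X X' Y (i - 1) j (r - 1)
      - p • serreExpr p X X' Y i (j - 1) (r - 1) + p ^ 2 • serreExpr p X X' Y i j (r - 2) = 0 := by
  have e : r - 1 - 1 = r - 2 := by ring
  have a1 := congrArg (X (i - 1) * ·) (hX' j r)
  have a2 := congrArg (X i * ·) (hX' j (r - 1))
  have a3 := congrArg (· * X' (j - 1)) (hX i r)
  have a4 := congrArg (· * X' j) (hX i (r - 1))
  have b1 := congrArg (X' (j - 1) * ·) (hX i r)
  have b2 := congrArg (X' j * ·) (hX i (r - 1))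
  have b3 := congrArg (· * X (i - 1)) (hX' j r)
  have b4 := congrArg (· * X i) (hX' j (r - 1))
  have c1 := congrArg (Y (r - 1) * ·) (hF i j)
  simp only [e, mul_sub, sub_mul, smul_mul_assoc, mul_smul_comm, ← mul_assoc]
    at a1 a2 a3 a4 b1 b2 b3 b4 c1
  unfold serreExpr
  linear_combination (norm := skip) a1 - p • a2 + p • a3 - a4 - (p + p⁻¹) • a3 + ((p + p⁻¹) * p) • a4
    + b1 - p • b2 + p • b3 - b4 - (p + p⁻¹) • b3 + ((p + p⁻¹) * p) • b4 + (p * (p ^ 2 - 1)) • c1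
  match_scalars <;> field_simp <;> ring

/-- The mirror image: the factor `(p w - y)(p w' - y)` moves `Y` to the far right and leaves the
same polynomial. -/
theorem ExchangeRel.serreExpr_right {p : K} (hp : p ≠ 0) {X X' Y : ℤ → Module.End K V}
    (hX : ExchangeRel p X Y) (hX' : ExchangeRel p X' Y) (hF : FermiRel p X X') (i j r : ℤ) :
    p ^ 2 • serreExpr p X X' Y (i - 1) (j - 1) r - p • serreExpr p X X' Y (i - 1) j (r - 1)
      - p • serreExpr p X X' Y i (j - 1) (r - 1) + serreExpr p X X' Y i j (r - 2) = 0 := by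
  have e : r - 1 - 1 = r - 2 := by ring
  have a1 := congrArg (X (i - 1) * ·) (hX' j r)
  have a2 := congrArg (X i * ·) (hX' j (r - 1))
  have a3 := congrArg (· * X' (j - 1)) (hX i r)
  have a4 := congrArg (· * X' j) (hX i (r - 1))
  have b1 := congrArg (X' (j - 1) * ·) (hX i r)
  have b2 := congrArg (X' j * ·) (hX i (r - 1))
  have b3 := congrArg (· * X (i - 1)) (hX' j r)
  have b4 := congrArg (· * X i) (hX' j (r - 1))
  have c1 := congrArg (· * Y (r - 1)) (hF i j)
  simp only [e, mul_sub, sub_mul, smul_mul_assoc, mul_smul_comm, ← mul_assoc]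
    at a1 a2 a3 a4 b1 b2 b3 b4 c1
  unfold serreExpr
  linear_combination (norm := skip) -p • a3 + a4 - a1 + p • a2
    + ((p + p⁻¹) * p) • a1 - (p + p⁻¹) • a2 - p • b3 + b4 - b1 + p • b2
    + ((p + p⁻¹) * p) • b1 - (p + p⁻¹) • b2 + (p * (p ^ 2 - 1)) • c1
  match_scalars <;> field_simp <;> ring

theorem serreExpr_comm (p : K) (X X' Y : ℤ → Module.End K V) (i j r : ℤ) :
    serreExpr p X X' Y i j r = serreExpr p X' X Y j i r := by
  unfold serreExpr
  module

/-- A family of operators `U` is governed by the exhaustive family `W` of subspaces if `U r` kills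
`W D` for `r ≤ -D`. -/
structure IsFilt (U : ℤ → Module.End K V) (W : ℤ → Submodule K V) : Prop where
  exhaust : ∀ v, ∃ D, v ∈ W D
  kill : ∀ D, ∀ v ∈ W D, ∀ r ≤ -D, U r v = 0

/-- The operators `T r` preserve all the subspaces `W D`. -/
def Preserves (T : ℤ → Module.End K V) (W : ℤ → Submodule K V) : Prop :=
  ∀ D, ∀ v ∈ W D, ∀ r, T r v ∈ W D

/-- On a fixed vector the expression vanishes for low modes of `Y`, uniformly in the other two. In
`(w - p y)(w' - p y)` the term `w w'` has coefficient 1, so the value at `r` is determined by those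
at `r - 1` and `r - 2`. -/
theorem serreExpr_eq_zero_of_filt_right {p : K} (hp : p ≠ 0) {X X' Y : ℤ → Module.End K V}
    (hX : ExchangeRel p X Y) (hX' : ExchangeRel p X' Y) (hF : FermiRel p X X')
    {W : ℤ → Submodule K V} (hW : IsFilt Y W) (hWX : Preserves X W) (hWX' : Preserves X' W)
    (i j r : ℤ) : serreExpr p X X' Y i j r = 0 := by
  ext1 v
  obtain ⟨D, hv⟩ := hW.exhaust v
  have base : ∀ r ≤ -D, ∀ i j, serreExpr p X X' Y i j r v = 0 := by
    intro r hr i j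
    have k := fun w hw => hW.kill D w hw r hr
    have m := fun w hw i => hWX D w hw i
    have m' := fun w hw i => hWX' D w hw i
    simp [serreExpr, k _ hv, k _ (m _ hv i), k _ (m' _ hv j), k _ (m _ (m' _ hv j) i),
      k _ (m' _ (m _ hv i) j)]
  have step : ∀ N : ℕ, ∀ r ≤ -D + N, ∀ i j, serreExpr p X X' Y i j r v = 0 := by
    intro N
    induction N with
    | zero => simpa using base
    | succ N ih =>
      intro r hr i j
      have h := congrArg (fun T => T v) (hX.serreExpr_left hp hX' hF (i + 1) (j + 1) r)
      push_cast at hr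
      simpa [ih (r - 1) (by omega), ih (r - 2) (by omega)] using h
  exact step (r + D).toNat r (by omega) i j

/-- A geometric recursion along which the values eventually vanish. -/
theorem eq_zero_of_shift {M : Type*} [AddCommGroup M] [Module K M] {p : K}
    {G : ℤ → ℤ → M}
    (h : ∀ i r, p • G (i - 1) r = G i (r - 1)) {I : ℤ} (hI : ∀ i ≤ I, ∀ r, G i r = 0) (i r : ℤ) :
    G i r = 0 := by
  have step : ∀ N : ℕ, ∀ i ≤ I + N, ∀ r, G i r = 0 := by
    intro N
    induction N with
    | zero => simpa using hI
    | succ N ih =>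
      intro i hi r
      have := h i (r + 1)
      push_cast at hi
      rw [ih (i - 1) (by omega), smul_zero] at this
      simpa using this.symm
  exact step (i - I).toNat i (by omega) r

/-- The bound on `i` has to be uniform in `r`, since the recursion in `eq_zero_of_shift` moves `r`.
The exchange relation trades `X' j (Y r v)` for terms with `Y` outermost, which low modes of `X`
kill because `Y` preserves the filtration, and for a term with `j - 1`. -/
theorem ExchangeRel.kill_triple {p : K} (hp : p ≠ 0) {X X' Y : ℤ → Module.End K V}
    (hX' : ExchangeRel p X' Y) {W : ℤ → Submodule K V}
    (hW : IsFilt X W) (hW' : IsFilt X' W) (hWY : Preserves Y W) (v : V) (j : ℤ) :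
    ∃ I, ∀ i ≤ I, ∀ r, X i (X' j (Y r v)) = 0 := by
  obtain ⟨D, hv⟩ := hW.exhaust v
  have step : ∀ N : ℕ, ∀ j ≤ -D + N, ∃ I, ∀ i ≤ I, ∀ r, X i (X' j (Y r v)) = 0 := by
    intro N
    induction N with
    | zero =>
      intro j hj
      exact ⟨0, fun i _ r => by
        rw [hW'.kill D _ (hWY D v hv r) j (by simpa using hj), map_zero]⟩
    | succ N ih =>
      intro j hj
      push_cast at hj
      obtain ⟨I, hI⟩ := ih (j - 1) (by omega)
      obtain ⟨D₁, h₁⟩ := hW.exhaust (X' (j - 1) v)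
      obtain ⟨D₂, h₂⟩ := hW.exhaust (X' j v)
      refine ⟨min I (min (-D₁) (-D₂)), fun i hi r => ?_⟩
      have h := congrArg (fun T => X i (T v)) (hX' j (r + 1))
      have k₁ := hW.kill D₁ _ (hWY D₁ _ h₁ (r + 1)) i (by omega)
      have k₂ := hW.kill D₂ _ (hWY D₂ _ h₂ r) i (by omega)
      have k₃ := hI i (by omega) (r + 1)
      simpa [k₁, k₂, k₃, hp] using h
  exact step (j + D).toNat j (by omega)

/-- Here truncation is available in the two variables of `X` and `X'` but not in that of `Y`, so the
linear factors of `serreExpr_right` are removed one at a time. -/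
theorem serreExpr_eq_zero_of_filt_left {p : K} (hp : p ≠ 0) {X X' Y : ℤ → Module.End K V}
    (hX : ExchangeRel p X Y) (hX' : ExchangeRel p X' Y) (hF : FermiRel p X X')
    {W : ℤ → Submodule K V} (hW : IsFilt X W) (hW' : IsFilt X' W) (hWY : Preserves Y W)
    (i j r : ℤ) : serreExpr p X X' Y i j r = 0 := by
  have key : ∀ {X X' : ℤ → Module.End K V}, ExchangeRel p X' Y → IsFilt X W → IsFilt X' W →
      ∀ v j, ∃ I, ∀ i ≤ I, ∀ r, serreExpr p X X' Y i j r v = 0 := by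
    intro X X' hX' hW hW' v j
    obtain ⟨I, hI⟩ := hX'.kill_triple hp hW hW' hWY v j
    obtain ⟨D, hv⟩ := hW.exhaust v
    obtain ⟨D₁, h₁⟩ := hW.exhaust (X' j v)
    refine ⟨min I (min (-D) (-D₁)), fun i hi r => ?_⟩
    have k₁ := hI i (by omega) r
    have k₂ := hW.kill D _ hv i (by omega)
    have k₃ := hW.kill D _ (hWY D _ hv r) i (by omega)
    have k₄ := hW.kill D₁ _ h₁ i (by omega)
    have k₅ := hW.kill D₁ _ (hWY D₁ _ h₁ r) i (by omega)
    simp [serreExpr, k₁, k₂, k₃, k₄, k₅]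
  ext1 v
  -- The product with `p w' - y` alone is killed by `p w - y` and vanishes for low modes of `X`.
  have half : ∀ i j r, p • serreExpr p X X' Y i (j - 1) r v = serreExpr p X X' Y i j (r - 1) v := by
    intro i j r
    obtain ⟨I₁, h₁⟩ := key hX' hW hW' v (j - 1)
    obtain ⟨I₂, h₂⟩ := key hX' hW hW' v j
    have := eq_zero_of_shift (p := p) (I := min I₁ I₂)
      (G := fun i r => p • serreExpr p X X' Y i (j - 1) r v - serreExpr p X X' Y i j (r - 1) v)
      (fun i r => ?_) (fun i hi r => ?_) i r
    · exact sub_eq_zero.1 this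
    · have h := congrArg (fun T => T v) (hX.serreExpr_right hp hX' hF i j r)
      have e : r - 1 - 1 = r - 2 := by ring
      simp only [LinearMap.add_apply, LinearMap.sub_apply, LinearMap.smul_apply,
        LinearMap.zero_apply] at h
      rw [e]
      linear_combination (norm := module) h
    · simp only [h₁ i (by omega), h₂ i (by omega), smul_zero, sub_zero]
  obtain ⟨J, hJ⟩ := key hX hW' hW v i
  refine eq_zero_of_shift (p := p) (I := J) (G := fun j r => serreExpr p X X' Y i j r v)
    (fun j r => half i j r) (fun j hj r => ?_) j r
  rw [serreExpr_comm]
  exact hJ j hj r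

end Serre

-- Root vector algebra: the quadratic relation and nested commutators.

section Quad

variable {K : Type*} [Field K] {R : Type*} [Ring R] [Algebra K R]

/-- The `q`-Serre relation of degree two in `f` and one in `P`. -/
def SerreRel (p : K) (P f : R) : Prop :=
  P * f * f - (p + p⁻¹) • (f * P * f) + f * f * P = 0

/-- The relation by which `P` intertwines the root vector `[f, A]`. -/
def QuadRel (p : K) (P f A : R) : Prop :=
  P * f * A + (p ^ 2)⁻¹ • (P * A * f) + f * A * P + (p ^ 2)⁻¹ • (A * f * P)
    - ((1 + (p ^ 2)⁻¹) * p⁻¹) • (A * P * f) - ((1 + (p ^ 2)⁻¹) * p) • (f * P * A) = 0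

/-- The long end of the diagram. Since `P` commutes with `y`, multiplying the Serre relation by `y`
on either side gives the two relations needed. -/
theorem SerreRel.quadRel {p : K} (hp : p ≠ 0) {P f y : R} (h : SerreRel p P f)
    (hy : P * y = y * P) : QuadRel p P f ((p ^ 2)⁻¹ • qComm (p ^ 2) y f) := by
  have hy' : ∀ z, P * (y * z) = y * (P * z) := fun z => by rw [← mul_assoc, hy, mul_assoc]
  unfold SerreRel at h
  have h1 := congrArg (y * ·) h
  have h2 := congrArg (· * y) h
  unfold QuadRel qComm
  simp only [mul_sub, sub_mul, mul_add, add_mul, mul_zero, zero_mul, smul_mul_assoc, mul_smul_comm,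
    mul_assoc, hy, hy'] at h1 h2 ⊢
  linear_combination (norm := skip) (p ^ 4)⁻¹ • h1 - h2
  match_scalars <;> field_simp <;> ring

/-- One inductive step: the relation for the triple `f, g, A` at the shorter diagram, together with
the Serre relation of `P` and `f`, gives it for `P, f` and the next root vector. -/
theorem QuadRel.step {p : K} (hp : p ≠ 0) (hp2 : p ^ 2 + 1 ≠ 0) {P f g A : R}
    (h : SerreRel p P f) (hg : P * g = g * P) (hA : P * A = A * P) (hT : QuadRel p f g A) :
    QuadRel p P f (qComm p⁻¹ g (p⁻¹ • qComm p A f)) := by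
  have hg' : ∀ z, P * (g * z) = g * (P * z) := fun z => by rw [← mul_assoc, hg, mul_assoc]
  have hA' : ∀ z, P * (A * z) = A * (P * z) := fun z => by rw [← mul_assoc, hA, mul_assoc]
  unfold SerreRel at h
  unfold QuadRel at hT
  have s1 := congrArg (g * A * ·) h
  have s2 := congrArg (· * (g * A)) h
  have s3 := congrArg (A * g * ·) h
  have s4 := congrArg (· * (A * g)) h
  have t1 := congrArg (P * f * ·) hT
  have t2 := congrArg (P * · * f) hT
  have t3 := congrArg (f * P * ·) hT
  have t4 := congrArg (f * · * P) hT
  have t5 := congrArg (· * (P * f)) hT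
  have t6 := congrArg (· * (f * P)) hT
  unfold QuadRel qComm
  simp only [mul_sub, sub_mul, mul_add, add_mul, mul_zero, zero_mul, smul_mul_assoc, mul_smul_comm,
    mul_assoc, hg, hg', hA, hA', smul_sub, smul_smul]
    at s1 s2 s3 s4 t1 t2 t3 t4 t5 t6 ⊢
  -- The Serre relation is multiplied by the words `g A` and `A g`, and the relation `hT` by `P` and
  -- `f` in all six placements; the coefficients solve the resulting linear system, whose
  -- denominator is `p² + 1`.
  linear_combination (norm := skip) (p / (p ^ 2 + 1) * (p ^ 4)⁻¹) • s1 - (p / (p ^ 2 + 1)) • s2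
    - (p / (p ^ 2 + 1) * (p ^ 4)⁻¹) • s3 + (p / (p ^ 2 + 1)) • s4
    + (p / (p ^ 2 + 1)) • t1 + (p / (p ^ 2 + 1) * (p ^ 2)⁻¹) • t2 - t3 + (p / (p ^ 2 + 1)) • t4
    - (p ^ 2)⁻¹ • t5 + (p / (p ^ 2 + 1) * (p ^ 2)⁻¹) • t6
  match_scalars <;> field_simp <;> ring

/-- If `P` satisfies exchange relations with `f` and `A` and `QuadRel` holds, then the
`q`-commutator of `P` with `[f, A]` is determined by that of `P` with `A`. -/
theorem QuadRel.qComm_eq {p : K} (hp : p ≠ 0) {P f A : R} (h : QuadRel p P f A) :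
    qComm (p ^ 2)⁻¹ P (qComm (1 : K) f A) = -(1 + (p ^ 2)⁻¹) • qComm p (qComm p⁻¹ P A) f := by
  unfold QuadRel at h
  unfold qComm
  simp only [mul_sub, sub_mul, smul_mul_assoc, mul_smul_comm, ← mul_assoc, smul_sub, smul_smul]
  linear_combination (norm := skip) h
  match_scalars <;> field_simp <;> ring

/-- `X ↦ [b, X]_v` as a linear map. -/
def adL (v : K) (b : R) : R →ₗ[K] R := LinearMap.mulLeft K b - v • LinearMap.mulRight K b

theorem adL_apply (v : K) (b X : R) : adL v b X = qComm v b X := by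
  simp [adL, qComm]

/-- `[f_k, …, f_{k+d-1}, f_{k+d}, f_{k+d-1}, …, f_k, X]` with subscripts
`p⁻¹ ⋯ p⁻¹ p⁻² p⁻¹ ⋯ p⁻¹`. -/
def core (p : K) (f : ℕ → R) : ℕ → ℕ → R →ₗ[K] R
  | 0, k => adL (p ^ 2)⁻¹ (f k)
  | d + 1, k => adL p⁻¹ (f k) ∘ₗ core p f d (k + 1) ∘ₗ adL p⁻¹ (f k)

/-- Each layer of `core` is assembled from left and right multiplications by the `f j`, so it
suffices that `T` commutes with those. It is used for `T` a left or right multiplication. -/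
theorem core_comm (p : K) (f : ℕ → R) (T : R →ₗ[K] R) (d k : ℕ)
    (hl : ∀ j, k ≤ j → j ≤ k + d → ∀ X, T (f j * X) = f j * T X)
    (hr : ∀ j, k ≤ j → j ≤ k + d → ∀ X, T (X * f j) = T X * f j) (X : R) :
    T (core p f d k X) = core p f d k (T X) := by
  induction d generalizing k X with
  | zero => simp [core, adL, hl k le_rfl le_rfl, hr k le_rfl le_rfl]
  | succ d ih =>
    have e := ih (k + 1) (fun j h1 h2 => hl j (by omega) (by omega))
      (fun j h1 h2 => hr j (by omega) (by omega))
    simp only [core, LinearMap.comp_apply]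
    simp [adL, hl k le_rfl (by omega), hr k le_rfl (by omega), e]

theorem mul_core {p : K} {f : ℕ → R} {P : R} {d k : ℕ}
    (h : ∀ j, k ≤ j → j ≤ k + d → P * f j = f j * P) (X : R) :
    P * core p f d k X = core p f d k (P * X) :=
  core_comm p f (LinearMap.mulLeft K P) d k
    (fun j h1 h2 X => by simp [← mul_assoc, h j h1 h2]) (fun j h1 h2 X => by simp [mul_assoc]) X

theorem core_mul {p : K} {f : ℕ → R} {P : R} {d k : ℕ}
    (h : ∀ j, k ≤ j → j ≤ k + d → P * f j = f j * P) (X : R) :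
    core p f d k X * P = core p f d k (X * P) :=
  core_comm p f (LinearMap.mulRight K P) d k
    (fun j h1 h2 X => by simp [mul_assoc]) (fun j h1 h2 X => by simp [mul_assoc, h j h1 h2]) X

theorem qComm_core {p v : K} {f : ℕ → R} {P : R} {d k : ℕ}
    (h : ∀ j, k ≤ j → j ≤ k + d → P * f j = f j * P) (X : R) :
    qComm v P (core p f d k X) = core p f d k (qComm v P X) := by
  simp [qComm, mul_core h, core_mul h]

theorem core_qComm {p v : K} {f : ℕ → R} {P : R} {d k : ℕ}
    (h : ∀ j, k ≤ j → j ≤ k + d → P * f j = f j * P) (X : R) :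
    qComm v (core p f d k X) P = core p f d k (qComm v X P) := by
  simp [qComm, mul_core h, core_mul h]

/-- The relations between the modes `f i = x_i(0)` and `x i = x_i(1)` of the currents that are used
for the action of `ê_0`. -/
structure CurrentRels (p : K) (n : ℕ) (f x : ℕ → R) : Prop where
  ff : ∀ i j, i + 2 ≤ j → j < n → f i * f j = f j * f i
  fx : ∀ i j, i + 2 ≤ j → j < n → f i * x j = x j * f i
  serre : ∀ i, i + 2 < n → SerreRel p (f i) (f (i + 1))
  short : ∀ i, i + 2 < n →
    qComm p⁻¹ (f (i + 1)) (x i) = p⁻¹ • qComm p (x (i + 1)) (f i)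
  long : ∀ i, i + 2 = n →
    qComm (p ^ 2)⁻¹ (f (i + 1)) (x i) = (p ^ 2)⁻¹ • qComm (p ^ 2) (x (i + 1)) (f i)

/-- The induction must be over all `P`: `H.short` replaces `[f (k + 1), x k]` by `[x (k + 1), f k]`,
so at the next node `f k` takes the place of `P`, and its Serre and commutation relations are part
of `H`. -/
theorem CurrentRels.quadRel {p : K} (hp : p ≠ 0) (hp2 : p ^ 2 + 1 ≠ 0) {n : ℕ} {f x : ℕ → R}
    (H : CurrentRels p n f x) (d k : ℕ) (hk : k + d + 2 = n) (P : R) (hS : SerreRel p P (f k))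
    (hf : ∀ j, k < j → j < n → P * f j = f j * P)
    (hx : ∀ j, k < j → j < n → P * x j = x j * P) :
    QuadRel p P (f k) (core p f d (k + 1) (x k)) := by
  induction d generalizing k P with
  | zero =>
    rw [core, adL_apply, H.long k (by omega)]
    exact hS.quadRel hp (hx _ (by omega) (by omega))
  | succ d ih =>
    simp only [core, LinearMap.comp_apply]
    rw [adL_apply, adL_apply, H.short k (by omega), map_smul,
      ← core_qComm (fun j h1 h2 => H.ff k j (by omega) (by omega))]
    refine QuadRel.step hp hp2 hS (hf _ (by omega) (by omega)) ?_
      (ih (k + 1) (by omega) (f k) (H.serre k (by omega)) (fun j h1 h2 => H.ff k j (by omega) h2)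
        (fun j h1 h2 => H.fx k j (by omega) h2))
    rw [mul_core (fun j h1 h2 => hf j (by omega) (by omega)),
      core_mul (fun j h1 h2 => hf j (by omega) (by omega)), hx _ (by omega) (by omega)]

/-- The nested commutator as an iterated application of linear maps. -/
theorem nestedComm_append (L : List R) (x : R) (ws : List K) (h : ws.length = L.length) :
    nestedComm (L ++ [x]) ws.reverse =
      (L.zip ws).foldr (fun a X => qComm a.2 a.1 X) x := by
  induction L generalizing ws with
  | nil => simp [nestedComm]
  | cons l L ih =>
    obtain _ | ⟨w, ws⟩ := ws
    · simp at h
    · have := ih ws (by simpa using h)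
      obtain _ | ⟨l', L⟩ := L
      · simp at h
        simp [nestedComm, h]
      · simp only [List.cons_append, nestedComm] at this ⊢
        simp [this]

theorem core_eq_foldr (p : K) (f : ℕ → R) (d k : ℕ) (X : R) :
    core p f d k X = ((((List.range' k d).map f ++ [f (k + d)]) ++ (List.range' k d).reverse.map f).zip
      ((List.replicate d p⁻¹ ++ [(p ^ 2)⁻¹]) ++ List.replicate d p⁻¹)).foldr
        (fun a X => qComm a.2 a.1 X) X := by
  induction d generalizing k X with
  | zero => simp [core, adL_apply]
  | succ d ih =>
    simp only [core, LinearMap.comp_apply, ih, adL_apply]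
    have e : k + 1 + d = k + (d + 1) := by ring
    -- The outermost layer contributes one entry at each end of both palindromic lists, so one `p⁻¹`
    -- is split off from either block.
    have r : (List.replicate (d + 1) p⁻¹ ++ [(p ^ 2)⁻¹]) ++ List.replicate (d + 1) p⁻¹ =
        (p⁻¹ :: ((List.replicate d p⁻¹ ++ [(p ^ 2)⁻¹]) ++ List.replicate d p⁻¹)) ++ [p⁻¹] := by
      conv_lhs => arg 2; rw [List.replicate_succ']
      simp [List.replicate_succ]
    have t : ((List.range' k (d + 1)).map f ++ [f (k + (d + 1))]) ++
          (List.range' k (d + 1)).reverse.map f =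
        (f k :: (((List.range' (k + 1) d).map f ++ [f (k + 1 + d)]) ++
          (List.range' (k + 1) d).reverse.map f)) ++ [f k] := by
      simp [List.range'_succ, e]
    rw [r, t]
    conv_rhs =>
      rw [List.zip_append (by simp), List.foldr_append, List.zip_cons_cons, List.foldr_cons]
    rfl

end Quad

-- The action of `ê_0` deduced from the relations between modes.

section Chain

variable {K : Type*} [Field K]

/-- `x_i^-(1)`, with `i` counted from `0`. -/
def xOne (s : K) (n : ℕ) [NeZero n] (i : ℕ) : Module.End K (Fock K n) :=
  xMinus s (Fin.ofNat n i) 1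

theorem map_finRange_eq_range' {R : Type*} {n : ℕ} [NeZero n] (g : Fin n → R) :
    (List.finRange n).map g = (List.range' 0 n).map (fun i => g (Fin.ofNat n i)) := by
  rw [← List.range_eq_range', ← List.map_coe_finRange_eq_range, List.map_map]
  refine List.map_congr_left fun i _ => ?_
  simp

theorem map_drop_finRange {R : Type*} {n d : ℕ} [NeZero n] (hn : n = d + 2) (g : Fin n → R) :
    ((List.finRange n).drop 1).dropLast.reverse.map g =
      (List.range' 1 d).reverse.map (fun i => g (Fin.ofNat n i)) := by
  rw [List.map_reverse, List.map_reverse, List.map_dropLast, List.map_drop, map_finRange_eq_range']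
  subst hn
  congr 1
  simp only [List.range'_succ, List.map_cons, List.drop_succ_cons, List.drop_zero]
  rw [← List.map_cons (f := fun i => g (Fin.ofNat (d + 2) i)), ← List.range'_succ, List.range'_concat]
  simp

theorem eZeroHat_eq (s : K) {n d : ℕ} [NeZero n] (hn : n = d + 2) :
    eZeroHat s n = qComm (1 : K) (fOp s n 0) (core (s ^ 2) (fOp s n) d 1 (xOne s n 0)) := by
  have hw : List.replicate (n - 2) ((s ^ 2)⁻¹) ++ [(s ^ 4)⁻¹] ++ List.replicate (n - 2) ((s ^ 2)⁻¹)
      ++ [1] = (1 :: ((List.replicate d ((s ^ 2)⁻¹) ++ [((s ^ 2) ^ 2)⁻¹]) ++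
        List.replicate d ((s ^ 2)⁻¹))).reverse := by
    have : n - 2 = d := by omega
    simp [this, ← pow_mul]
  have hl : (List.finRange n).map (fun i => xMinus s i 0) ++
      ((List.finRange n).drop 1).dropLast.reverse.map (fun i => xMinus s i 0) =
      fOp s n 0 :: (((List.range' 1 d).map (fOp s n) ++ [fOp s n (1 + d)]) ++
        (List.range' 1 d).reverse.map (fOp s n)) := by
    rw [map_drop_finRange hn, map_finRange_eq_range']
    have : List.range' 0 n = 0 :: (List.range' 1 d ++ [1 + d]) := by
      rw [hn, List.range'_succ, List.range'_concat]; simp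
    rw [this]
    rw [show (fun i => xMinus s (Fin.ofNat n i) 0) = fOp s n from rfl]
    simp
  rw [eZeroHat, hw, hl, show xMinus s (0 : Fin n) 1 = xOne s n 0 from rfl,
    nestedComm_append _ _ _ (by simp), List.zip_cons_cons, List.foldr_cons, core_eq_foldr]

theorem qComm_inv_swap {R : Type*} [Ring R] [Algebra K R] {v : K} (hv : v ≠ 0) (a b : R) :
    qComm v⁻¹ a b = -v⁻¹ • qComm v b a := by
  unfold qComm
  match_scalars <;> field_simp

theorem phiBar_succ (s : K) {n : ℕ} [NeZero n] (F : FormalDist K n) (k : ℕ) (r : ℤ) :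
    phiBar s F (k + 1) r = (-1 : K) • qComm (s ^ 2) (phiBar s F k r) (fOp s n k) := by
  simp only [phiBar]
  exact (neg_one_smul K (qComm (s ^ 2) (phiBar s F k r) (fOp s n k))).symm

/-- Each of the `2 d + 1` brackets is reversed by `qComm_inv_swap`. The `2 d` short ones contribute
`q^{-1/2}` each and the long one `q^{-1}`. The minus sign of the reversal is absorbed by the
recursion for the barred components and survives in the other `d + 1` brackets. -/
theorem core_phiBar {s : K} (hs : s ≠ 0) {n : ℕ} [NeZero n] (F : FormalDist K n) (r : ℤ)
    (d k : ℕ) (hk : k + d + 1 = n) :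
    core (s ^ 2) (fOp s n) d k (phiBar s F k r) =
      ((-1) ^ (d + 1) * ((s ^ 4) ^ (d + 1))⁻¹ : K) • phiDown s F d r := by
  have h4 : (s ^ 2) ^ 2 = s ^ 4 := by ring
  induction d generalizing k with
  | zero =>
    obtain rfl : k = n - 1 := by omega
    rw [core, adL_apply, h4, qComm_inv_swap (pow_ne_zero _ hs)]
    simp [phiDown]
  | succ d ih =>
    have e1 : qComm (s ^ 2)⁻¹ (fOp s n k) (phiBar s F k r) = (s ^ 2)⁻¹ • phiBar s F (k + 1) r := by
      rw [qComm_inv_swap (pow_ne_zero _ hs)]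
      rw [phiBar_succ, smul_smul, mul_neg_one]
    have e2 : qComm (s ^ 2)⁻¹ (fOp s n k) (phiDown s F d r) =
        -(s ^ 2)⁻¹ • phiDown s F (d + 1) r := by
      rw [qComm_inv_swap (pow_ne_zero _ hs), phiDown]
      congr 4; omega
    simp only [core, LinearMap.comp_apply]
    rw [adL_apply _ _ (phiBar s F k r), e1, map_smul, ih (k + 1) (by omega), map_smul,
      map_smul, adL_apply, e2]
    simp only [smul_smul]
    congr 1
    field_simp
    ring

/-- The action of `ê_0` on a vertex operator, from the relations with the currents. -/
theorem qComm_eZeroHat {s : K} (hs : s ≠ 0) (hs4 : s ^ 4 + 1 ≠ 0) {n : ℕ} [NeZero n]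
    (hn : 2 ≤ n) {F : FormalDist K n} (H : CurrentRels (s ^ 2) n (fOp s n) (xOne s n))
    (hf : ∀ r j, 0 < j → j < n → F r * fOp s n j = fOp s n j * F r)
    (hx : ∀ r j, 0 < j → j < n → F r * xOne s n j = xOne s n j * F r)
    (hS : ∀ r, SerreRel (s ^ 2) (F r) (fOp s n 0))
    (hR : ∀ r, qComm (s ^ 2)⁻¹ (F r) (xOne s n 0) =
      (s ^ 4) ^ n • qComm (s ^ 2) (F (r - 1)) (fOp s n 0)) (r : ℤ) :
    qComm ((s ^ 4)⁻¹) (F r) (eZeroHat s n) =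
      ((-1) ^ (n - 1) * (1 + s ^ 4) : K) • phiOne s F (r - 1) := by
  obtain ⟨d, rfl⟩ : ∃ d, n = d + 2 := ⟨n - 2, by omega⟩
  have h4 : (s ^ 2) ^ 2 = s ^ 4 := by ring
  have hp : s ^ 2 ≠ 0 := pow_ne_zero _ hs
  have hq := H.quadRel hp (by rwa [h4]) d 0 (by omega) (F r) (hS r) (hf r) (hx r)
  have hb : qComm (s ^ 2) (F (r - 1)) (fOp s (d + 2) 0) =
      (-1 : K) • phiBar s F 1 (r - 1) := by
    rw [phiBar_succ, smul_smul]
    simp [phiBar]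
  -- The factor `q^n` from `hR`, with `n = d + 2`, meets `q^{-(d+1)}` from `core_phiBar`, leaving a
  -- single `q`.
  have hB : qComm (s ^ 2)⁻¹ (F r) (core (s ^ 2) (fOp s (d + 2)) d 1 (xOne s (d + 2) 0)) =
      ((-1) ^ d * s ^ 4 : K) • phiDown s F d (r - 1) := by
    rw [qComm_core (fun j h1 h2 => hf r j (by omega) (by omega)), hR, hb, map_smul, map_smul,
      core_phiBar hs F (r - 1) d 1 (by omega), smul_smul, smul_smul]
    congr 1
    field_simp
    ring
  have hd : phiOne s F (r - 1) = qComm (s ^ 2) (phiDown s F d (r - 1)) (fOp s (d + 2) 0) := by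
    simp [phiOne, phiDown]
  have hc : ∀ (c : K) (X Y : Module.End K (Fock K (d + 2))),
      qComm (s ^ 2) (c • X) Y = c • qComm (s ^ 2) X Y := by
    intro c X Y
    simp [qComm, smul_sub, smul_comm c]
  -- What remains is `-(1 + q⁻¹) · (-1)^d q = (-1)^{d+1} (1 + q)`.
  rw [eZeroHat_eq s rfl, ← h4, hq.qComm_eq hp, hB, hd, hc, smul_smul]
  congr 1
  field_simp
  simp
  ring

end Chain

-- The Euler operator on power series over a noncommutative ring.

section EulerOp

variable {R : Type*} [Ring R]

/-- The Euler operator `X d/dX` on power series over a possibly noncommutative ring. -/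
def eulerOp (F : PowerSeries R) : PowerSeries R := PowerSeries.mk fun m => (m : R) * PowerSeries.coeff m F

theorem coeff_eulerOp (m : ℕ) (F : PowerSeries R) :
    PowerSeries.coeff m (eulerOp F) = (m : R) * PowerSeries.coeff m F := PowerSeries.coeff_mk _ _

theorem eulerOp_sub (F G : PowerSeries R) : eulerOp (F - G) = eulerOp F - eulerOp G := by
  ext m
  simp [coeff_eulerOp, mul_sub]

theorem eulerOp_mul (F G : PowerSeries R) :
    eulerOp (F * G) = eulerOp F * G + F * eulerOp G := by
  ext m
  simp only [coeff_eulerOp, map_add, PowerSeries.coeff_mul, Finset.mul_sum, ← Finset.sum_add_distrib]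
  refine Finset.sum_congr rfl fun x hx => ?_
  rw [← Finset.HasAntidiagonal.mem_antidiagonal.1 hx, Nat.cast_add, add_mul, mul_assoc, ← mul_assoc _ (x.2 : R),
    (Nat.cast_commute x.2 (PowerSeries.coeff x.1 F)).eq.symm, mul_assoc]

theorem eulerOp_C (a : R) : eulerOp (PowerSeries.C a) = 0 := by
  ext m
  rw [coeff_eulerOp, PowerSeries.coeff_C]
  split_ifs with h <;> simp [h]

theorem eulerOp_pow_succ {S : PowerSeries R} (h : Commute (eulerOp S) S) (j : ℕ) :
    eulerOp (S ^ (j + 1)) = (j + 1) • (eulerOp S * S ^ j) := by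
  induction j with
  | zero => simp
  | succ j ih =>
    rw [pow_succ, eulerOp_mul, ih, ← (h.pow_right (j + 1)).eq, smul_mul_assoc, mul_assoc, ← pow_succ,
      ← succ_nsmul]

/-- As `T` has no constant term, `m` times the `m`-th coefficient depends only on lower
coefficients, and `m` is invertible. Identities between exponentials below are proved by checking
that both sides solve the same equation. -/
theorem eulerOp_unique {K : Type*} [Field K] [CharZero K] [Algebra K R] {T F G : PowerSeries R}
    (hT : PowerSeries.coeff 0 T = 0) (hF : eulerOp F = T * F) (hG : eulerOp G = T * G)
    (h0 : PowerSeries.coeff 0 F = PowerSeries.coeff 0 G) : F = G := by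
  ext m
  induction m using Nat.strong_induction_on with
  | _ m ih =>
    obtain rfl | hm := Nat.eq_zero_or_pos m
    · exact h0
    · have e : (m : R) * PowerSeries.coeff m F = (m : R) * PowerSeries.coeff m G := by
        rw [← coeff_eulerOp, ← coeff_eulerOp, hF, hG, PowerSeries.coeff_mul, PowerSeries.coeff_mul]
        refine Finset.sum_congr rfl fun x hx => ?_
        obtain h | h := Nat.eq_zero_or_pos x.1
        · rw [h, hT, zero_mul, zero_mul]
        · rw [ih x.2 (by have := Finset.HasAntidiagonal.mem_antidiagonal.1 hx; omega)]
      have hK : (m : K) ≠ 0 := by exact_mod_cast hm.ne'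
      have := congrArg ((m : K)⁻¹ • ·) e
      simp only [← nsmul_eq_mul, ← Nat.cast_smul_eq_nsmul K, smul_smul, inv_mul_cancel₀ hK,
        one_smul] at this
      exact this

end EulerOp

-- Exponentials of oscillators and their exchange.

section ExpSeries

variable {K : Type*} [Field K] {n : ℕ}

/-- `∑_{k ≥ 1} A_k X ^ k`. -/
def opSeries (A : ℕ+ → Module.End K (Pol K n)) : PowerSeries (Module.End K (Pol K n)) :=
  PowerSeries.mk fun k => if hk : 0 < k then A ⟨k, hk⟩ else 0

theorem coeff_opSeries_zero (A : ℕ+ → Module.End K (Pol K n)) :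
    PowerSeries.coeff 0 (opSeries A) = 0 := by simp [opSeries]

theorem coeff_opSeries (A : ℕ+ → Module.End K (Pol K n)) (k : ℕ+) :
    PowerSeries.coeff (k : ℕ) (opSeries A) = A k := by
  rw [opSeries, PowerSeries.coeff_mk, dif_pos k.pos]
  rfl

theorem commute_series {R : Type*} [Ring R] {F G : PowerSeries R}
    (h : ∀ i j, Commute (PowerSeries.coeff i F) (PowerSeries.coeff j G)) : Commute F G := by
  ext m
  rw [PowerSeries.coeff_mul, PowerSeries.coeff_mul, ← Finset.Nat.sum_antidiagonal_swap]
  exact Finset.sum_congr rfl fun x _ => h _ _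

theorem commute_opSeries {A B : ℕ+ → Module.End K (Pol K n)} (h : ∀ k l, Commute (A k) (B l))
    (i j : ℕ) : Commute (PowerSeries.coeff i (opSeries A)) (PowerSeries.coeff j (opSeries B)) := by
  rw [opSeries, opSeries, PowerSeries.coeff_mk, PowerSeries.coeff_mk]
  split_ifs
  · exact h _ _
  all_goals simp

theorem coeff_pow_eq_zero {R : Type*} [Ring R] {S : PowerSeries R} (h : PowerSeries.coeff 0 S = 0)
    {m j : ℕ} (hm : m < j) : PowerSeries.coeff m (S ^ j) = 0 := by
  induction j generalizing m with
  | zero => omega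
  | succ j ih =>
    rw [pow_succ, PowerSeries.coeff_mul]
    refine Finset.sum_eq_zero fun x hx => ?_
    have := Finset.HasAntidiagonal.mem_antidiagonal.1 hx
    obtain h2 | h2 := Nat.eq_zero_or_pos x.2
    · rw [h2, h, mul_zero]
    · rw [ih (by omega), zero_mul]

/-- `exp (∑_{k ≥ 1} A_k X ^ k)`. -/
def expSeries (A : ℕ+ → Module.End K (Pol K n)) : PowerSeries (Module.End K (Pol K n)) :=
  PowerSeries.mk (expCoeff A)

theorem expCoeff_eq (A : ℕ+ → Module.End K (Pol K n)) {m M : ℕ} (h : m < M) :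
    expCoeff A m = ∑ j ∈ Finset.range M, ((j.factorial : K)⁻¹) •
      PowerSeries.coeff m (opSeries A ^ j) := by
  refine Finset.sum_subset (by simpa using h) fun j _ hj => ?_
  change _ • PowerSeries.coeff m (opSeries A ^ j) = 0
  rw [coeff_pow_eq_zero (coeff_opSeries_zero A) (by simpa using hj), smul_zero]

theorem expCoeff_zero (A : ℕ+ → Module.End K (Pol K n)) : expCoeff A 0 = 1 := by
  simp [expCoeff]

theorem coeff_expSeries_zero (A : ℕ+ → Module.End K (Pol K n)) :
    PowerSeries.coeff 0 (expSeries A) = 1 := by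
  rw [expSeries, PowerSeries.coeff_mk, expCoeff_zero]

theorem eulerOp_expSeries [CharZero K] {A : ℕ+ → Module.End K (Pol K n)} (h : ∀ k l, Commute (A k) (A l)) :
    eulerOp (expSeries A) = eulerOp (opSeries A) * expSeries A := by
  have hc : Commute (eulerOp (opSeries A)) (opSeries A) := commute_series fun i j => by
    rw [coeff_eulerOp]
    exact (Nat.cast_commute _ _).mul_left (commute_opSeries h i j)
  ext1 m
  rw [coeff_eulerOp, PowerSeries.coeff_mul, expSeries, PowerSeries.coeff_mk,
    -- One more term of the exponential is kept than on the right, because differentiation lowers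
    -- the power `j` by one.
    expCoeff_eq A (show m < m + 2 by omega), Finset.sum_range_succ']
  have e : ∀ x ∈ Finset.HasAntidiagonal.antidiagonal m, PowerSeries.coeff x.1 (eulerOp (opSeries A)) *
      PowerSeries.coeff x.2 (PowerSeries.mk (expCoeff A)) = ∑ j ∈ Finset.range (m + 1),
        ((j.factorial : K)⁻¹) • (PowerSeries.coeff x.1 (eulerOp (opSeries A)) *
          PowerSeries.coeff x.2 (opSeries A ^ j)) := fun x hx => by
    have := Finset.HasAntidiagonal.mem_antidiagonal.1 hx
    rw [PowerSeries.coeff_mk, expCoeff_eq A (show x.2 < m + 1 by omega), Finset.mul_sum]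
    exact Finset.sum_congr rfl fun j _ => mul_smul_comm _ _ _
  rw [Finset.sum_congr rfl e, Finset.sum_comm, mul_add, Finset.mul_sum]
  have z : (m : Module.End K (Pol K n)) * (((0 : ℕ).factorial : K)⁻¹ •
      PowerSeries.coeff m (opSeries A ^ 0)) = 0 := by
    rw [pow_zero, PowerSeries.coeff_one]
    split_ifs with hm <;> simp [hm]
  rw [z, add_zero]
  refine Finset.sum_congr rfl fun j _ => ?_
  rw [← Finset.smul_sum, ← PowerSeries.coeff_mul, mul_smul_comm, ← coeff_eulerOp,
    eulerOp_pow_succ hc, map_nsmul, ← Nat.cast_smul_eq_nsmul K, smul_smul, Nat.factorial_succ]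
  congr 1
  have : ((j + 1 : ℕ) : K) ≠ 0 := by exact_mod_cast j.succ_ne_zero
  push_cast at this ⊢
  field_simp

/-- By the Euler equation, `m` times the `m`-th coefficient is the sum of `k A_k` times the `(m -
k)`-th one. Induction along this avoids expanding powers of the series. -/
theorem expCoeff_induction [CharZero K] {A : ℕ+ → Module.End K (Pol K n)} (h : ∀ k l, Commute (A k) (A l))
    {P : ℕ → Module.End K (Pol K n) → Prop} (h1 : P 0 1)
    (hadd : ∀ m S T, P m S → P m T → P m (S + T)) (hz : ∀ m, P m 0)
    (hsmul : ∀ m (c : K) T, P m T → P m (c • T))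
    (hmul : ∀ (k : ℕ+) m T, P m T → P (k + m) (A k * T)) (m : ℕ) : P m (expCoeff A m) := by
  induction m using Nat.strong_induction_on with
  | _ m ih =>
    obtain rfl | hm := Nat.eq_zero_or_pos m
    · rwa [expCoeff_zero]
    · have hK : (m : K) ≠ 0 := by exact_mod_cast hm.ne'
      have e := congrArg (PowerSeries.coeff m) (eulerOp_expSeries h)
      rw [coeff_eulerOp, expSeries, PowerSeries.coeff_mk, ← nsmul_eq_mul,
        ← Nat.cast_smul_eq_nsmul K, PowerSeries.coeff_mul] at e
      rw [← inv_smul_smul₀ hK (expCoeff A m), e]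
      refine hsmul _ _ _ (Finset.sum_induction _ (P m) (hadd m) (hz m) fun x hx => ?_)
      have hx' := Finset.HasAntidiagonal.mem_antidiagonal.1 hx
      rw [coeff_eulerOp, PowerSeries.coeff_mk, ← nsmul_eq_mul, ← Nat.cast_smul_eq_nsmul K,
        smul_mul_assoc]
      refine hsmul _ _ _ ?_
      obtain h0 | h0 := Nat.eq_zero_or_pos x.1
      · rw [h0, coeff_opSeries_zero, zero_mul]
        exact hz m
      · have hk : PowerSeries.coeff x.1 (opSeries A) = A ⟨x.1, h0⟩ := coeff_opSeries A ⟨x.1, h0⟩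
        rw [hk, ← hx']
        exact hmul ⟨x.1, h0⟩ x.2 _ (ih _ (by omega))

theorem commute_expCoeff [CharZero K] {A : ℕ+ → Module.End K (Pol K n)} (h : ∀ k l, Commute (A k) (A l))
    {T : Module.End K (Pol K n)} (hT : ∀ k, Commute T (A k)) (m : ℕ) : Commute T (expCoeff A m) :=
  expCoeff_induction h (P := fun _ S => Commute T S) (Commute.one_right T)
    (fun _ _ _ => Commute.add_right) (fun _ => Commute.zero_right T)
    (fun _ c _ h => h.smul_right c) (fun k _ _ h => (hT k).mul_right h) m

/-- `expCoeff`, extended by zero to negative indices. -/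
def expCoeffInt (A : ℕ+ → Module.End K (Pol K n)) (l : ℤ) : Module.End K (Pol K n) :=
  if 0 ≤ l then expCoeff A l.toNat else 0

theorem expCoeffInt_natCast (A : ℕ+ → Module.End K (Pol K n)) (l : ℕ) :
    expCoeffInt A l = expCoeff A l := by simp [expCoeffInt]

theorem expCoeffInt_of_neg (A : ℕ+ → Module.End K (Pol K n)) {l : ℤ} (h : l < 0) :
    expCoeffInt A l = 0 := by simp [expCoeffInt, h]

theorem commute_expCoeffInt [CharZero K] {A : ℕ+ → Module.End K (Pol K n)}
    (h : ∀ k l, Commute (A k) (A l)) {T : Module.End K (Pol K n)} (hT : ∀ k, Commute T (A k))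
    (m : ℤ) : Commute T (expCoeffInt A m) := by
  rw [expCoeffInt]
  split_ifs
  · exact commute_expCoeff h hT _
  · exact Commute.zero_right _

/-- `[B_k, A_l] = δ_kl c_k`. -/
def IsContr (B A : ℕ+ → Module.End K (Pol K n)) (c : ℕ+ → K) : Prop :=
  ∀ k l, B k * A l - A l * B k = if k = l then c k • (1 : Module.End K (Pol K n)) else 0

/-- Bracketing with `B k` sends the Euler derivative of the exponent to the central series `k c_k
X^k`. Hence the difference of the two sides, as a series, solves the Euler equation of the
exponential with zero constant term. -/
theorem IsContr.comm_expCoeffInt [CharZero K] {A B : ℕ+ → Module.End K (Pol K n)} {c : ℕ+ → K}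
    (h : ∀ k l, Commute (A k) (A l)) (hc : IsContr B A c) (k : ℕ+) (l : ℤ) :
    B k * expCoeffInt A l - expCoeffInt A l * B k = c k • expCoeffInt A (l - k) := by
  have hE := eulerOp_expSeries h
  have hS0 := coeff_opSeries_zero A
  have hS := coeff_opSeries A
  have hE0 := coeff_expSeries_zero A
  have hEl : ∀ l, PowerSeries.coeff l (expSeries A) = expCoeff A l := fun l =>
    PowerSeries.coeff_mk _ _
  generalize opSeries A = S at *
  generalize expSeries A = E at *
  let CB : PowerSeries (Module.End K (Pol K n)) := PowerSeries.C (B k)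
  let Y : PowerSeries (Module.End K (Pol K n)) :=
    PowerSeries.X ^ (k : ℕ) * PowerSeries.C (c k • 1)
  have hYc : ∀ F : PowerSeries (Module.End K (Pol K n)), F * Y = Y * F := fun F => by
    have h1 : Commute F (PowerSeries.X ^ (k : ℕ)) := (PowerSeries.commute_X_pow F k)
    have h2 : Commute F (PowerSeries.C (c k • (1 : Module.End K (Pol K n)))) := by
      refine commute_series fun i j => ?_
      rw [PowerSeries.coeff_C]
      split_ifs
      · exact (Commute.one_right _).smul_right _
      · exact Commute.zero_right _
    exact h1.mul_right h2
  have hYe : eulerOp Y = (k : ℕ) • Y := by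
    ext1 m
    rw [coeff_eulerOp, map_nsmul, PowerSeries.coeff_X_pow_mul', nsmul_eq_mul, PowerSeries.coeff_C]
    split_ifs with h1 h2
    · rw [show m = k by omega]
    all_goals simp
  have hBS : CB * eulerOp S - eulerOp S * CB = (k : ℕ) • Y := by
    ext1 m
    rw [map_sub, map_nsmul, PowerSeries.coeff_C_mul, PowerSeries.coeff_mul_C, coeff_eulerOp,
      PowerSeries.coeff_X_pow_mul', PowerSeries.coeff_C, ← nsmul_eq_mul, mul_smul_comm,
      smul_mul_assoc, ← nsmul_sub]
    obtain h0 | h0 := Nat.eq_zero_or_pos m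
    · rw [h0, hS0]
      simp
    · obtain ⟨m, rfl⟩ : ∃ m' : ℕ+, (m' : ℕ) = m := ⟨⟨m, h0⟩, rfl⟩
      rw [hS, hc]
      split_ifs with h1 h2 h3 h3
      · rw [h1]
      · exact absurd (by rw [h1, Nat.sub_self]) h3
      · exact absurd (by rw [h1]) h2
      · exact absurd (PNat.eq (by omega)) h1
      all_goals simp
  have key : CB * E - E * CB - Y * E = 0 := by
    refine eulerOp_unique (K := K) (T := eulerOp S) (by simp [coeff_eulerOp]) ?_ ?_ ?_
    · have e0 : eulerOp CB = 0 := eulerOp_C _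
      rw [eulerOp_sub, eulerOp_sub, eulerOp_mul, eulerOp_mul, eulerOp_mul, hE, hYe, e0, zero_mul,
        mul_zero, ← hBS, ← mul_assoc Y, ← hYc]
      simp only [sub_mul, mul_sub, mul_assoc]
      abel
    · rw [mul_zero]
      ext1 m
      simp [coeff_eulerOp]
    · have hY0 : PowerSeries.coeff 0 Y = 0 := by
        rw [PowerSeries.coeff_X_pow_mul', if_neg (by simp)]
      rw [map_sub, map_sub, PowerSeries.coeff_C_mul, PowerSeries.coeff_mul_C, hE0,
        PowerSeries.coeff_mul]
      simp [hY0]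
  obtain hl | hl := lt_or_ge l 0
  · rw [expCoeffInt_of_neg A hl, expCoeffInt_of_neg A (by have := k.pos; omega)]
    simp
  · lift l to ℕ using hl
    have := congrArg (PowerSeries.coeff l) key
    rw [map_sub, map_sub, PowerSeries.coeff_C_mul, PowerSeries.coeff_mul_C, map_zero,
      sub_eq_zero, mul_assoc, PowerSeries.coeff_X_pow_mul', PowerSeries.coeff_C_mul, hEl] at this
    rw [expCoeffInt_natCast, this]
    split_ifs with hk
    · rw [hEl, show (l : ℤ) - (k : ℕ) = ((l - k : ℕ) : ℤ) by omega, expCoeffInt_natCast,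
        smul_mul_assoc, one_mul]
    · rw [expCoeffInt_of_neg A (by omega), smul_zero]

/-- The coefficients of `(1 - a X) / (1 - b X)`. -/
def ratioCoeff (a b : K) : ℕ → K
  | 0 => 1
  | i + 1 => (b - a) * b ^ i

/-- This is the logarithmic derivative of `(1 - a X) / (1 - b X)`, namely `∑ (b^k - a^k) X^k`,
written in coefficients. -/
theorem sum_antidiagonal_ratioCoeff (a b : K) (m : ℕ) :
    ∑ x ∈ Finset.HasAntidiagonal.antidiagonal m, (b ^ x.1 - a ^ x.1) * ratioCoeff a b x.2 =
      m * ratioCoeff a b m := by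
  cases m with
  | zero => simp
  | succ m =>
    have h := geom_sum₂_mul a b (m + 1)
    have h2 := Finset.Nat.sum_antidiagonal_eq_sum_range_succ (fun i j => a ^ i * b ^ j) m
    simp only [Nat.add_sub_cancel] at h
    rw [← h2] at h
    rw [Finset.Nat.sum_antidiagonal_succ']
    have e : ∀ x ∈ Finset.HasAntidiagonal.antidiagonal m,
        (b ^ x.1 - a ^ x.1) * ratioCoeff a b (x.2 + 1) =
          (b - a) * b ^ m - a ^ x.1 * b ^ x.2 * (b - a) := fun x hx => by
      rw [ratioCoeff, ← Finset.HasAntidiagonal.mem_antidiagonal.1 hx, pow_add]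
      ring
    rw [Finset.sum_congr rfl e, Finset.sum_sub_distrib, ← Finset.sum_mul, Finset.sum_const,
      Finset.Nat.card_antidiagonal]
    simp only [ratioCoeff, nsmul_eq_mul]
    rw [← Finset.sum_mul]
    push_cast
    linear_combination h

/-- Both sides solve the Euler equation of the exponential of `B`. For the right side the
contractions `k c_k = b^k - a^k` produce the logarithmic derivative of the rational factor. -/
theorem exp_exchange_series [CharZero K] {A B : ℕ+ → Module.End K (Pol K n)} {c : ℕ+ → K} {a b : K}
    (hA : ∀ k l, Commute (A k) (A l)) (hB : ∀ k l, Commute (B k) (B l)) (hc : IsContr B A c)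
    (hab : ∀ k : ℕ+, ((k : ℕ) : K) * c k = b ^ (k : ℕ) - a ^ (k : ℕ)) (l : ℤ) :
    expSeries B * PowerSeries.C (expCoeffInt A l) =
      PowerSeries.mk (fun i => ratioCoeff a b i • expCoeffInt A (l - i)) * expSeries B := by
  have hE := eulerOp_expSeries hB
  have hE0 := coeff_expSeries_zero B
  have hS0 := coeff_opSeries_zero B
  have hS := coeff_opSeries B
  generalize opSeries B = S at *
  generalize expSeries B = D at *
  set H := PowerSeries.mk (fun i : ℕ => ratioCoeff a b i • expCoeffInt A (l - i)) with hH
  have hHe : eulerOp H = eulerOp S * H - H * eulerOp S := by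
    ext1 m
    rw [map_sub, PowerSeries.coeff_mul, PowerSeries.coeff_mul, ← Finset.Nat.sum_antidiagonal_swap,
      ← Finset.sum_sub_distrib, coeff_eulerOp, hH, PowerSeries.coeff_mk, ← nsmul_eq_mul,
      ← Nat.cast_smul_eq_nsmul K, smul_smul, ← sum_antidiagonal_ratioCoeff, Finset.sum_smul,
      ← Finset.Nat.sum_antidiagonal_swap]
    refine Finset.sum_congr rfl fun x hx => ?_
    have hx' := Finset.HasAntidiagonal.mem_antidiagonal.1 hx
    simp only [Prod.fst_swap, Prod.snd_swap, coeff_eulerOp, PowerSeries.coeff_mk]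
    obtain h0 | h0 := Nat.eq_zero_or_pos x.2
    · simp [h0]
    · obtain ⟨k, hk⟩ : ∃ k : ℕ+, (k : ℕ) = x.2 := ⟨⟨x.2, h0⟩, rfl⟩
      have e := hc.comm_expCoeffInt hA k (l - x.1)
      rw [← hk, hS, ← nsmul_eq_mul, ← Nat.cast_smul_eq_nsmul K, mul_smul_comm, smul_mul_assoc,
        mul_smul_comm, smul_mul_assoc, ← hab]
      rw [show l - (x.1 : ℤ) - ((k : ℕ) : ℤ) = l - m by omega] at e
      linear_combination (norm := module) (-((k : ℕ) : K) * ratioCoeff a b x.1) • e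
  refine eulerOp_unique (K := K) (T := eulerOp S) (by simp [coeff_eulerOp]) ?_ ?_ ?_
  · rw [eulerOp_mul, eulerOp_C, hE, mul_zero, add_zero, mul_assoc]
  · rw [eulerOp_mul, hHe, hE]
    simp only [sub_mul, mul_assoc]
    abel
  · rw [PowerSeries.coeff_mul_C, hE0, PowerSeries.coeff_mul]
    simp [hH, hE0, ratioCoeff]

/-- The denominator `1 - b X` is cleared, so that only finitely many terms remain on each side. -/
theorem exp_exchange [CharZero K] {A B : ℕ+ → Module.End K (Pol K n)} {c : ℕ+ → K} {a b : K}
    (hA : ∀ k l, Commute (A k) (A l)) (hB : ∀ k l, Commute (B k) (B l)) (hc : IsContr B A c)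
    (hab : ∀ k : ℕ+, ((k : ℕ) : K) * c k = b ^ (k : ℕ) - a ^ (k : ℕ)) (l : ℤ) (m : ℕ) :
    expCoeff B (m + 1) * expCoeffInt A l - b • (expCoeff B m * expCoeffInt A (l - 1)) =
      expCoeffInt A l * expCoeff B (m + 1) - a • (expCoeffInt A (l - 1) * expCoeff B m) := by
  have key : ∀ l m, expCoeff B m * expCoeffInt A l =
      ∑ x ∈ Finset.HasAntidiagonal.antidiagonal m,
        ratioCoeff a b x.1 • (expCoeffInt A (l - x.1) * expCoeff B x.2) := fun l m => by
    have := congrArg (PowerSeries.coeff m) (exp_exchange_series hA hB hc hab l)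
    rw [PowerSeries.coeff_mul_C, expSeries, PowerSeries.coeff_mk, PowerSeries.coeff_mul] at this
    simpa only [PowerSeries.coeff_mk, smul_mul_assoc] using this
  rw [key, key, Finset.Nat.sum_antidiagonal_succ, Finset.smul_sum, add_sub_assoc,
    ← Finset.sum_sub_distrib, Finset.sum_eq_single (0, m)]
  · simp only [ratioCoeff]
    push_cast
    simp only [sub_zero]
    match_scalars <;> ring
  · rintro ⟨i, j⟩ hx hne
    have hx' := Finset.HasAntidiagonal.mem_antidiagonal.1 hx
    obtain _ | i := i
    · exact absurd (by simp_all) hne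
    · simp only [ratioCoeff]
      rw [smul_smul, show l - ((i + 1 + 1 : ℕ) : ℤ) = l - 1 - ((i + 1 : ℕ) : ℤ) by push_cast; ring]
      match_scalars
      ring
  · simp

end ExpSeries

-- Modes of normally ordered exponentials on the polynomial algebra.

section Modes

variable {K : Type*} [Field K] {n : ℕ}

/-- The degree of a creation operator. -/
def oscDeg (o : Osc n) : ℕ := Sum.elim (fun p => (p.2 : ℕ)) (fun p => (p.2 : ℕ)) o

/-- The `A k` are operators of multiplication. -/
def IsUp (A : ℕ+ → Module.End K (Pol K n)) : Prop :=
  ∃ f : ℕ+ → Pol K n, ∀ k, A k = LinearMap.mulLeft K (f k)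

/-- The derivation which maps the generators `X o` of degree `k` to `β o`. -/
def lowerDer (β : Osc n → K) (k : ℕ+) : Derivation K (Pol K n) (Pol K n) :=
  MvPolynomial.mkDerivation K fun o => if oscDeg o = k then MvPolynomial.C (β o) else 0

/-- The `B k` are derivations that lower the degree by `k` and map generators to constants. -/
def IsDn (B : ℕ+ → Module.End K (Pol K n)) : Prop :=
  ∃ β : Osc n → K, ∀ k, B k = (lowerDer β k).toLinearMap

theorem IsUp.commute {A A' : ℕ+ → Module.End K (Pol K n)} (h : IsUp A) (h' : IsUp A') (k l : ℕ+) :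
    Commute (A k) (A' l) := by
  obtain ⟨f, hf⟩ := h
  obtain ⟨f', hf'⟩ := h'
  rw [hf, hf']
  refine LinearMap.ext fun p => ?_
  simp [Module.End.mul_apply, mul_left_comm]

/-- The commutator of two derivations is a derivation, and it vanishes on the generators because
each factor sends them to constants. -/
theorem IsDn.commute {B B' : ℕ+ → Module.End K (Pol K n)} (h : IsDn B) (h' : IsDn B') (k l : ℕ+) :
    Commute (B k) (B' l) := by
  obtain ⟨β, hβ⟩ := h
  obtain ⟨β', hβ'⟩ := h'
  have : ⁅lowerDer β k, lowerDer β' l⁆ = 0 := by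
    refine MvPolynomial.derivation_ext fun o => ?_
    rw [Derivation.commutator_apply]
    simp only [lowerDer, MvPolynomial.mkDerivation_X]
    split_ifs <;> simp
  rw [hβ, hβ']
  refine LinearMap.ext fun p => ?_
  have h := congrArg (fun D => D p) this
  rw [Derivation.commutator_apply, Derivation.zero_apply, sub_eq_zero] at h
  exact h

/-- The span of the monomials of degree `z`. -/
def gradePiece (K : Type*) [Field K] (n : ℕ) (z : ℤ) : Submodule K (Pol K n) :=
  Submodule.span K {p | ∃ d : Osc n →₀ ℕ, (monDegree d : ℤ) = z ∧ p = MvPolynomial.monomial d 1}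

theorem monomial_mem_gradePiece (d : Osc n →₀ ℕ) (c : K) {z : ℤ} (h : (monDegree d : ℤ) = z) :
    MvPolynomial.monomial d c ∈ gradePiece K n z := by
  have : MvPolynomial.monomial d c = c • MvPolynomial.monomial d 1 := by
    rw [MvPolynomial.smul_monomial, smul_eq_mul, mul_one]
  rw [this]
  exact Submodule.smul_mem _ _ (Submodule.subset_span ⟨d, h, rfl⟩)

theorem eq_zero_of_mem_gradePiece {z : ℤ} (hz : z < 0) {p : Pol K n} (hp : p ∈ gradePiece K n z) :
    p = 0 := by
  have : {p : Pol K n | ∃ d : Osc n →₀ ℕ, (monDegree d : ℤ) = z ∧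
      p = MvPolynomial.monomial d 1} = ∅ := by
    ext p
    simp only [Set.mem_ofPred_eq, Set.mem_empty_iff_false, iff_false]
    rintro ⟨d, h, -⟩
    omega
  rw [gradePiece, this, Submodule.span_empty] at hp
  simpa using hp

theorem monDegree_sub_single (d : Osc n →₀ ℕ) (o : Osc n) (ho : d o ≠ 0) :
    (monDegree (d - Finsupp.single o 1) : ℤ) = monDegree d - oscDeg o := by
  have h : d = (d - Finsupp.single o 1) + Finsupp.single o 1 := by
    rw [tsub_add_cancel_of_le]
    rw [Finsupp.single_le_iff]
    omega
  have e : monDegree d = monDegree (d - Finsupp.single o 1) + oscDeg o := by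
    conv_lhs => rw [h]
    rw [monDegree, monDegree, Finsupp.sum_add_index' (by simp) (by intros; ring),
      Finsupp.sum_single_index (by simp), one_mul]
    rfl
  omega

theorem lowerDer_mem_gradePiece (β : Osc n → K) (k : ℕ+) {z : ℤ} {p : Pol K n}
    (hp : p ∈ gradePiece K n z) : lowerDer β k p ∈ gradePiece K n (z - (k : ℕ)) := by
  induction hp using Submodule.span_induction with
  | mem p hp =>
    obtain ⟨d, rfl, rfl⟩ := hp
    rw [lowerDer, MvPolynomial.mkDerivation_monomial, one_smul]
    refine Submodule.sum_mem _ fun o ho => ?_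
    simp only [smul_eq_mul]
    split_ifs with h
    · rw [mul_comm, MvPolynomial.C_mul_monomial]
      refine monomial_mem_gradePiece _ _ ?_
      rw [monDegree_sub_single d o (Finsupp.mem_support_iff.1 ho), h]
    · rw [mul_zero]
      exact Submodule.zero_mem _
  | zero => rw [map_zero]; exact Submodule.zero_mem _
  | add p p' _ _ h h' => rw [map_add]; exact Submodule.add_mem _ h h'
  | smul c p _ h => rw [Derivation.map_smul]; exact Submodule.smul_mem _ _ h

theorem IsDn.expCoeff_mem [CharZero K] {B : ℕ+ → Module.End K (Pol K n)} (h : IsDn B) (m : ℕ)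
    {z : ℤ} {p : Pol K n} (hp : p ∈ gradePiece K n z) :
    expCoeff B m p ∈ gradePiece K n (z - m) := by
  refine expCoeff_induction (h.commute h)
    (P := fun m S => ∀ z : ℤ, ∀ p ∈ gradePiece K n z, S p ∈ gradePiece K n (z - m))
    ?_ ?_ ?_ ?_ ?_ m z p hp
  · intro z p hp
    simpa using hp
  · intro m S T hS hT z p hp
    exact Submodule.add_mem _ (hS z p hp) (hT z p hp)
  · intro m z p _
    exact Submodule.zero_mem _
  · intro m c T hT z p hp
    exact Submodule.smul_mem _ _ (hT z p hp)
  · intro k m T hT z p hp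
    obtain ⟨β, hβ⟩ := h
    rw [hβ, show z - ((k + m : ℕ) : ℤ) = z - m - (k : ℕ) by push_cast; ring]
    exact lowerDer_mem_gradePiece β k (hT z p hp)

/-- `T m` kills all monomials of degree less than `m`. -/
def LocallyFinite (T : ℕ → Module.End K (Pol K n)) : Prop :=
  ∀ (d : Osc n →₀ ℕ) (m : ℕ), monDegree d < m → T m (MvPolynomial.monomial d 1) = 0

theorem IsDn.locallyFinite [CharZero K] {B : ℕ+ → Module.End K (Pol K n)} (h : IsDn B) :
    LocallyFinite (expCoeff B) := fun d m hd =>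
  eq_zero_of_mem_gradePiece (z := (monDegree d : ℤ) - m) (by omega)
    (h.expCoeff_mem m (monomial_mem_gradePiece d 1 rfl))

theorem LocallyFinite.comp {T : ℕ → Module.End K (Pol K n)} (h : LocallyFinite T)
    (S : ℕ → Module.End K (Pol K n)) : LocallyFinite (fun m => S m * T m) := fun d m hd => by
  rw [Module.End.mul_apply, h d m hd, map_zero]

theorem LocallyFinite.exists_bound {T : ℕ → Module.End K (Pol K n)} (h : LocallyFinite T)
    (p : Pol K n) : ∃ M, ∀ m, M ≤ m → T m p = 0 := by
  refine ⟨p.support.sup monDegree + 1, fun m hm => ?_⟩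
  conv_lhs => rw [p.as_sum]
  rw [map_sum]
  refine Finset.sum_eq_zero fun d hd => ?_
  have : MvPolynomial.monomial d (p.coeff d) = p.coeff d • MvPolynomial.monomial d 1 := by
    rw [MvPolynomial.smul_monomial, smul_eq_mul, mul_one]
  have hle : monDegree d ≤ p.support.sup monDegree := Finset.le_sup hd
  rw [this, map_smul, h d m (by omega), smul_zero]

/-- The operator `∑_m T m`, for a locally finite family. -/
def locSum (T : ℕ → Module.End K (Pol K n)) : Module.End K (Pol K n) :=
  (MvPolynomial.basisMonomials (Osc n) K).constr K fun d =>
    ∑ m ∈ Finset.range (monDegree d + 1), T m (MvPolynomial.monomial d 1)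

/-- The cutoff in the definition depends on the monomial; this allows any cutoff valid for the given
polynomial, so that several sums can be compared over a common range. -/
theorem LocallyFinite.locSum_apply {T : ℕ → Module.End K (Pol K n)} (h : LocallyFinite T)
    {p : Pol K n} {M : ℕ} (hM : ∀ m, M ≤ m → T m p = 0) :
    locSum T p = ∑ m ∈ Finset.range M, T m p := by
  have hmon : ∀ (d : Osc n →₀ ℕ) (N : ℕ), monDegree d < N → locSum T (MvPolynomial.monomial d 1) =
      ∑ m ∈ Finset.range N, T m (MvPolynomial.monomial d 1) := fun d N hN => by
    have e := (MvPolynomial.basisMonomials (Osc n) K).constr_basis K (fun d =>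
      ∑ m ∈ Finset.range (monDegree d + 1), T m (MvPolynomial.monomial d 1)) d
    rw [MvPolynomial.coe_basisMonomials] at e
    rw [locSum, e]
    refine Finset.sum_subset (by simpa using hN) fun m _ hm => h d m ?_
    simpa [Nat.lt_succ_iff] using hm
  have hN : ∀ N, p.support.sup monDegree < N → locSum T p = ∑ m ∈ Finset.range N, T m p :=
      fun N hN => by
    conv_lhs => rw [p.as_sum]
    conv_rhs => rw [p.as_sum]
    simp only [map_sum]
    rw [Finset.sum_comm]
    refine Finset.sum_congr rfl fun d hd => ?_
    have : MvPolynomial.monomial d (p.coeff d) = p.coeff d • MvPolynomial.monomial d 1 := by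
      rw [MvPolynomial.smul_monomial, smul_eq_mul, mul_one]
    simp only [this, map_smul]
    rw [hmon d N ((Finset.le_sup hd).trans_lt hN), Finset.smul_sum]
  rw [hN (p.support.sup monDegree + 1 + M) (by omega)]
  symm
  refine Finset.sum_subset (by simp) fun m _ hm => hM m ?_
  simpa using hm

theorem expMode_eq_locSum (A B : ℕ+ → Module.End K (Pol K n)) (r : ℤ) :
    expMode A B r = locSum fun m => expCoeffInt A (r + m) * expCoeff B m := by
  unfold expMode locSum expCoeffInt
  congr 1
  funext d
  refine Finset.sum_congr rfl fun m _ => ?_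
  by_cases h : 0 ≤ r + (m : ℤ) <;> simp [h]

theorem IsDn.expMode_apply [CharZero K] {B : ℕ+ → Module.End K (Pol K n)} (h : IsDn B)
    (A : ℕ+ → Module.End K (Pol K n)) (r : ℤ) {p : Pol K n} {M : ℕ}
    (hM : ∀ m, M ≤ m → expCoeff B m p = 0) :
    expMode A B r p = ∑ m ∈ Finset.range M, expCoeffInt A (r + m) (expCoeff B m p) := by
  rw [expMode_eq_locSum, (h.locallyFinite.comp _).locSum_apply (M := M)]
  · rfl
  · intro m hm
    rw [Module.End.mul_apply, hM m hm, map_zero]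

theorem commute_expMode [CharZero K] {A B : ℕ+ → Module.End K (Pol K n)} (hA : IsUp A)
    (hB : IsDn B) {T : Module.End K (Pol K n)} (hTA : ∀ k, Commute T (A k))
    (hTB : ∀ k, Commute T (B k)) (r : ℤ) : Commute T (expMode A B r) := by
  refine LinearMap.ext fun p => ?_
  have cA := fun l => LinearMap.congr_fun (commute_expCoeffInt (hA.commute hA) hTA l).eq
  have cB := fun l => LinearMap.congr_fun (commute_expCoeff (hB.commute hB) hTB l).eq
  simp only [Module.End.mul_apply] at cA cB ⊢
  obtain ⟨M, hM⟩ := hB.locallyFinite.exists_bound p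
  have hM' : ∀ m, M ≤ m → expCoeff B m (T p) = 0 := fun m hm => by rw [← cB, hM m hm, map_zero]
  rw [hB.expMode_apply A r hM, hB.expMode_apply A r hM', map_sum]
  refine Finset.sum_congr rfl fun m _ => ?_
  rw [cA, cB]

/-- Moving a field past the creation part of another one. -/
theorem expMode_mul_expCoeffInt [CharZero K] {A B A' : ℕ+ → Module.End K (Pol K n)} {c : ℕ+ → K}
    {a b : K} (hA : IsUp A) (hB : IsDn B) (hA' : IsUp A') (hc : IsContr B A' c)
    (hab : ∀ k : ℕ+, ((k : ℕ) : K) * c k = b ^ (k : ℕ) - a ^ (k : ℕ)) (r l : ℤ) :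
    expMode A B r * expCoeffInt A' l - b • (expMode A B (r + 1) * expCoeffInt A' (l - 1)) =
      expCoeffInt A' l * expMode A B r - a • (expCoeffInt A' (l - 1) * expMode A B (r + 1)) := by
  refine LinearMap.ext fun p => ?_
  have cA := fun i j => LinearMap.congr_fun (commute_expCoeffInt (hA.commute hA)
    (fun k => (commute_expCoeffInt (hA'.commute hA') (fun l => hA.commute hA' k l) j).symm) i).eq
  have ex := fun m => LinearMap.congr_fun
    (exp_exchange (hA'.commute hA') (hB.commute hB) hc hab l m)
  simp only [Module.End.mul_apply, LinearMap.sub_apply, LinearMap.smul_apply] at cA ex ⊢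
  obtain ⟨M₁, h₁⟩ := hB.locallyFinite.exists_bound p
  obtain ⟨M₂, h₂⟩ := hB.locallyFinite.exists_bound (expCoeffInt A' l p)
  obtain ⟨M₃, h₃⟩ := hB.locallyFinite.exists_bound (expCoeffInt A' (l - 1) p)
  set M := M₁ + M₂ + M₃
  -- The ranges `M + 1` and `M` match the indices `m + 1` and `m` in `exp_exchange`; the remaining
  -- `m = 0` term is the commutation of the creation parts.
  rw [hB.expMode_apply A r (M := M + 1) (fun m hm => h₂ m (by omega)),
    hB.expMode_apply A (r + 1) (M := M) (fun m hm => h₃ m (by omega)),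
    hB.expMode_apply A r (M := M + 1) (fun m hm => h₁ m (by omega)),
    hB.expMode_apply A (r + 1) (M := M) (fun m hm => h₁ m (by omega)),
    Finset.sum_range_succ', Finset.sum_range_succ', map_add, map_sum, map_sum, Finset.smul_sum,
    Finset.smul_sum, add_sub_right_comm, add_sub_right_comm, ← Finset.sum_sub_distrib,
    ← Finset.sum_sub_distrib]
  congr 1
  · refine Finset.sum_congr rfl fun m _ => ?_
    rw [show r + ((m + 1 : ℕ) : ℤ) = r + 1 + m by push_cast; ring, ← map_smul, ← map_sub, ex, cA,
      cA, map_sub, map_smul]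
  · rw [expCoeff_zero, Module.End.one_apply, Module.End.one_apply, cA]

/-- Both families of a normally ordered exponential consist of operators of the right kind. -/
structure NExp.Good (U : NExp K n) : Prop where
  up : IsUp U.up
  dn : IsDn U.dn

/-- The modes of the normally ordered product of two fields in two variables. -/
def noMode (U V : NExp K n) (r t : ℤ) : Module.End K (Pol K n) :=
  locSum fun m => expCoeffInt V.up (t + m) * expMode U.up U.dn r * expCoeff V.dn m

theorem noMode_apply [CharZero K] {U V : NExp K n} (hV : V.Good) (r t : ℤ) {p : Pol K n} {M : ℕ}
    (hM : ∀ m, M ≤ m → expCoeff V.dn m p = 0) :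
    noMode U V r t p = ∑ m ∈ Finset.range M,
      expCoeffInt V.up (t + m) (expMode U.up U.dn r (expCoeff V.dn m p)) := by
  rw [noMode, (hV.dn.locallyFinite.comp _).locSum_apply (M := M)]
  · rfl
  · intro m hm
    rw [Module.End.mul_apply, hM m hm, map_zero]

/-- Only the annihilation part of `U` and the creation part of `V` fail to commute. Each term of the
sum over the annihilation part of `V` is an instance of `expMode_mul_expCoeffInt`. -/
theorem expMode_mul_expMode [CharZero K] {U V : NExp K n} (hU : U.Good) (hV : V.Good) {c : ℕ+ → K}
    {a b : K} (hc : IsContr U.dn V.up c)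
    (hab : ∀ k : ℕ+, ((k : ℕ) : K) * c k = b ^ (k : ℕ) - a ^ (k : ℕ)) (r t : ℤ) :
    expMode U.up U.dn r * expMode V.up V.dn t
        - b • (expMode U.up U.dn (r + 1) * expMode V.up V.dn (t - 1)) =
      noMode U V r t - a • noMode U V (r + 1) (t - 1) := by
  refine LinearMap.ext fun p => ?_
  obtain ⟨M, hM⟩ := hV.dn.locallyFinite.exists_bound p
  have ex := fun l => LinearMap.congr_fun
    (expMode_mul_expCoeffInt hU.up hU.dn hV.up hc hab r l)
  simp only [Module.End.mul_apply, LinearMap.sub_apply, LinearMap.smul_apply] at ex ⊢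
  rw [noMode_apply hV _ _ hM, noMode_apply hV _ _ hM, hV.dn.expMode_apply _ _ hM,
    hV.dn.expMode_apply _ _ hM, map_sum, map_sum, Finset.smul_sum, Finset.smul_sum,
    ← Finset.sum_sub_distrib, ← Finset.sum_sub_distrib]
  refine Finset.sum_congr rfl fun m _ => ?_
  rw [show t - 1 + (m : ℤ) = t + m - 1 by ring]
  exact ex (t + m) (expCoeff V.dn m p)

/-- In the normally ordered product all creation parts stand to the left of all annihilation parts,
and within either group everything commutes. -/
theorem noMode_comm [CharZero K] {U V : NExp K n} (hU : U.Good) (hV : V.Good) (r t : ℤ) :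
    noMode U V r t = noMode V U t r := by
  refine LinearMap.ext fun p => ?_
  obtain ⟨M₁, h₁⟩ := hU.dn.locallyFinite.exists_bound p
  obtain ⟨M₂, h₂⟩ := hV.dn.locallyFinite.exists_bound p
  have cD := fun i j => LinearMap.congr_fun (commute_expCoeff (hU.dn.commute hU.dn)
    (fun k => (commute_expCoeff (hV.dn.commute hV.dn) (fun l => hU.dn.commute hV.dn k l) j).symm)
    i).eq
  have cE := fun i j => LinearMap.congr_fun (commute_expCoeffInt (hU.up.commute hU.up)
    (fun k => (commute_expCoeffInt (hV.up.commute hV.up) (fun l => hU.up.commute hV.up k l) j).symm)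
    i).eq
  simp only [Module.End.mul_apply] at cD cE
  have h₁' : ∀ m', ∀ m, M₁ + M₂ ≤ m → expCoeff U.dn m (expCoeff V.dn m' p) = 0 := fun m' m hm => by
    rw [← cD, h₁ m (by omega), map_zero]
  have h₂' : ∀ m', ∀ m, M₁ + M₂ ≤ m → expCoeff V.dn m (expCoeff U.dn m' p) = 0 := fun m' m hm => by
    rw [cD, h₂ m (by omega), map_zero]
  rw [noMode_apply hV r t (M := M₁ + M₂) (fun m hm => h₂ m (by omega)),
    noMode_apply hU t r (M := M₁ + M₂) (fun m hm => h₁ m (by omega))]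
  simp only [fun m => hU.dn.expMode_apply U.up r (h₁' m), fun m => hV.dn.expMode_apply V.up t (h₂' m),
    map_sum]
  rw [Finset.sum_comm]
  refine Finset.sum_congr rfl fun m _ => Finset.sum_congr rfl fun m' _ => ?_
  rw [cE, cD]

end Modes

-- Operator products and truncation on the total Fock space.

section Fields

variable {K : Type*} [Field K] {n : ℕ}

/-- Translation of a vacuum label. -/
def Charge.translate (c : Charge n) (t : (Fin n → ℤ) × (Fin n → ℤ)) : Charge n :=
  ⟨c.fst + t.1, c.half, c.snd + t.2⟩

theorem Charge.translate_comm (c : Charge n) (t t' : (Fin n → ℤ) × (Fin n → ℤ)) :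
    (c.translate t).translate t' = (c.translate t').translate t := by
  simp [Charge.translate, add_right_comm]

theorem NExp.field_single (U : NExp K n) (r : ℤ) (c : Charge n) (p : Pol K n) :
    U.field r (Finsupp.single c p) =
      Finsupp.single (c.translate U.shift) (U.coef c • expMode U.up U.dn (r - U.expo c) p) := by
  simp [NExp.field, Charge.translate]

/-- The modes of the normally ordered product of two fields, on the Fock space. -/
def noField (U V : NExp K n) (r t : ℤ) : Module.End K (Fock K n) :=
  Finsupp.lsum K fun c : Charge n =>
    (Finsupp.lsingle ((c.translate U.shift).translate V.shift)).comp
      ((U.coef c * V.coef c) • noMode U V (r - U.expo c) (t - V.expo c))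

theorem noField_single (U V : NExp K n) (r t : ℤ) (c : Charge n) (p : Pol K n) :
    noField U V r t (Finsupp.single c p) =
      Finsupp.single ((c.translate U.shift).translate V.shift)
        ((U.coef c * V.coef c) • noMode U V (r - U.expo c) (t - V.expo c) p) := by
  simp [noField]

theorem noField_comm [CharZero K] {U V : NExp K n} (hU : U.Good) (hV : V.Good) (r t : ℤ) :
    noField U V r t = noField V U t r := by
  refine Finsupp.lhom_ext fun c p => ?_
  rw [noField_single, noField_single, noMode_comm hU hV, Charge.translate_comm, mul_comm]

/-- The product `U(z) V(w)` equals `κ (z - a w) / (z - b w)` times the normally ordered product. -/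
structure NExp.OPE (U V : NExp K n) (a b κ : K) : Prop where
  left : U.Good
  right : V.Good
  contr : ∃ c, IsContr U.dn V.up c ∧
    ∀ k : ℕ+, ((k : ℕ) : K) * c k = b ^ (k : ℕ) - a ^ (k : ℕ)
  expo : ∀ c : Charge n, U.expo (c.translate V.shift) = U.expo c
  coef : ∀ c : Charge n, U.coef (c.translate V.shift) = κ * U.coef c

/-- The oscillator factor comes from `expMode_mul_expMode`. Moving the zero mode part of `U` past
the shift of `V` contributes only the constant `κ`, since the exponent is unchanged. -/
theorem NExp.OPE.field_mul [CharZero K] {U V : NExp K n} {a b κ : K} (h : U.OPE V a b κ)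
    (r t : ℤ) :
    U.field r * V.field t - b • (U.field (r + 1) * V.field (t - 1)) =
      κ • (noField U V r t - a • noField U V (r + 1) (t - 1)) := by
  obtain ⟨γ, hγ, hab⟩ := h.contr
  refine Finsupp.lhom_ext fun c p => ?_
  have e := LinearMap.congr_fun (expMode_mul_expMode h.left h.right hγ hab (r - U.expo c)
    (t - V.expo c)) p
  rw [sub_add_eq_add_sub, sub_right_comm t] at e
  simp only [LinearMap.sub_apply, LinearMap.smul_apply, Module.End.mul_apply, NExp.field_single,
    noField_single, h.expo, h.coef, Charge.translate_comm c V.shift U.shift] at e ⊢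
  simp only [map_smul, Finsupp.smul_single, ← Finsupp.single_sub]
  congr 1
  linear_combination (norm := module) (κ * U.coef c * V.coef c) • e

theorem NExp.OPE.field_mul_of_trivial [CharZero K] {U V : NExp K n} {κ : K} (h : U.OPE V 0 0 κ)
    (r t : ℤ) : U.field r * V.field t = κ • noField U V r t := by
  refine LinearMap.ext fun v => ?_
  have e := LinearMap.congr_fun (h.field_mul r t) v
  simp only [LinearMap.sub_apply, LinearMap.smul_apply] at e
  rw [zero_smul, zero_smul, sub_zero, sub_zero] at e
  exact e

/-- The vectors on which the `z ^ r`-coefficient of `U(z)` and of all the fields obtained from it by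
contractions vanishes for `r ≤ -D`. -/
def NExp.filt (U : NExp K n) (D : ℤ) : Submodule K (Fock K n) where
  carrier := {v | ∀ c, ∀ m : ℕ, U.expo c + D ≤ m → expCoeff U.dn m (v c) = 0}
  add_mem' := fun hv hw c m h => by
    rw [Finsupp.add_apply, map_add, hv c m h, hw c m h, add_zero]
  zero_mem' := fun c m _ => by rw [Finsupp.zero_apply, map_zero]
  smul_mem' := fun x v hv c m h => by rw [Finsupp.smul_apply, map_smul, hv c m h, smul_zero]

theorem NExp.filt_mono (U : NExp K n) {D D' : ℤ} (h : D ≤ D') : U.filt D ≤ U.filt D' :=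
  fun _ hv c m hm => hv c m (by omega)

theorem NExp.single_mem_filt {U : NExp K n} {D : ℤ} {c : Charge n} {p : Pol K n}
    (h : ∀ m : ℕ, U.expo c + D ≤ m → expCoeff U.dn m p = 0) : Finsupp.single c p ∈ U.filt D := by
  classical
  intro c' m hm
  rw [Finsupp.single_apply]
  split_ifs with e
  · exact h m (e ▸ hm)
  · rw [map_zero]

theorem NExp.exists_mem_filt [CharZero K] {U : NExp K n} (hU : U.Good) (v : Fock K n) :
    ∃ D, v ∈ U.filt D := by
  induction v using Finsupp.induction_linear with
  | zero => exact ⟨0, Submodule.zero_mem _⟩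
  | add v w hv hw =>
    obtain ⟨D, hD⟩ := hv
    obtain ⟨D', hD'⟩ := hw
    exact ⟨max D D', Submodule.add_mem _ (U.filt_mono (le_max_left _ _) hD)
      (U.filt_mono (le_max_right _ _) hD')⟩
  | single c p =>
    obtain ⟨M, hM⟩ := hU.dn.locallyFinite.exists_bound p
    exact ⟨M - U.expo c, NExp.single_mem_filt fun m hm => hM m (by omega)⟩

theorem NExp.field_apply_eq_zero [CharZero K] {U : NExp K n} (hU : U.Good) {D r : ℤ}
    {v : Fock K n} (hv : v ∈ U.filt D) (hr : r ≤ -D) : U.field r v = 0 := by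
  rw [← Finsupp.sum_single v, Finsupp.sum, map_sum]
  refine Finset.sum_eq_zero fun c _ => ?_
  obtain ⟨M, hM⟩ := hU.dn.locallyFinite.exists_bound (v c)
  rw [NExp.field_single, hU.dn.expMode_apply _ _ hM, Finset.sum_eq_zero, smul_zero,
    Finsupp.single_zero]
  -- A nonnegative creation index forces `m ≥ U.expo c - r ≥ U.expo c + D`, where the annihilation
  -- part already vanishes.
  intro m _
  obtain h | h := lt_or_ge (r - U.expo c + m) 0
  · rw [expCoeffInt_of_neg _ h, LinearMap.zero_apply]
  · rw [hv c m (by omega), map_zero]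

theorem NExp.isFilt [CharZero K] {U : NExp K n} (hU : U.Good) : IsFilt U.field U.filt :=
  ⟨NExp.exists_mem_filt hU, fun _ _ hv _ hr => NExp.field_apply_eq_zero hU hv hr⟩

theorem IsContr.commute_of_zero {A B : ℕ+ → Module.End K (Pol K n)} (h : IsContr B A 0) (k l : ℕ+) :
    Commute (B k) (A l) := by
  have := h k l
  simp only [Pi.zero_apply, zero_smul, ite_self] at this
  exact sub_eq_zero.1 this

/-- With `a = b = 0` all contractions vanish in characteristic zero, so the annihilation part of `U`
commutes with `V`; the exponent of `U` is insensitive to the shift of `V`. -/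
theorem NExp.OPE.preserves [CharZero K] {U V : NExp K n} {κ : K} (h : U.OPE V 0 0 κ) :
    Preserves V.field U.filt := by
  obtain ⟨γ, hγ, hab⟩ := h.contr
  obtain rfl : γ = 0 := by
    funext k
    have : ((k : ℕ) : K) ≠ 0 := by exact_mod_cast k.ne_zero
    simpa [this] using hab k
  intro D v hv r
  rw [← Finsupp.sum_single v, Finsupp.sum, map_sum]
  refine Submodule.sum_mem _ fun c _ => ?_
  rw [NExp.field_single]
  refine NExp.single_mem_filt fun m hm => ?_
  rw [h.expo] at hm
  have cm : Commute (expCoeff U.dn m) (expMode V.up V.dn (r - V.expo c)) :=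
    commute_expMode h.right.up h.right.dn
      (fun k => (commute_expCoeff (h.left.dn.commute h.left.dn)
        (fun l => (hγ.commute_of_zero l k).symm) m).symm)
      (fun k => (commute_expCoeff (h.left.dn.commute h.left.dn)
        (fun l => h.right.dn.commute h.left.dn k l) m).symm) _
  rw [map_smul, ← Module.End.mul_apply, cm.eq, Module.End.mul_apply, hv c m hm, map_zero, smul_zero]

end Fields

-- From operator products to exchange, Fermi and Serre relations.

section Abstract

variable {K : Type*} [Field K] {V : Type*} [AddCommGroup V] [Module K V]

/-- Substituting `μ y` for the argument of `Y` turns `(w - b y)` and `κ (w - a y)` into `w - p y`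
and `κ' (p w - y)`; the opposite product is `κ'` times the same normally ordered product. -/
theorem exchangeRel_of_right {p μ a b κ κ' : K} (hμ : μ ≠ 0) (hp : p ≠ 0)
    (ha : a * μ = p⁻¹) (hb : b * μ = p) (hκ : κ = p * κ')
    {X Y : ℤ → Module.End K V} {N : ℤ → ℤ → Module.End K V}
    (hXY : ∀ r t, X r * Y t - b • (X (r + 1) * Y (t - 1)) = κ • (N r t - a • N (r + 1) (t - 1)))
    (hYX : ∀ r t, Y t * X r = κ' • N r t) : ExchangeRel p X (fun r => μ ^ r • Y r) := by
  intro i r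
  obtain rfl : a = p⁻¹ * μ⁻¹ := by rw [← ha, mul_inv_cancel_right₀ hμ]
  obtain rfl : b = p * μ⁻¹ := by rw [← hb, mul_inv_cancel_right₀ hμ]
  subst hκ
  have h := hXY (i - 1) r
  rw [sub_add_cancel] at h
  simp only [smul_mul_assoc, mul_smul_comm, hYX, zpow_sub_one₀ hμ]
  linear_combination (norm := skip) μ ^ r • h
  match_scalars <;> field_simp <;> ring

/-- The same argument with the rational factor sitting in the product `Y X`. -/
theorem exchangeRel_of_left {p μ a b κ κ' : K} (hμ : μ ≠ 0) (hp : p ≠ 0)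
    (ha : a * p = μ) (hb : b = p * μ) (hκ : κ' = p * κ)
    {X Y : ℤ → Module.End K V} {N : ℤ → ℤ → Module.End K V}
    (hXY : ∀ r t, X r * Y t = κ • N r t)
    (hYX : ∀ r t, Y t * X r - b • (Y (t + 1) * X (r - 1)) = κ' • (N r t - a • N (r - 1) (t + 1))) :
    ExchangeRel p X (fun r => μ ^ r • Y r) := by
  intro i r
  obtain rfl : a = μ * p⁻¹ := by rw [← ha, mul_inv_cancel_right₀ hp]
  subst hκ hb
  have h := hYX i (r - 1)
  rw [sub_add_cancel] at h
  simp only [smul_mul_assoc, mul_smul_comm, hXY, zpow_sub_one₀ hμ]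
  linear_combination (norm := skip) (μ ^ r * μ⁻¹) • h
  match_scalars <;> field_simp <;> ring

/-- The conditions on the constants say `κ (w - a w') = -κ' (w' - a' w)`, so the two products cancel
after clearing the common pole. -/
theorem fermiRel_of_mul {p a a' κ κ' : K} (h : κ = κ' * a') (h' : κ' = κ * a)
    {X X' : ℤ → Module.End K V} {N : ℤ → ℤ → Module.End K V}
    (hX : ∀ r t, X r * X' t - (p ^ 2)⁻¹ • (X (r + 1) * X' (t - 1)) =
      κ • (N r t - a • N (r + 1) (t - 1)))
    (hX' : ∀ r t, X' t * X r - (p ^ 2)⁻¹ • (X' (t + 1) * X (r - 1)) =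
      κ' • (N r t - a' • N (r - 1) (t + 1))) : FermiRel p X X' := by
  intro i j
  have e := hX (i - 1) j
  have e' := hX' i (j - 1)
  rw [sub_add_cancel] at e e'
  linear_combination (norm := skip) e + e' + h • N (i - 1) j + h' • N i (j - 1)
  match_scalars <;> ring

theorem ExchangeRel.sub_left {p : K} {X X' Y : ℤ → Module.End K V} (c : K)
    (h : ExchangeRel p X Y) (h' : ExchangeRel p X' Y) :
    ExchangeRel p (fun i => c • (X i - X' i)) Y := by
  intro i r
  simp only [smul_mul_assoc, mul_smul_comm, sub_mul, mul_sub]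
  linear_combination (norm := module) c • h i r - c • h' i r

theorem ExchangeRel.sub_right {p : K} {X Y Y' : ℤ → Module.End K V} (c : K)
    (h : ExchangeRel p X Y) (h' : ExchangeRel p X Y') :
    ExchangeRel p X (fun i => c • (Y i - Y' i)) := by
  intro i r
  simp only [smul_mul_assoc, mul_smul_comm, sub_mul, mul_sub]
  linear_combination (norm := module) c • h i r - c • h' i r

/-- Polarisation: expanding the differences gives the symmetrised expressions of all pairs of
components. Equal components are counted twice, whence the halves. -/
theorem serreRel_of_serreExpr [CharZero K] {p : K} {X Y : K → ℤ → Module.End K V} {i r : ℤ} {u w : K}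
    (c d : K) (h : ∀ x x' y, (x = u ∨ x = w) → (x' = u ∨ x' = w) → (y = u ∨ y = w) →
      serreExpr p (X x) (X x') (Y y) i i r = 0) :
    SerreRel p (d • (Y u r - Y w r)) (c • (X u i - X w i)) := by
  have h1 := h u u u (.inl rfl) (.inl rfl) (.inl rfl)
  have h2 := h u w u (.inl rfl) (.inr rfl) (.inl rfl)
  have h3 := h w w u (.inr rfl) (.inr rfl) (.inl rfl)
  have h4 := h u u w (.inl rfl) (.inl rfl) (.inr rfl)
  have h5 := h u w w (.inl rfl) (.inr rfl) (.inr rfl)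
  have h6 := h w w w (.inr rfl) (.inr rfl) (.inr rfl)
  unfold serreExpr at *
  unfold SerreRel
  generalize p + p⁻¹ = m at *
  simp only [smul_mul_assoc, mul_smul_comm, sub_mul, mul_sub]
  linear_combination (norm := skip) (c ^ 2 * d / 2) • h1 - (c ^ 2 * d) • h2 + (c ^ 2 * d / 2) • h3
    - (c ^ 2 * d / 2) • h4 + (c ^ 2 * d) • h5 - (c ^ 2 * d / 2) • h6
  match_scalars <;> field_simp <;> ring

theorem IsFilt.inf {U U' : ℤ → Module.End K V} {W W' : ℤ → Submodule K V}
    (h : IsFilt U W) (h' : IsFilt U' W') (hm : Monotone W) (hm' : Monotone W') :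
    IsFilt U (W ⊓ W') where
  exhaust v := by
    obtain ⟨D, hD⟩ := h.exhaust v
    obtain ⟨D', hD'⟩ := h'.exhaust v
    exact ⟨max D D', hm (le_max_left _ _) hD, hm' (le_max_right _ _) hD'⟩
  kill D v hv r hr := h.kill D v hv.1 r hr

theorem Preserves.inf {T : ℤ → Module.End K V} {W W' : ℤ → Submodule K V}
    (h : Preserves T W) (h' : Preserves T W') : Preserves T (W ⊓ W') :=
  fun D v hv r => ⟨h D v hv.1 r, h' D v hv.2 r⟩

theorem Preserves.smul {T : ℤ → Module.End K V} {W : ℤ → Submodule K V}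
    (h : Preserves T W) (c : ℤ → K) : Preserves (fun r => c r • T r) W :=
  fun D v hv r => Submodule.smul_mem _ _ (h D v hv r)

theorem IsFilt.smul {U : ℤ → Module.End K V} {W : ℤ → Submodule K V}
    (h : IsFilt U W) (c : ℤ → K) : IsFilt (fun r => c r • U r) W :=
  ⟨h.exhaust, fun D v hv r hr => by rw [LinearMap.smul_apply, h.kill D v hv r hr, smul_zero]⟩

end Abstract

-- Pairs of fields attached to a short root.

section OPE

variable {K : Type*} [Field K] [CharZero K] {n : ℕ}

theorem NExp.OPE.exchangeRel_right {U V : NExp K n} {p μ a b κ κ' : K} (h : U.OPE V a b κ)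
    (h' : V.OPE U 0 0 κ') (hμ : μ ≠ 0) (hp : p ≠ 0) (ha : a * μ = p⁻¹) (hb : b * μ = p)
    (hκ : κ = p * κ') : ExchangeRel p U.field (fun r => μ ^ r • V.field r) :=
  exchangeRel_of_right hμ hp ha hb hκ h.field_mul fun r t => by
    rw [h'.field_mul_of_trivial, noField_comm h'.left h'.right]

theorem NExp.OPE.exchangeRel_left {U V : NExp K n} {p μ a b κ κ' : K} (h : U.OPE V 0 0 κ)
    (h' : V.OPE U a b κ') (hμ : μ ≠ 0) (hp : p ≠ 0) (ha : a * p = μ) (hb : b = p * μ)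
    (hκ : κ' = p * κ) : ExchangeRel p U.field (fun r => μ ^ r • V.field r) :=
  exchangeRel_of_left hμ hp ha hb hκ h.field_mul_of_trivial fun r t => by
    rw [h'.field_mul, noField_comm h'.left h'.right, noField_comm h'.left h'.right]

theorem NExp.OPE.fermiRel {U V : NExp K n} {p a a' κ κ' : K} (h : U.OPE V a (p ^ 2)⁻¹ κ)
    (h' : V.OPE U a' (p ^ 2)⁻¹ κ') (hκ : κ = κ' * a') (hκ' : κ' = κ * a) :
    FermiRel p U.field V.field :=
  fermiRel_of_mul hκ hκ' h.field_mul fun r t => by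
    rw [h'.field_mul, noField_comm h'.left h'.right, noField_comm h'.left h'.right]

theorem NExp.OPE.field_comm {U V : NExp K n} {κ : K} (h : U.OPE V 0 0 κ) (h' : V.OPE U 0 0 κ)
    (r t : ℤ) : U.field r * V.field t = V.field t * U.field r := by
  rw [h.field_mul_of_trivial, h'.field_mul_of_trivial, noField_comm h.left h.right]

/-- The contractions between the two components `Y u`, `u = p ^ {± 1}`, of a field and the
components `X u` of the current of a short root by which it is raised. -/
structure ShortPair (p μ κ κ' : K) (X Y : K → NExp K n) : Prop where
  XX : ∀ u v, (u = p ∨ u = p⁻¹) → (v = p ∨ v = p⁻¹) → (X u).OPE (X v) (v / u) (p ^ 2)⁻¹ u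
  XY : ∀ u, (u = p ∨ u = p⁻¹) → (X u).OPE (Y p) (p⁻¹ / μ) (p / μ) (p * κ)
  YX : ∀ u, (u = p ∨ u = p⁻¹) → (Y p).OPE (X u) 0 0 κ
  XY' : ∀ u, (u = p ∨ u = p⁻¹) → (X u).OPE (Y p⁻¹) 0 0 κ'
  YX' : ∀ u, (u = p ∨ u = p⁻¹) → (Y p⁻¹).OPE (X u) (μ / p) (p * μ) (p * κ')

variable {p μ κ κ' : K} {X Y : K → NExp K n}

/-- The component `Y p` has its pole in the product `X Y`, and `Y p⁻¹` in `Y X`; both lead to the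
same exchange relation, which therefore passes to differences. -/
theorem ShortPair.exchangeRel_comp (h : ShortPair p μ κ κ' X Y) (hp : p ≠ 0) (hμ : μ ≠ 0) {u v : K}
    (hu : u = p ∨ u = p⁻¹) (hv : v = p ∨ v = p⁻¹) :
    ExchangeRel p (X u).field (fun r => μ ^ r • (Y v).field r) := by
  obtain rfl | rfl := hv
  · exact (h.XY u hu).exchangeRel_right (h.YX u hu) hμ hp (by field_simp) (by field_simp) rfl
  · exact (h.XY' u hu).exchangeRel_left (h.YX' u hu) hμ hp (by field_simp) rfl rfl

theorem ShortPair.exchangeRel (h : ShortPair p μ κ κ' X Y) (hp : p ≠ 0) (hμ : μ ≠ 0) (c d : K) :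
    ExchangeRel p (fun i => c • ((X p).field i - (X p⁻¹).field i))
      (fun r => μ ^ r • (d • ((Y p).field r - (Y p⁻¹).field r))) := by
  have e := fun {u} hu => ExchangeRel.sub_right d (h.exchangeRel_comp hp hμ (u := u) hu (.inl rfl))
    (h.exchangeRel_comp hp hμ hu (.inr rfl))
  have := ExchangeRel.sub_left c (e (.inl rfl)) (e (.inr rfl))
  convert this using 2 with r
  module

theorem ShortPair.fermiRel (h : ShortPair p μ κ κ' X Y) (hp : p ≠ 0) {u v : K}
    (hu : u = p ∨ u = p⁻¹) (hv : v = p ∨ v = p⁻¹) : FermiRel p (X u).field (X v).field := by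
  have hu0 : u ≠ 0 := by obtain rfl | rfl := hu <;> simpa
  have hv0 : v ≠ 0 := by obtain rfl | rfl := hv <;> simpa
  exact (h.XX u v hu hv).fermiRel (h.XX v u hv hu) (by field_simp) (by field_simp)

omit [CharZero K] in
theorem NExp.monotone_filt (U : NExp K n) : Monotone U.filt := fun _ _ h => U.filt_mono h

theorem ShortPair.serreRel (h : ShortPair p μ κ κ' X Y) (hp : p ≠ 0) (hμ : μ ≠ 0) (c d : K) (i r : ℤ) :
    SerreRel p (d • ((Y p).field r - (Y p⁻¹).field r)) (c • ((X p).field i - (X p⁻¹).field i)) := by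
  refine serreRel_of_serreExpr (X := fun u => (X u).field) (Y := fun u => (Y u).field) c d
    fun u u' v hu hu' hv => ?_
  have e1 := h.exchangeRel_comp hp hμ hu hv
  have e2 := h.exchangeRel_comp hp hμ hu' hv
  have e3 := h.fermiRel hp hu hu'
  have hg : serreExpr p (X u).field (X u').field (fun r => μ ^ r • (Y v).field r) i i r = 0 := by
    -- The pole decides the direction of truncation. `Y p` times `X` is regular, so `X` preserves
    -- the filtration of `Y p`; `X` times `Y p⁻¹` is regular, so `Y p⁻¹` preserves those of the
    -- components of `X`.
    obtain rfl | rfl := hv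
    · exact serreExpr_eq_zero_of_filt_right hp e1 e2 e3
        ((NExp.isFilt (h.YX _ hu).left).smul _) (h.YX _ hu).preserves (h.YX _ hu').preserves i i r
    · refine serreExpr_eq_zero_of_filt_left hp e1 e2 e3 (W := (X u).filt ⊓ (X u').filt)
        ((NExp.isFilt (h.YX' _ hu).right).inf (NExp.isFilt (h.YX' _ hu').right)
          (NExp.monotone_filt _) (NExp.monotone_filt _)) ?_
        (((h.XY' _ hu).preserves.inf (h.XY' _ hu').preserves).smul _) i i r
      rw [inf_comm]
      exact (NExp.isFilt (h.YX' _ hu').right).inf (NExp.isFilt (h.YX' _ hu).right)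
          (NExp.monotone_filt _) (NExp.monotone_filt _)
  have hμr : μ ^ r ≠ 0 := zpow_ne_zero r hμ
  rw [← inv_smul_smul₀ hμr (serreExpr p _ _ _ i i r), ← smul_zero (μ ^ r)⁻¹, ← hg]
  congr 1
  unfold serreExpr
  simp only [smul_mul_assoc, mul_smul_comm]
  module

end OPE

-- Bilinear bookkeeping for contractions of elementary exponentials.

section Contractions

variable {K : Type*} [Field K] {n : ℕ}

theorem IsUp.add {A A' : ℕ+ → Module.End K (Pol K n)} (h : IsUp A) (h' : IsUp A') :
    IsUp (fun k => A k + A' k) := by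
  obtain ⟨f, hf⟩ := h
  obtain ⟨f', hf'⟩ := h'
  exact ⟨f + f', fun k => by simp only [hf, hf']; refine LinearMap.ext fun p => ?_; simp [add_mul]⟩

theorem IsUp.smul {A : ℕ+ → Module.End K (Pol K n)} (h : IsUp A) (x : ℕ+ → K) :
    IsUp (fun k => x k • A k) := by
  obtain ⟨f, hf⟩ := h
  exact ⟨fun k => x k • f k, fun k => by simp only [hf]; refine LinearMap.ext fun p => ?_; simp⟩

theorem IsUp.zero : IsUp (fun _ => (0 : Module.End K (Pol K n))) :=
  ⟨0, fun k => by ext1; simp⟩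

theorem IsUp.sum {ι : Type*} (S : Finset ι) {A : ι → ℕ+ → Module.End K (Pol K n)}
    (h : ∀ i, IsUp (A i)) : IsUp (fun k => ∑ i ∈ S, A i k) := by
  classical
  induction S using Finset.induction_on with
  | empty => simpa using IsUp.zero
  | insert i S hi ih => simpa [Finset.sum_insert hi] using (h i).add ih

theorem lowerDer_X (β : Osc n → K) (k : ℕ+) (o : Osc n) :
    lowerDer β k (MvPolynomial.X o) = if oscDeg o = k then MvPolynomial.C (β o) else 0 :=
  MvPolynomial.mkDerivation_X _ _ _

theorem IsDn.add {B B' : ℕ+ → Module.End K (Pol K n)} (h : IsDn B) (h' : IsDn B') :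
    IsDn (fun k => B k + B' k) := by
  obtain ⟨β, hβ⟩ := h
  obtain ⟨β', hβ'⟩ := h'
  refine ⟨β + β', fun k => ?_⟩
  simp only [hβ, hβ', ← Derivation.coe_add_linearMap]
  congr 1
  refine MvPolynomial.derivation_ext fun o => ?_
  rw [Derivation.add_apply, lowerDer_X, lowerDer_X, lowerDer_X]
  split_ifs <;> simp

theorem IsDn.smul {B : ℕ+ → Module.End K (Pol K n)} (h : IsDn B) (x : ℕ+ → K) :
    IsDn (fun k => x k • B k) := by
  obtain ⟨β, hβ⟩ := h
  refine ⟨fun o => x (Sum.elim (fun p => p.2) (fun p => p.2) o) * β o, fun k => ?_⟩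
  simp only [hβ, ← Derivation.coe_smul_linearMap]
  congr 1
  refine MvPolynomial.derivation_ext fun o => ?_
  rw [Derivation.smul_apply, lowerDer_X, lowerDer_X]
  split_ifs with h
  · have : Sum.elim (fun p : Fin n × ℕ+ => p.2) (fun p : Fin n × ℕ+ => p.2) o = k := by
      obtain o | o := o <;> exact PNat.eq h
    rw [this, MvPolynomial.smul_eq_C_mul, MvPolynomial.C_mul]
  · rw [smul_zero]

theorem IsDn.zero : IsDn (fun _ => (0 : Module.End K (Pol K n))) :=
  ⟨0, fun k => by
    have : lowerDer (0 : Osc n → K) k = 0 := MvPolynomial.derivation_ext fun o => by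
      rw [lowerDer_X]
      simp
    rw [this]
    rfl⟩

theorem IsDn.sum {ι : Type*} (S : Finset ι) {A : ι → ℕ+ → Module.End K (Pol K n)}
    (h : ∀ i, IsDn (A i)) : IsDn (fun k => ∑ i ∈ S, A i k) := by
  classical
  induction S using Finset.induction_on with
  | empty => simpa using IsDn.zero
  | insert i S hi ih => simpa [Finset.sum_insert hi] using (h i).add ih

theorem isUp_aNeg (i : Fin n) : IsUp (aNeg K i) := ⟨_, fun _ => rfl⟩

theorem isUp_bNeg (i : Fin n) : IsUp (bNeg K i) := ⟨_, fun _ => rfl⟩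

theorem isDn_aPos (s : K) (i : Fin n) : IsDn (aPos s i) := by
  refine ⟨fun o => match o with
    | Sum.inl (j, l) => qHalf s ((l : ℤ) * twoForm i j) * qHalf s (-(l : ℤ)) / ((l : ℕ) : K)
    | Sum.inr _ => 0, fun k => ?_⟩
  rw [aPos, lowerDer]
  congr 2
  funext o
  obtain ⟨j, l⟩ | ⟨j, l⟩ := o
  · by_cases h : k = l
    · subst h; simp [oscDeg]
    · have : (l : ℕ) ≠ k := fun e => h (PNat.eq e.symm)
      simp [oscDeg, h, this]
  · simp [oscDeg]

theorem isDn_bPos (i : Fin n) : IsDn (bPos K i) := by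
  refine ⟨fun o => match o with
    | Sum.inl _ => 0
    | Sum.inr (j, l) => if i = j then ((l : ℕ) : K) else 0, fun k => ?_⟩
  rw [bPos, lowerDer]
  congr 2
  funext o
  obtain ⟨j, l⟩ | ⟨j, l⟩ := o
  · simp [oscDeg]
  · by_cases h : k = l
    · subst h; by_cases hij : i = j <;> simp [oscDeg, hij]
    · have : (l : ℕ) ≠ k := fun e => h (PNat.eq e.symm)
      simp [oscDeg, h, this]

theorem IsContr.add_left {B B' A : ℕ+ → Module.End K (Pol K n)} {c c' : ℕ+ → K}
    (h : IsContr B A c) (h' : IsContr B' A c') : IsContr (fun k => B k + B' k) A (c + c') := by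
  intro k l
  have e : (B k + B' k) * A l - A l * (B k + B' k) =
      (B k * A l - A l * B k) + (B' k * A l - A l * B' k) := by noncomm_ring
  rw [e, h, h']
  split_ifs
  · rw [Pi.add_apply, add_smul]
  · exact add_zero _

theorem IsContr.add_right {B A A' : ℕ+ → Module.End K (Pol K n)} {c c' : ℕ+ → K}
    (h : IsContr B A c) (h' : IsContr B A' c') : IsContr B (fun k => A k + A' k) (c + c') := by
  intro k l
  have e : B k * (A l + A' l) - (A l + A' l) * B k =
      (B k * A l - A l * B k) + (B k * A' l - A' l * B k) := by noncomm_ring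
  rw [e, h, h']
  split_ifs
  · rw [Pi.add_apply, add_smul]
  · exact add_zero _

theorem IsContr.smul_left {B A : ℕ+ → Module.End K (Pol K n)} {c : ℕ+ → K}
    (h : IsContr B A c) (x : ℕ+ → K) : IsContr (fun k => x k • B k) A (x * c) := by
  intro k l
  have e : (x k • B k) * A l - A l * (x k • B k) = x k • (B k * A l - A l * B k) := by
    rw [smul_mul_assoc, mul_smul_comm, smul_sub]
  rw [e, h]
  split_ifs
  · rw [Pi.mul_apply, mul_smul]
  · exact smul_zero _

theorem IsContr.smul_right {B A : ℕ+ → Module.End K (Pol K n)} {c : ℕ+ → K}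
    (h : IsContr B A c) (x : ℕ+ → K) : IsContr B (fun k => x k • A k) (x * c) := by
  intro k l
  have e : B k * (x l • A l) - (x l • A l) * B k = x l • (B k * A l - A l * B k) := by
    rw [smul_mul_assoc, mul_smul_comm, smul_sub]
  rw [e, h]
  split_ifs with hkl
  · rw [Pi.mul_apply, mul_smul, hkl]
  · exact smul_zero _

theorem IsContr.zero_left (A : ℕ+ → Module.End K (Pol K n)) : IsContr (fun _ => 0) A 0 := by
  intro k l
  simp

theorem IsContr.zero_right (B : ℕ+ → Module.End K (Pol K n)) : IsContr B (fun _ => 0) 0 := by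
  intro k l
  simp

theorem IsContr.sum_left {ι : Type*} (S : Finset ι) {B : ι → ℕ+ → Module.End K (Pol K n)}
    {A : ℕ+ → Module.End K (Pol K n)} {c : ι → ℕ+ → K} (h : ∀ i, IsContr (B i) A (c i)) :
    IsContr (fun k => ∑ i ∈ S, B i k) A (∑ i ∈ S, c i) := by
  classical
  induction S using Finset.induction_on with
  | empty => simpa using IsContr.zero_left A
  | insert i S hi ih => simpa [Finset.sum_insert hi] using (h i).add_left ih

theorem IsContr.sum_right {ι : Type*} (S : Finset ι) {A : ι → ℕ+ → Module.End K (Pol K n)}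
    {B : ℕ+ → Module.End K (Pol K n)} {c : ι → ℕ+ → K} (h : ∀ i, IsContr B (A i) (c i)) :
    IsContr B (fun k => ∑ i ∈ S, A i k) (∑ i ∈ S, c i) := by
  classical
  induction S using Finset.induction_on with
  | empty => simpa using IsContr.zero_right B
  | insert i S hi ih => simpa [Finset.sum_insert hi] using (h i).add_right ih

/-- A derivation and a multiplication operator whose commutator is a scalar. -/
theorem derivation_mulLeft (D : Derivation K (Pol K n) (Pol K n)) (o : Osc n) {x : K}
    (h : D (MvPolynomial.X o) = MvPolynomial.C x) :
    (D : Module.End K (Pol K n)) * LinearMap.mulLeft K (MvPolynomial.X o) -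
      LinearMap.mulLeft K (MvPolynomial.X o) * (D : Module.End K (Pol K n)) =
        x • (1 : Module.End K (Pol K n)) := by
  refine LinearMap.ext fun p => ?_
  have : D (MvPolynomial.X o * p) = MvPolynomial.X o * D p + p * MvPolynomial.C x := by
    rw [Derivation.leibniz, h, smul_eq_mul, smul_eq_mul]
  simp only [LinearMap.sub_apply, Module.End.mul_apply, LinearMap.mulLeft_apply,
    Derivation.coeFn_coe, this, LinearMap.smul_apply, Module.End.one_apply,
    MvPolynomial.smul_eq_C_mul]
  ring

theorem isContr_b_b (i j : Fin n) :
    IsContr (bPos K i) (bNeg K j) (fun k => if i = j then ((k : ℕ) : K) else 0) := by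
  intro k l
  have := derivation_mulLeft (MvPolynomial.mkDerivation K (fun o : Osc n =>
    match o with
    | Sum.inl _ => (0 : Pol K n)
    | Sum.inr (j, l) => if i = j ∧ k = l then MvPolynomial.C ((k : ℕ) : K) else 0)) (Sum.inr (j, l))
    (x := if k = l then if i = j then ((k : ℕ) : K) else 0 else 0) (by
      rw [MvPolynomial.mkDerivation_X]
      by_cases h : i = j <;> by_cases h' : k = l <;> simp [h, h'])
  refine this.trans ?_
  split_ifs <;> simp

theorem isContr_b_a (i j : Fin n) : IsContr (bPos K i) (aNeg K j) 0 := by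
  intro k l
  refine (derivation_mulLeft _ (Sum.inl (j, l)) (x := 0) ?_).trans ?_
  · rw [MvPolynomial.mkDerivation_X, map_zero]
  · simp

theorem isContr_a_b (s : K) (i j : Fin n) : IsContr (aPos s i) (bNeg K j) 0 := by
  intro k l
  refine (derivation_mulLeft _ (Sum.inr (j, l)) (x := 0) ?_).trans ?_
  · rw [MvPolynomial.mkDerivation_X, map_zero]
  · simp

theorem isContr_a_a (s : K) (i j : Fin n) : IsContr (aPos s i) (aNeg K j)
    (fun k => qHalf s ((k : ℤ) * twoForm i j) * qHalf s (-(k : ℤ)) / ((k : ℕ) : K)) := by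
  intro k l
  refine (derivation_mulLeft _ (Sum.inl (j, l)) (x := if k = l then
    qHalf s ((k : ℤ) * twoForm i j) * qHalf s (-(k : ℤ)) / ((k : ℕ) : K) else 0) ?_).trans ?_
  · rw [MvPolynomial.mkDerivation_X]
    by_cases h : k = l <;> simp [h]
  · split_ifs <;> simp

/-- The contractions of `U(z)` with `V(w)`: `k [U.dn k, V.up k] = g k`, and passing from the charge
of the vacuum to the one created by `V` changes the exponent by `e` and the constant by `κ`. -/
structure NExp.Pairing (U V : NExp K n) (g : ℕ → K) (e : ℤ) (κ : K) : Prop where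
  left : U.Good
  right : V.Good
  contr : ∃ c, IsContr U.dn V.up c ∧ ∀ k : ℕ+, ((k : ℕ) : K) * c k = g k
  expo : ∀ c : Charge n, U.expo (c.translate V.shift) = U.expo c + e
  coef : ∀ c : Charge n, U.coef (c.translate V.shift) = κ * U.coef c

theorem NExp.Good.mul {U V : NExp K n} (hU : U.Good) (hV : V.Good) : (U.mul V).Good :=
  ⟨hU.up.add hV.up, hU.dn.add hV.dn⟩

theorem NExp.Good.rescale {U : NExp K n} (hU : U.Good) (u : K) : (U.rescale u).Good :=
  ⟨hU.up.smul _, hU.dn.smul _⟩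

theorem Charge.translate_add (c : Charge n) (t t' : (Fin n → ℤ) × (Fin n → ℤ)) :
    c.translate (t + t') = (c.translate t).translate t' := by
  simp [Charge.translate, add_assoc]

namespace NExp.Pairing

variable {U U' V V' : NExp K n} {g g' : ℕ → K} {e e' : ℤ} {κ κ' : K}

theorem mul_left (h : U.Pairing V g e κ) (h' : U'.Pairing V g' e' κ') :
    (U.mul U').Pairing V (g + g') (e + e') (κ * κ') where
  left := h.left.mul h'.left
  right := h.right
  contr := by
    obtain ⟨c, hc, hg⟩ := h.contr
    obtain ⟨c', hc', hg'⟩ := h'.contr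
    exact ⟨_, hc.add_left hc', fun k => by rw [Pi.add_apply, mul_add, hg, hg']; rfl⟩
  expo c := by simp only [NExp.mul, h.expo, h'.expo]; ring
  coef c := by simp only [NExp.mul, h.coef, h'.coef]; ring

theorem mul_right (h : U.Pairing V g e κ) (h' : U.Pairing V' g' e' κ') :
    U.Pairing (V.mul V') (g + g') (e + e') (κ * κ') where
  left := h.left
  right := h.right.mul h'.right
  contr := by
    obtain ⟨c, hc, hg⟩ := h.contr
    obtain ⟨c', hc', hg'⟩ := h'.contr
    exact ⟨_, hc.add_right hc', fun k => by rw [Pi.add_apply, mul_add, hg, hg']; rfl⟩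
  expo c := by simp only [NExp.mul, Charge.translate_add, h.expo, h'.expo]; ring
  coef c := by simp only [NExp.mul, Charge.translate_add, h.coef, h'.coef]; ring

theorem rescale_left (h : U.Pairing V g e κ) {u : K} (hu : u ≠ 0) :
    (U.rescale u).Pairing V (fun k => (u ^ k)⁻¹ * g k) e (κ * u ^ e) where
  left := h.left.rescale u
  right := h.right
  contr := by
    obtain ⟨c, hc, hg⟩ := h.contr
    exact ⟨_, hc.smul_left _, fun k => by rw [Pi.mul_apply, mul_left_comm, hg]⟩
  expo := h.expo
  coef c := by simp only [NExp.rescale, h.coef, h.expo, zpow_add₀ hu]; ring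

theorem rescale_right (h : U.Pairing V g e κ) (u : K) :
    U.Pairing (V.rescale u) (fun k => u ^ k * g k) e κ where
  left := h.left
  right := h.right.rescale u
  contr := by
    obtain ⟨c, hc, hg⟩ := h.contr
    exact ⟨_, hc.smul_right _, fun k => by rw [Pi.mul_apply, mul_left_comm, hg]⟩
  expo := h.expo
  coef := h.coef

theorem ope (h : U.Pairing V g e κ) (he : e = 0) {a b κ₀ : K}
    (hg : ∀ k : ℕ, 0 < k → g k = b ^ k - a ^ k) (hκ : κ = κ₀) : U.OPE V a b κ₀ where
  left := h.left
  right := h.right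
  contr := by
    obtain ⟨c, hc, hg'⟩ := h.contr
    exact ⟨c, hc, fun k => by rw [hg', hg k k.pos]⟩
  expo c := by rw [h.expo, he, add_zero]
  coef := hκ ▸ h.coef

theorem ope_zero (h : U.Pairing V g e κ) (he : e = 0) {κ₀ : K}
    (hg : ∀ k : ℕ, 0 < k → g k = 0) (hκ : κ = κ₀) : U.OPE V 0 0 κ₀ :=
  h.ope he (fun k hk => by rw [hg k hk, sub_self]) hκ

end NExp.Pairing

/-- The Kronecker symbol. -/
def delta (i j : Fin n) : ℤ := if i = j then 1 else 0

theorem good_Zop (σ : ℤ) (i : Fin n) : (Zop K σ i).Good :=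
  ⟨(isUp_bNeg i).smul _, (isDn_bPos i).smul _⟩

theorem good_Yop (s : K) (σ : ℤ) (i : Fin n) : (Yop s σ i).Good :=
  ⟨(isUp_aNeg i).smul _, (isDn_aPos s i).smul _⟩

theorem pairing_Zop_Zop [CharZero K] (σ τ : ℤ) (i j : Fin n) :
    (Zop K σ i).Pairing (Zop K τ j) (fun _ => ((-(σ * τ * delta i j) : ℤ) : K))
      (σ * τ * delta i j) 1 where
  left := good_Zop σ i
  right := good_Zop τ j
  contr := ⟨_, ((isContr_b_b i j).smul_left _).smul_right _, fun k => by
    have : ((k : ℕ) : K) ≠ 0 := by exact_mod_cast k.ne_zero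
    simp only [Pi.mul_apply, delta]
    split_ifs
    · push_cast
      field_simp
    · simp⟩
  expo c := by
    simp only [Zop, Charge.translate, Pi.add_apply, Pi.single_apply, delta]
    split_ifs <;> ring
  coef c := (one_mul _).symm

theorem pairing_Zop_Yop (s : K) (σ τ : ℤ) (i j : Fin n) :
    (Zop K σ i).Pairing (Yop s τ j) 0 0 1 where
  left := good_Zop σ i
  right := good_Yop s τ j
  contr := ⟨_, ((isContr_b_a i j).smul_left _).smul_right _, fun k => by simp⟩
  expo c := by simp [Zop, Yop, Charge.translate]
  coef c := (one_mul _).symm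

theorem pairing_Yop_Zop (s : K) (σ τ : ℤ) (i j : Fin n) :
    (Yop s τ i).Pairing (Zop K σ j) 0 0 1 where
  left := good_Yop s τ i
  right := good_Zop σ j
  contr := ⟨_, ((isContr_a_b s i j).smul_left _).smul_right _, fun k => by simp⟩
  expo c := by simp [Zop, Yop, Charge.translate, twoA0, Charge.h]
  coef c := (one_mul _).symm

theorem qHalf_neg (s : K) (k : ℤ) : qHalf s (-k) = -qHalf s k := by
  unfold qHalf
  rw [← neg_div]
  congr 1
  rw [show -(2 * -k) = 2 * k by ring, show 2 * -k = -(2 * k) by ring, neg_sub]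

theorem twoA0_translate (i : Fin n) (c : Charge n) (t : (Fin n → ℤ) × (Fin n → ℤ)) :
    twoA0 i (c.translate t) = twoA0 i c + ∑ j, simpleRoot i j * t.1 j := by
  simp only [twoA0, Charge.translate, Charge.h, Pi.add_apply, mul_add, Finset.sum_add_distrib]
  exact add_right_comm _ _ _

theorem pairing_Yop_Yop [CharZero K] {s : K} (hq : ∀ k : ℕ, 0 < k → qHalf s k ≠ 0) (i j : Fin n) :
    (Yop s (-1) i).Pairing (Yop s (-1) j)
      (fun k => qHalf s (k * twoForm i j) / qHalf s k * s ^ (-2 * (k : ℤ)))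
      (-twoForm i j) 1 where
  left := good_Yop s _ i
  right := good_Yop s _ j
  contr := ⟨_, ((isContr_a_a s i j).smul_left _).smul_right _, fun k => by
    have h0 : ((k : ℕ) : K) ≠ 0 := by exact_mod_cast k.ne_zero
    have h1 := hq k k.pos
    have h2 : s ^ (-2 * ((k : ℕ) : ℤ)) = s ^ (-1 * ((k : ℕ) : ℤ)) * s ^ (-1 * ((k : ℕ) : ℤ)) := by
      obtain rfl | hs := eq_or_ne s 0
      · rw [zero_zpow _ (by simp), zero_zpow _ (by simp), zero_mul]
      · rw [← zpow_add₀ hs]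
        congr 1
        ring
    simp only [Pi.mul_apply, qHalf_neg, h2]
    push_cast
    field_simp⟩
  expo c := by
    simp only [Yop, twoA0_translate, twoForm]
    rw [mul_add]
    simp [Finset.mul_sum]
  coef c := (one_mul _).symm

end Contractions

-- Operator products of the currents.

section Currents

variable {K : Type*} [Field K] {n : ℕ}

theorem simpleRoot_of_succ {i j : Fin n} (h : (j : ℕ) = i + 1) (l : Fin n) :
    simpleRoot i l = delta i l - delta j l := by
  have h1 : (i : ℕ) + 1 ≠ n := by have := j.isLt; omega
  rw [simpleRoot, if_neg h1, delta, delta]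
  simp only [Fin.ext_iff]
  split_ifs <;> first | rfl | (exfalso; omega)

theorem simpleRoot_of_last {i : Fin n} (h : (i : ℕ) + 1 = n) (l : Fin n) :
    simpleRoot i l = 2 * delta i l := by
  rw [simpleRoot, if_pos h, delta]
  simp only [eq_comm]
  split_ifs <;> rfl

theorem twoForm_comm (i j : Fin n) : twoForm i j = twoForm j i :=
  Finset.sum_congr rfl fun _ _ => mul_comm _ _

theorem sum_delta_mul (i : Fin n) (f : Fin n → ℤ) : ∑ l, delta i l * f l = f i := by
  simp [delta]

theorem twoForm_of_succ {i j : Fin n} (h : (j : ℕ) = i + 1) (l : Fin n) :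
    twoForm i l = simpleRoot l i - simpleRoot l j := by
  simp only [twoForm, simpleRoot_of_succ h, sub_mul, Finset.sum_sub_distrib, sum_delta_mul]

theorem twoForm_of_last {i : Fin n} (h : (i : ℕ) + 1 = n) (l : Fin n) :
    twoForm i l = 2 * simpleRoot l i := by
  simp only [twoForm, simpleRoot_of_last h, mul_assoc, ← Finset.mul_sum, sum_delta_mul]

/-- The exponent `k [k (α_i|α_j)] / [k / 2] q ^ (-k / 2)` of the contraction of `Y_i^-` and `Y_j^-`,
where `D = 2 (α_i|α_j)`. -/
def yContr (s : K) (D : ℤ) (k : ℕ) : K := qHalf s (k * D) / qHalf s k * s ^ (-2 * (k : ℤ))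

theorem yContr_zero (s : K) (k : ℕ) : yContr s 0 k = 0 := by
  simp [yContr, qHalf]

/-- `q ^ (x / 2) + q ^ (-x / 2)`. -/
def qSum (s : K) (x : ℤ) : K := s ^ (2 * x) + s ^ (-(2 * x))

theorem qHalf_two_mul {s : K} (hs : s ≠ 0) (x : ℤ) : qHalf s (2 * x) = qHalf s x * qSum s x := by
  unfold qHalf qSum
  rw [div_mul_eq_mul_div]
  congr 1
  rw [show 2 * (2 * x) = 2 * x + 2 * x by ring, show -(2 * x + 2 * x) = -(2 * x) + -(2 * x) by ring,
    zpow_add₀ hs, zpow_add₀ hs]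
  ring

theorem yContr_neg_one {s : K} {k : ℕ} (h : qHalf s k ≠ 0) :
    yContr s (-1) k = -((s ^ 2) ^ k)⁻¹ := by
  have e : (s : K) ^ (-2 * (k : ℤ)) = ((s ^ 2) ^ k)⁻¹ := by
    rw [neg_mul, zpow_neg, zpow_mul]
    norm_cast
  rw [yContr, e, mul_neg_one, qHalf_neg, neg_div, div_self h]
  ring

theorem yContr_two {s : K} (hs : s ≠ 0) {k : ℕ} (h : qHalf s k ≠ 0) :
    yContr s 2 k = 1 + (((s ^ 2) ^ 2) ^ k)⁻¹ := by
  have e : (s : K) ^ (-2 * (k : ℤ)) = ((s ^ 2) ^ k)⁻¹ := by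
    rw [neg_mul, zpow_neg, zpow_mul]
    norm_cast
  have e' : (s : K) ^ (2 * (k : ℤ)) = (s ^ 2) ^ k := by
    rw [zpow_mul]
    norm_cast
  have e'' : (s : K) ^ (-(2 * (k : ℤ))) = ((s ^ 2) ^ k)⁻¹ := by
    rw [zpow_neg, e']
  rw [yContr, e, mul_comm (k : ℤ) 2, qHalf_two_mul hs, qSum, e', e'', mul_div_cancel_left₀ _ h]
  field_simp
  ring

theorem yContr_neg (s : K) (D : ℤ) (k : ℕ) : yContr s (-D) k = -yContr s D k := by
  rw [yContr, mul_neg, qHalf_neg, yContr]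
  ring

theorem NExp.Pairing.congr {U V : NExp K n} {g g' : ℕ → K} {e e' : ℤ} {κ κ' : K}
    (h : U.Pairing V g e κ) (hg : ∀ k, g k = g' k) (he : e = e') (hκ : κ = κ') :
    U.Pairing V g' e' κ' := by
  obtain rfl : g = g' := funext hg
  subst he hκ
  exact h

/-- The components of `x_i^-`, where `j` is the successor of `i`. -/
def shortComp (s : K) (i j : Fin n) (u : K) : NExp K n :=
  ((Zop K (-1) i).mul ((Zop K 1 j).rescale u)).mul (Yop s (-1) i)

/-- The normally ordered exponential in `x_i^-` for the long root `α_i`. -/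
def longComp (s : K) (i : Fin n) : NExp K n :=
  (((Zop K (-1) i).rescale (s ^ 2)).mul ((Zop K (-1) i).rescale (s ^ 2)⁻¹)).mul (Yop s (-1) i)

variable [CharZero K] {s : K}

theorem pairing_short_Zop (i j l : Fin n) (τ : ℤ) {u : K} (hu : u ≠ 0) :
    (shortComp s i j u).Pairing (Zop K τ l)
      (fun k => (τ * delta i l : ℤ) - (u ^ k)⁻¹ * (τ * delta j l : ℤ))
      (τ * (delta j l - delta i l)) (u ^ (τ * delta j l)) :=
  (((pairing_Zop_Zop (-1) τ i l).mul_left ((pairing_Zop_Zop 1 τ j l).rescale_left hu)).mul_left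
    (pairing_Yop_Zop s τ (-1) i l)).congr
    (fun k => by simp only [Pi.add_apply, Pi.zero_apply]; push_cast; ring) (by ring)
    (by simp)

theorem pairing_short_Yop (hq : ∀ k : ℕ, 0 < k → qHalf s k ≠ 0) (i j l : Fin n) {u : K} (hu : u ≠ 0) :
    (shortComp s i j u).Pairing (Yop s (-1) l) (yContr s (twoForm i l)) (-twoForm i l) 1 :=
  (((pairing_Zop_Yop s (-1) (-1) i l).mul_left ((pairing_Zop_Yop s 1 (-1) j l).rescale_left hu)).mul_left
    (pairing_Yop_Yop hq i l)).congr
    (fun k => by simp [yContr]) (by ring) (by simp)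

theorem pairing_long_Zop (hs : s ≠ 0) (i l : Fin n) (τ : ℤ) :
    (longComp s i).Pairing (Zop K τ l)
      (fun k => ((s ^ 2) ^ k + ((s ^ 2) ^ k)⁻¹) * (τ * delta i l : ℤ))
      (-2 * (τ * delta i l)) 1 :=
  ((((pairing_Zop_Zop (-1) τ i l).rescale_left (pow_ne_zero 2 hs)).mul_left
    ((pairing_Zop_Zop (-1) τ i l).rescale_left (inv_ne_zero (pow_ne_zero 2 hs)))).mul_left
    (pairing_Yop_Zop s τ (-1) i l)).congr
    (fun k => by simp only [Pi.add_apply, Pi.zero_apply, inv_pow, inv_inv]; push_cast; ring) (by ring)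
    (by
      rw [mul_one, one_mul, one_mul, ← mul_zpow, mul_inv_cancel₀ (pow_ne_zero 2 hs), one_zpow])

theorem pairing_long_Yop (hs : s ≠ 0) (hq : ∀ k : ℕ, 0 < k → qHalf s k ≠ 0) (i l : Fin n) :
    (longComp s i).Pairing (Yop s (-1) l) (yContr s (twoForm i l)) (-twoForm i l) 1 :=
  ((((pairing_Zop_Yop s (-1) (-1) i l).rescale_left (pow_ne_zero 2 hs)).mul_left
    ((pairing_Zop_Yop s (-1) (-1) i l).rescale_left (inv_ne_zero (pow_ne_zero 2 hs)))).mul_left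
    (pairing_Yop_Yop hq i l)).congr
    (fun k => by simp [yContr]) (by ring) (by simp)

omit [CharZero K] in
theorem NExp.Pairing.short {U : NExp K n} {i j : Fin n} {g₁ g₂ g₃ : ℕ → K} {e₁ e₂ e₃ : ℤ}
    {κ₁ κ₂ κ₃ : K} (h₁ : U.Pairing (Zop K (-1) i) g₁ e₁ κ₁) (h₂ : U.Pairing (Zop K 1 j) g₂ e₂ κ₂)
    (h₃ : U.Pairing (Yop s (-1) i) g₃ e₃ κ₃) (v : K) :
    U.Pairing (shortComp s i j v) (fun k => g₁ k + v ^ k * g₂ k + g₃ k) (e₁ + e₂ + e₃)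
      (κ₁ * κ₂ * κ₃) :=
  (h₁.mul_right (h₂.rescale_right v)).mul_right h₃

omit [CharZero K] in
theorem NExp.Pairing.long {U : NExp K n} {i : Fin n} {g₁ g₃ : ℕ → K} {e₁ e₃ : ℤ}
    {κ₁ κ₃ : K} (h₁ : U.Pairing (Zop K (-1) i) g₁ e₁ κ₁)
    (h₃ : U.Pairing (Yop s (-1) i) g₃ e₃ κ₃) :
    U.Pairing (longComp s i) (fun k => ((s ^ 2) ^ k + ((s ^ 2) ^ k)⁻¹) * g₁ k + g₃ k)
      (2 * e₁ + e₃) (κ₁ ^ 2 * κ₃) :=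
  (((h₁.rescale_right (s ^ 2)).mul_right (h₁.rescale_right (s ^ 2)⁻¹)).mul_right h₃).congr
    (fun k => by simp only [Pi.add_apply, inv_pow]; ring) (by ring) (by ring)

theorem pairing_short_short (hq : ∀ k : ℕ, 0 < k → qHalf s k ≠ 0) (i j i' j' : Fin n) {u : K}
    (hu : u ≠ 0) (v : K) :
    (shortComp s i j u).Pairing (shortComp s i' j' v)
      (fun k => -(delta i i' : ℤ) + (u ^ k)⁻¹ * (delta j i' : ℤ) + v ^ k * (delta i j' : ℤ)
        - (v ^ k * (u ^ k)⁻¹) * (delta j j' : ℤ) + yContr s (twoForm i i') k)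
      (delta i i' - delta j i' - delta i j' + delta j j' - twoForm i i')
      (u ^ (delta j j' - delta j i')) :=
  ((pairing_short_Zop i j i' (-1) hu).short (pairing_short_Zop i j j' 1 hu)
    (pairing_short_Yop hq i j i' hu) v).congr (fun k => by push_cast; ring) (by ring)
    (by rw [mul_one, ← zpow_add₀ hu]; congr 1; ring)

theorem pairing_short_long (hq : ∀ k : ℕ, 0 < k → qHalf s k ≠ 0) (i j l : Fin n) {u : K}
    (hu : u ≠ 0) :
    (shortComp s i j u).Pairing (longComp s l)
      (fun k => ((s ^ 2) ^ k + ((s ^ 2) ^ k)⁻¹) * ((u ^ k)⁻¹ * (delta j l : ℤ) - (delta i l : ℤ))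
        + yContr s (twoForm i l) k)
      (2 * (delta i l - delta j l) - twoForm i l) (u ^ (-2 * delta j l)) :=
  ((pairing_short_Zop i j l (-1) hu).long (pairing_short_Yop hq i j l hu)).congr
    (fun k => by push_cast; ring) (by ring)
    (by rw [mul_one, ← zpow_natCast, ← zpow_mul]; congr 1; push_cast; ring)

theorem pairing_long_short (hs : s ≠ 0) (hq : ∀ k : ℕ, 0 < k → qHalf s k ≠ 0) (l i j : Fin n)
    (v : K) : (longComp s l).Pairing (shortComp s i j v)
      (fun k => ((s ^ 2) ^ k + ((s ^ 2) ^ k)⁻¹) * (v ^ k * (delta l j : ℤ) - (delta l i : ℤ))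
        + yContr s (twoForm l i) k)
      (2 * (delta l i - delta l j) - twoForm l i) 1 :=
  ((pairing_long_Zop hs l i (-1)).short (pairing_long_Zop hs l j 1)
    (pairing_long_Yop hs hq l i) v).congr (fun k => by push_cast; ring) (by ring) (by ring)

variable (hs : s ≠ 0) (hq : ∀ k : ℕ, 0 < k → qHalf s k ≠ 0)
include hs hq

/-- The contraction `-1` of the two `Z_i^-` cancels the `1` in `1 + q^{-k}` from the `Y`-parts,
leaving `q^{-k} - (v/u)^k`. -/
theorem ope_short_self {i j : Fin n} (h : (j : ℕ) = i + 1) {u : K} (hu : u ≠ 0) (v : K) :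
    (shortComp s i j u).OPE (shortComp s i j v) (v / u) ((s ^ 2) ^ 2)⁻¹ u := by
  have hij : i ≠ j := fun e => by rw [e] at h; omega
  have hf : twoForm i i = 2 := by
    simp [twoForm_of_succ h, simpleRoot_of_succ h, delta, hij, hij.symm]
  refine (pairing_short_short hq i j i j hu v).ope ?_ ?_ ?_
  · simp [hf, delta, hij, hij.symm]
  · intro k hk
    simp only [hf, yContr_two hs (hq k hk), delta, hij, hij.symm]
    simp [div_pow]
    field_simp
    ring
  · simp [delta, hij.symm]

-- The contraction is `u^{-k} - q^{-k/2}`, which vanishes for `u = q^{1/2}`. This is why the two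
-- summands of the difference operator behave differently.
omit hs in
theorem ope_short_succ {i j l : Fin n} (h : (j : ℕ) = i + 1) (h' : (l : ℕ) = j + 1) {u a b : K}
    (hu : u ≠ 0) (v : K) (hab : ∀ k, (u ^ k)⁻¹ - ((s ^ 2) ^ k)⁻¹ = b ^ k - a ^ k) :
    (shortComp s i j u).OPE (shortComp s j l v) a b u⁻¹ := by
  have hij : i ≠ j := fun e => by rw [e] at h; omega
  have hjl : j ≠ l := fun e => by rw [e] at h'; omega
  have hil : i ≠ l := fun e => by rw [e] at h; omega
  have hf : twoForm i j = -1 := by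
    simp [twoForm_of_succ h, simpleRoot_of_succ h', delta, hij.symm, hjl.symm, hil.symm]
  refine (pairing_short_short hq i j j l hu v).ope ?_ ?_ ?_
  · simp [hf, delta, hij, hjl, hil]
  · intro k hk
    simp only [hf, yContr_neg_one (hq k hk), delta, hij, hjl, hil]
    simp [← hab]
    ring
  · simp [delta, hjl]

omit hs in
theorem ope_succ_short {i j l : Fin n} (h : (j : ℕ) = i + 1) (h' : (l : ℕ) = j + 1) {u v a b : K}
    (hu : u ≠ 0) (hab : ∀ k, v ^ k - ((s ^ 2) ^ k)⁻¹ = b ^ k - a ^ k) :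
    (shortComp s j l u).OPE (shortComp s i j v) a b 1 := by
  have hij : i ≠ j := fun e => by rw [e] at h; omega
  have hjl : j ≠ l := fun e => by rw [e] at h'; omega
  have hil : i ≠ l := fun e => by rw [e] at h; omega
  have hf : twoForm j i = -1 := by
    simp [twoForm_of_succ h', simpleRoot_of_succ h, delta, hij, hjl, hil]
  refine (pairing_short_short hq j l i j hu v).ope ?_ ?_ ?_
  · simp [hf, delta, hij.symm, hjl.symm, hil.symm]
  · intro k hk
    simp only [hf, yContr_neg_one (hq k hk), delta, hij.symm, hjl.symm, hil.symm]
    simp [← hab]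
    ring
  · simp [delta, hjl.symm, hil.symm]

omit hs in
theorem ope_short_far {i j i' j' : Fin n} (h : (j : ℕ) = i + 1) (h' : (j' : ℕ) = i' + 1)
    (h1 : i ≠ i') (h2 : j ≠ i') (h3 : i ≠ j') {u : K} (hu : u ≠ 0) (v : K) :
    (shortComp s i j u).OPE (shortComp s i' j' v) 0 0 1 := by
  have h4 : j ≠ j' := fun e => h1 (Fin.ext (by rw [e] at h; omega))
  have hf : twoForm i i' = 0 := by
    simp [twoForm_of_succ h, simpleRoot_of_succ h', delta, h1.symm, h2.symm, h3.symm, h4.symm]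
  refine (pairing_short_short hq i j i' j' hu v).ope_zero ?_ ?_ ?_
  · simp [hf, delta, h1, h2, h3, h4]
  · intro k hk
    simp [hf, delta, h1, h2, h3, h4, yContr_zero]
  · simp [delta, h4, h2]

/-- For `u = q^{1/2}` the left side of `hab` is zero; for `u = q^{-1/2}` it is `q^k - q^{-k}`, so
the exchange parameter becomes `q`. -/
theorem ope_short_long {i j : Fin n} (h : (j : ℕ) = i + 1) (h' : (j : ℕ) + 1 = n) {u a b : K}
    (hu : u ≠ 0) (hab : ∀ k, ((s ^ 2) ^ k + ((s ^ 2) ^ k)⁻¹) * (u ^ k)⁻¹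
      - (1 + (((s ^ 2) ^ 2) ^ k)⁻¹) = b ^ k - a ^ k) :
    (shortComp s i j u).OPE (longComp s j) a b (u ^ 2)⁻¹ := by
  have hij : i ≠ j := fun e => by rw [e] at h; omega
  have hf : twoForm i j = -2 := by
    simp [twoForm_of_succ h, simpleRoot_of_last h', delta, hij.symm]
  refine (pairing_short_long hq i j j hu).ope ?_ ?_ ?_
  · simp [hf, delta, hij]
  · intro k hk
    simp only [hf, yContr_neg, yContr_two hs (hq k hk), delta, hij]
    simp only [← hab]
    simp
    ring
  · simp [delta, zpow_neg]

theorem ope_long_short {i j : Fin n} (h : (j : ℕ) = i + 1) (h' : (j : ℕ) + 1 = n) {v a b : K}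
    (hab : ∀ k, ((s ^ 2) ^ k + ((s ^ 2) ^ k)⁻¹) * v ^ k
      - (1 + (((s ^ 2) ^ 2) ^ k)⁻¹) = b ^ k - a ^ k) :
    (longComp s j).OPE (shortComp s i j v) a b 1 := by
  have hij : i ≠ j := fun e => by rw [e] at h; omega
  have hf : twoForm j i = -2 := by
    rw [twoForm_comm]
    simp [twoForm_of_succ h, simpleRoot_of_last h', delta, hij.symm]
  refine (pairing_long_short hs hq j i j v).ope ?_ ?_ rfl
  · simp [hf, delta, hij.symm]
  · intro k hk
    simp only [hf, yContr_neg, yContr_two hs (hq k hk), delta, hij.symm]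
    simp only [← hab]
    simp
    ring

omit hs in
theorem ope_short_long_far {i j l : Fin n} (h : (j : ℕ) = i + 1) (h' : (l : ℕ) + 1 = n)
    (hjl : j ≠ l) {u : K} (hu : u ≠ 0) : (shortComp s i j u).OPE (longComp s l) 0 0 1 := by
  have hil : i ≠ l := fun e => by rw [e] at h; omega
  have hf : twoForm i l = 0 := by
    simp [twoForm_of_succ h, simpleRoot_of_last h', delta, hil.symm, hjl.symm]
  refine (pairing_short_long hq i j l hu).ope_zero ?_ ?_ ?_
  · simp [hf, delta, hil, hjl]
  · intro k hk
    simp [hf, delta, hil, hjl, yContr_zero]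
  · simp [delta, hjl]

theorem ope_long_short_far {i j l : Fin n} (h : (j : ℕ) = i + 1) (h' : (l : ℕ) + 1 = n)
    (hjl : j ≠ l) (v : K) : (longComp s l).OPE (shortComp s i j v) 0 0 1 := by
  have hil : i ≠ l := fun e => by rw [e] at h; omega
  have hf : twoForm l i = 0 := by
    rw [twoForm_comm]
    simp [twoForm_of_succ h, simpleRoot_of_last h', delta, hil.symm, hjl.symm]
  refine (pairing_long_short hs hq l i j v).ope_zero ?_ ?_ rfl
  · simp [hf, delta, hil.symm, hjl.symm]
  · intro k hk
    simp [hf, delta, hil.symm, hjl.symm, yContr_zero]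

end Currents

-- Duality of `a_{\bar 1}` with the simple root oscillators.

section VertexOperator

variable {K : Type*} [Field K] {n : ℕ}

theorem qSum_mul {s : K} (hs : s ≠ 0) (x y : ℤ) :
    qSum s x * qSum s y = qSum s (x + y) + qSum s (x - y) := by
  have e1 : 2 * (x + y) = 2 * x + 2 * y := by ring
  have e2 : 2 * (x - y) = 2 * x + -(2 * y) := by ring
  have e3 : -(2 * x + 2 * y) = -(2 * x) + -(2 * y) := by ring
  have e4 : -(2 * x + -(2 * y)) = -(2 * x) + 2 * y := by ring
  simp only [qSum, e1, e2, e3, e4, zpow_add₀ hs]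
  ring

variable [NeZero n] {s : K}

/-- The normalised coefficients of `a_{\bar 1}(k)`. -/
def abarWeight (s : K) (i : Fin n) (k : ℤ) : K :=
  if (i : ℕ) + 1 = n then 1 else qSum s (((n : ℤ) - (i : ℕ)) * k)

/-- All quotients of quantum integers simplify by `qHalf_two_mul`; at the last node `d_n = 1` makes
the middle quotient equal to 1. -/
theorem abarCoeff_eq (hn : 2 ≤ n) (hs : s ≠ 0) (hq : ∀ k : ℤ, k ≠ 0 → qHalf s k ≠ 0) (i : Fin n)
    {k : ℤ} (hk : k ≠ 0) : abarCoeff s i k =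
      k / qHalf s k ^ 2 * abarWeight s i k / qSum s (((n : ℤ) + 1) * k) := by
  have hi := i.isLt
  have h0 : twoD (0 : Fin n) = 1 := by
    have : ((0 : Fin n) : ℕ) + 1 ≠ n := by rw [Fin.val_zero]; omega
    rw [twoD, if_neg this]
  have h1 : ((n : ℤ) + 1) * k ≠ 0 := mul_ne_zero (by omega) hk
  have h2 : ((n : ℤ) - (i : ℕ)) * k ≠ 0 := mul_ne_zero (by omega) hk
  have h3 : 2 * (((n : ℤ) + 1) * k) ≠ 0 := mul_ne_zero two_ne_zero h1
  have e3 := hq _ h3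
  rw [qHalf_two_mul hs] at e3
  rw [abarCoeff, h0, one_mul, mul_assoc 2 ((n : ℤ) + 1), mul_assoc 2 ((n : ℤ) - (i : ℕ)),
    qHalf_two_mul hs (((n : ℤ) + 1) * k), abarWeight]
  have hA := left_ne_zero_of_mul e3
  have hB := right_ne_zero_of_mul e3
  have hC := hq _ h2
  split_ifs with hin
  · have : (n : ℤ) - (i : ℕ) = 1 := by omega
    rw [twoD, if_pos hin, this, one_mul, mul_one, div_self (hq _ (mul_ne_zero two_ne_zero hk))]
    field_simp
  · rw [twoD, if_neg hin, one_mul, qHalf_two_mul hs]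
    field_simp

omit [NeZero n] in
theorem qHalf_mul_twoForm_of_far (s : K) {i j : Fin n} (h : i ≠ j) (h1 : (i : ℕ) + 1 ≠ j)
    (h2 : (j : ℕ) + 1 ≠ i) (k : ℤ) : qHalf s (k * twoForm i j) = 0 := by
  have hf : twoForm i j = 0 := by
    refine Finset.sum_eq_zero fun l _ => ?_
    simp only [simpleRoot, Fin.ext_iff] at h ⊢
    split_ifs <;> first | rfl | (exfalso; omega)
  simp [hf, qHalf]

omit [NeZero n] in
theorem twoForm_self_of_succ {i j : Fin n} (h : (j : ℕ) = i + 1) : twoForm i i = 2 := by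
  have hij : i ≠ j := fun e => by rw [e] at h; omega
  simp [twoForm_of_succ h, simpleRoot_of_succ h, delta, hij, hij.symm]

omit [NeZero n] in
theorem twoForm_self_of_last {i : Fin n} (h : (i : ℕ) + 1 = n) : twoForm i i = 4 := by
  simp [twoForm_of_last h, simpleRoot_of_last h, delta]

-- The doubled form between the last two nodes compensates for the exceptional weight 1 of the last
-- node, so the formula is uniform.
omit [NeZero n] in
theorem abarWeight_mul_succ (hs : s ≠ 0) {i j : Fin n} (h : (j : ℕ) = i + 1) (k : ℤ) :
    abarWeight s j k * qHalf s (k * twoForm j i) =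
      -(qHalf s k * qSum s (((n : ℤ) - (j : ℕ)) * k)) := by
  have hij : i ≠ j := fun e => by rw [e] at h; omega
  by_cases hj : (j : ℕ) + 1 = n
  · have hf : twoForm j i = -2 := by
      simp [twoForm_of_last hj, simpleRoot_of_succ h, delta, hij]
    have e : (n : ℤ) - (j : ℕ) = 1 := by omega
    rw [abarWeight, if_pos hj, hf, e, one_mul, one_mul, mul_comm k, neg_mul, qHalf_neg,
      qHalf_two_mul hs]
  · have hjn := j.isLt
    have hl : ((⟨j + 1, by omega⟩ : Fin n) : ℕ) = j + 1 := rfl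
    have hf : twoForm j i = -1 := by
      simp [twoForm_of_succ hl, simpleRoot_of_succ h, delta, hij, Fin.ext_iff]
      omega
    rw [abarWeight, if_neg hj, hf, mul_neg_one, qHalf_neg]
    ring

/-- Away from the ends this is the three-term recursion of `x ↦ q^x + q^{-x}`. At the first node the
left neighbour is missing, and the term it would have cancelled survives. -/
theorem sum_abarWeight (hs : s ≠ 0) {j : Fin n} (hn : 2 ≤ n) (k : ℤ) :
    ∑ i, abarWeight s i k * qHalf s (k * twoForm i j) =
      if j = 0 then qHalf s k * qSum s (((n : ℤ) + 1) * k) else 0 := by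
  have hjn := j.isLt
  have up : ∀ (l : Fin n), (l : ℕ) = j + 1 → abarWeight s j k * qHalf s (k * twoForm j j) +
      abarWeight s l k * qHalf s (k * twoForm l j) =
        qHalf s k * qSum s (((n : ℤ) - (j : ℕ) + 1) * k) := by
    intro l hl
    have hlast : (j : ℕ) + 1 ≠ n := by have := l.isLt; omega
    have e : ((n : ℤ) - (j : ℕ)) * k - k = ((n : ℤ) - (l : ℕ)) * k := by
      rw [hl]; push_cast; ring
    have e' : ((n : ℤ) - (j : ℕ)) * k + k = ((n : ℤ) - (j : ℕ) + 1) * k := by ring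
    have := qSum_mul hs (((n : ℤ) - (j : ℕ)) * k) k
    rw [e, e'] at this
    rw [abarWeight_mul_succ hs hl, twoForm_self_of_succ hl, abarWeight, if_neg hlast, mul_comm k,
      qHalf_two_mul hs]
    linear_combination qHalf s k * this
  have last : (j : ℕ) + 1 = n → abarWeight s j k * qHalf s (k * twoForm j j) =
        qHalf s k * (qSum s k * qSum s (2 * k)) := by
    intro hl
    rw [twoForm_self_of_last hl, abarWeight, if_pos hl, mul_comm k, show (4 : ℤ) = 2 * 2 by norm_num,
      mul_assoc, qHalf_two_mul hs, qHalf_two_mul hs]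
    ring
  have down : ∀ (l : Fin n), (j : ℕ) = l + 1 → abarWeight s l k * qHalf s (k * twoForm l j) =
        qHalf s (k * twoForm l j) * qSum s (((n : ℤ) - (j : ℕ) + 1) * k) := by
    intro l hl
    have e : (n : ℤ) - (l : ℕ) = (n : ℤ) - (j : ℕ) + 1 := by omega
    rw [abarWeight, if_neg (by omega), e, mul_comm]
  have hz : ∀ i : Fin n, i ≠ j → (i : ℕ) + 1 ≠ j → (j : ℕ) + 1 ≠ i →
      abarWeight s i k * qHalf s (k * twoForm i j) = 0 := fun i h h1 h2 => by
    rw [qHalf_mul_twoForm_of_far s h h1 h2, mul_zero]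
  by_cases hj0 : j = 0
  · have hjv : (j : ℕ) = 0 := by rw [hj0]; rfl
    have h1 : (j : ℕ) + 1 < n := by omega
    rw [if_pos hj0, Finset.sum_eq_add j ⟨j + 1, h1⟩, up ⟨j + 1, h1⟩ rfl, hjv]
    · simp
    · intro e; have := congrArg Fin.val e; simp at this
    · rintro i - ⟨hi1, hi2⟩
      exact hz i hi1 (by omega) (fun e => hi2 (Fin.ext e.symm))
    · simp
    · simp
  · have hjv : (j : ℕ) ≠ 0 := fun e => hj0 (Fin.ext e)
    have hlj : (j : ℕ) = ((⟨j - 1, by omega⟩ : Fin n) : ℕ) + 1 := by simp; omega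
    generalize (⟨j - 1, by omega⟩ : Fin n) = l at hlj
    have hlj' : l ≠ j := fun e => by rw [e] at hlj; omega
    rw [if_neg hj0]
    by_cases hjl : (j : ℕ) + 1 = n
    · have hf : twoForm l j = -2 := by
        rw [twoForm_comm]
        simp [twoForm_of_last hjl, simpleRoot_of_succ hlj, delta, hlj']
      rw [Finset.sum_eq_add l j hlj', down l hlj, last hjl, hf, mul_comm k, neg_mul, qHalf_neg,
        qHalf_two_mul hs, show (n : ℤ) - (j : ℕ) + 1 = 2 by omega]
      · ring
      · rintro i - ⟨hi1, hi2⟩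
        exact hz i hi2 (fun e => hi1 (Fin.ext (by omega))) (fun e => by have := i.isLt; omega)
      · simp
      · simp
    · have h1 : (j : ℕ) + 1 < n := by omega
      have hf : twoForm l j = -1 := by
        simp [twoForm_of_succ hlj, simpleRoot_of_succ (i := j) (j := ⟨j + 1, h1⟩) rfl, delta,
          hlj'.symm, Fin.ext_iff]
        omega
      have hu := up ⟨j + 1, h1⟩ rfl
      generalize hm : (⟨j + 1, h1⟩ : Fin n) = m at hu
      have hmv : (m : ℕ) = j + 1 := by rw [← hm]
      rw [← Finset.sum_subset (Finset.subset_univ {l, j, m}), Finset.sum_insert, Finset.sum_pair, hu,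
        down l hlj, hf, mul_neg_one, qHalf_neg]
      · ring
      · intro e; rw [← e] at hmv; omega
      · simp only [Finset.mem_insert, Finset.mem_singleton, not_or]
        exact ⟨hlj', fun e => by rw [← e] at hmv; omega⟩
      · intro i _ hi
        simp only [Finset.mem_insert, Finset.mem_singleton, not_or] at hi
        exact hz i hi.2.1 (fun e => hi.1 (Fin.ext (by omega))) (fun e => hi.2.2 (Fin.ext (by omega)))

theorem sum_abarCoeff (hn : 2 ≤ n) (hs : s ≠ 0) (hq : ∀ k : ℤ, k ≠ 0 → qHalf s k ≠ 0) (j : Fin n)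
    {k : ℤ} (hk : k ≠ 0) : ∑ i, abarCoeff s i k * qHalf s (k * twoForm i j) =
      if j = 0 then k / qHalf s k else 0 := by
  have h1 : ((n : ℤ) + 1) * k ≠ 0 := mul_ne_zero (by omega) hk
  have e3 := hq _ (mul_ne_zero two_ne_zero h1)
  rw [qHalf_two_mul hs] at e3
  have hB := right_ne_zero_of_mul e3
  have hA := hq k hk
  have : ∀ i, abarCoeff s i k * qHalf s (k * twoForm i j) = k / qHalf s k ^ 2 /
      qSum s (((n : ℤ) + 1) * k) * (abarWeight s i k * qHalf s (k * twoForm i j)) := fun i => by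
    rw [abarCoeff_eq hn hs hq i hk]
    ring
  rw [Finset.sum_congr rfl fun i _ => this i, ← Finset.mul_sum, sum_abarWeight hs hn]
  split_ifs
  · field_simp
  · rw [mul_zero]

theorem abarCoeff_neg (s : K) (i : Fin n) (k : ℤ) : abarCoeff s i (-k) = -abarCoeff s i k := by
  simp only [abarCoeff, mul_neg, qHalf_neg, neg_div_neg_eq, Int.cast_neg, neg_sq]
  ring

end VertexOperator

-- Contractions of the `a`-part of the vertex operator.

section Phi

variable {K : Type*} [Field K] {n : ℕ} [NeZero n] {s : K}

/-- `q ^ (n + 1 / 2)`. -/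
def qShift (s : K) (n : ℕ) : K := s ^ (4 * (n : ℤ) + 2)

omit [NeZero n] in
theorem qShift_ne_zero (hs : s ≠ 0) : qShift s n ≠ 0 := zpow_ne_zero _ hs

theorem good_phiA (s : K) (κ : ZMod 2 × Bool → ℤ) (c : ZMod 2 × Bool → K) :
    (phiA (n := n) s κ c).Good where
  up := IsUp.smul (IsUp.sum Finset.univ fun i => (isUp_aNeg i).smul
    fun k => abarCoeff s i (-((k : ℕ) : ℤ))) _
  dn := IsDn.smul (IsDn.sum Finset.univ fun i => (isDn_aPos s i).smul
    fun k => abarCoeff s i ((k : ℕ) : ℤ)) _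

theorem isContr_phiA_dn (s : K) (κ : ZMod 2 × Bool → ℤ) (c : ZMod 2 × Bool → K)
    {A : ℕ+ → Module.End K (Pol K n)} {γ : Fin n → ℕ+ → K} (h : ∀ i, IsContr (aPos s i) A (γ i)) :
    IsContr (phiA s κ c).dn A (fun k => qHalf s k / ((k : ℕ) : K) *
      s ^ (-((4 * (n : ℤ) + 3) * ((k : ℕ) : ℤ))) * ∑ i, abarCoeff s i ((k : ℕ) : ℤ) * γ i k) := by
  have := (IsContr.sum_left Finset.univ fun i => (h i).smul_left
    fun k => abarCoeff s i ((k : ℕ) : ℤ)).smul_left fun k => qHalf s k / ((k : ℕ) : K) *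
      s ^ (-((4 * (n : ℤ) + 3) * ((k : ℕ) : ℤ)))
  refine Eq.mp (congrArg (IsContr _ _) (funext fun k => ?_)) this
  simp only [Pi.mul_apply, Finset.sum_apply]

theorem isContr_phiA_up (s : K) (κ : ZMod 2 × Bool → ℤ) (c : ZMod 2 × Bool → K)
    {B : ℕ+ → Module.End K (Pol K n)} {γ : Fin n → ℕ+ → K} (h : ∀ i, IsContr B (aNeg K i) (γ i)) :
    IsContr B (phiA s κ c).up (fun k => qHalf s k / ((k : ℕ) : K) *
      s ^ ((4 * (n : ℤ) + 1) * ((k : ℕ) : ℤ)) * ∑ i, abarCoeff s i (-((k : ℕ) : ℤ)) * γ i k) := by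
  have := (IsContr.sum_right Finset.univ fun i => (h i).smul_right
    fun k => abarCoeff s i (-((k : ℕ) : ℤ))).smul_right fun k => qHalf s k / ((k : ℕ) : K) *
      s ^ ((4 * (n : ℤ) + 1) * ((k : ℕ) : ℤ))
  refine Eq.mp (congrArg (IsContr _ _) (funext fun k => ?_)) this
  simp only [Pi.mul_apply, Finset.sum_apply]

theorem pairing_phiA_Zop (s : K) (κ : ZMod 2 × Bool → ℤ) (c : ZMod 2 × Bool → K) (τ : ℤ)
    (i : Fin n) : (phiA s κ c).Pairing (Zop K τ i) 0 0 1 where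
  left := good_phiA s κ c
  right := good_Zop τ i
  contr := ⟨_, isContr_phiA_dn s κ c fun j => (isContr_a_b s j i).smul_right _, fun k => by simp⟩
  expo γ := by simp [phiA, Zop, Charge.translate, Charge.coset]
  coef γ := by simp [phiA, Zop, Charge.translate, Charge.coset]

theorem pairing_Zop_phiA (s : K) (κ : ZMod 2 × Bool → ℤ) (c : ZMod 2 × Bool → K) (τ : ℤ)
    (i : Fin n) : (Zop K τ i).Pairing (phiA s κ c) 0 0 1 where
  left := good_Zop τ i
  right := good_phiA s κ c
  contr := ⟨_, isContr_phiA_up s κ c fun j => (isContr_b_a i j).smul_left _, fun k => by simp⟩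
  expo γ := by simp [phiA, Zop, Charge.translate]
  coef γ := (one_mul _).symm

-- The coordinates of every simple root have even sum, so the coset-dependent constants of the
-- vertex operator are not seen by the currents.
omit [NeZero n] in
theorem coset_translate_simpleRoot (γ : Charge n) (j : Fin n) :
    (γ.translate (fun l => -1 * simpleRoot j l, 0)).coset = γ.coset := by
  have h : ((∑ l, simpleRoot j l : ℤ) : ZMod 2) = 0 := by
    have hj := j.isLt
    rcases Nat.lt_or_ge (j + 1) n with h | h
    · have := sum_delta_mul j (fun _ => (1 : ℤ))
      have h2 := sum_delta_mul (⟨j + 1, h⟩ : Fin n) (fun _ => (1 : ℤ))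
      simp only [mul_one] at this h2
      simp only [simpleRoot_of_succ (i := j) (j := ⟨j + 1, h⟩) rfl, Finset.sum_sub_distrib, this, h2]
      simp
    · have := sum_delta_mul j (fun _ => (1 : ℤ))
      simp only [mul_one] at this
      simp only [simpleRoot_of_last (i := j) (by omega), ← Finset.mul_sum, this]
      decide
  simp only [Charge.coset, Charge.translate, Pi.add_apply, Finset.sum_add_distrib, ← Finset.mul_sum]
  rw [Int.cast_add, Int.cast_mul, h, mul_zero, add_zero]

variable [CharZero K]

/-- By duality only the first node contributes. The powers `q^{-(n+3/4)k}` and `q^{-k/4}` combine to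
`q^{-(n+1)k}`. -/
theorem pairing_phiA_Yop (hn : 2 ≤ n) (hs : s ≠ 0) (hq : ∀ k : ℤ, k ≠ 0 → qHalf s k ≠ 0)
    (κ : ZMod 2 × Bool → ℤ) (c : ZMod 2 × Bool → K) (j : Fin n) :
    (phiA s κ c).Pairing (Yop s (-1) j) (fun k => -(delta 0 j : ℤ) * ((s ^ 2 * qShift s n) ^ k)⁻¹)
      (simpleRoot j 0) (qShift s n ^ simpleRoot j 0) where
  left := good_phiA s κ c
  right := good_Yop s _ j
  contr := ⟨_, isContr_phiA_dn s κ c fun i => (isContr_a_a s i j).smul_right _, fun k => by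
    have h0 : ((k : ℕ) : K) ≠ 0 := by exact_mod_cast k.ne_zero
    have hk : ((k : ℕ) : ℤ) ≠ 0 := by exact_mod_cast k.ne_zero
    have h1 := hq _ hk
    have e : ((s ^ 2 * qShift s n) ^ (k : ℕ))⁻¹ = s ^ (-((4 * (n : ℤ) + 3) * ((k : ℕ) : ℤ))) *
        s ^ (-1 * ((k : ℕ) : ℤ)) := by
      rw [qShift, ← zpow_natCast s 2, ← zpow_add₀ hs, ← zpow_natCast, ← zpow_mul, ← zpow_neg,
        ← zpow_add₀ hs]
      congr 1
      push_cast
      ring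
    have hsum := sum_abarCoeff hn hs hq j hk
    simp only [Pi.mul_apply]
    rw [Finset.sum_congr rfl fun i _ => show _ = (s ^ (-1 * ((k : ℕ) : ℤ)) / ((k : ℕ) : K) * (-1)) *
      (abarCoeff s i ((k : ℕ) : ℤ) * qHalf s (((k : ℕ) : ℤ) * twoForm i j)) from ?_,
      ← Finset.mul_sum, hsum, e]
    · simp only [delta, eq_comm (a := (0 : Fin n))]
      split_ifs
      · push_cast
        field_simp
      · simp
    · rw [qHalf_neg]
      push_cast
      field_simp⟩
  expo γ := by
    change -((γ.translate (fun l => -1 * simpleRoot j l, 0)).fst 0) +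
      κ (γ.translate (fun l => -1 * simpleRoot j l, 0)).coset = -γ.fst 0 + κ γ.coset + simpleRoot j 0
    rw [coset_translate_simpleRoot]
    simp only [Charge.translate, Pi.add_apply]
    ring
  coef γ := by
    change c (γ.translate (fun l => -1 * simpleRoot j l, 0)).coset *
      qShift s n ^ (-((γ.translate (fun l => -1 * simpleRoot j l, 0)).fst 0) +
      κ (γ.translate (fun l => -1 * simpleRoot j l, 0)).coset) =
        qShift s n ^ simpleRoot j 0 * (c γ.coset * qShift s n ^ (-γ.fst 0 + κ γ.coset))
    rw [coset_translate_simpleRoot, mul_left_comm, ← zpow_add₀ (qShift_ne_zero hs)]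
    simp only [Charge.translate, Pi.add_apply]
    congr 2
    ring

/-- In this order the powers are `q^{(n+1/4)k}` and `q^{-k/4}`, giving `q^{nk}`. -/
theorem pairing_Yop_phiA (hn : 2 ≤ n) (hs : s ≠ 0) (hq : ∀ k : ℤ, k ≠ 0 → qHalf s k ≠ 0)
    (κ : ZMod 2 × Bool → ℤ) (c : ZMod 2 × Bool → K) (j : Fin n) :
    (Yop s (-1) j).Pairing (phiA s κ c) (fun k => -(delta 0 j : ℤ) * (qShift s n / s ^ 2) ^ k)
      (simpleRoot j 0) 1 where
  left := good_Yop s _ j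
  right := good_phiA s κ c
  contr := ⟨_, isContr_phiA_up s κ c fun i => (isContr_a_a s j i).smul_left _, fun k => by
    have h0 : ((k : ℕ) : K) ≠ 0 := by exact_mod_cast k.ne_zero
    have hk : ((k : ℕ) : ℤ) ≠ 0 := by exact_mod_cast k.ne_zero
    have h1 := hq _ hk
    have e : (qShift s n / s ^ 2) ^ (k : ℕ) = s ^ ((4 * (n : ℤ) + 1) * ((k : ℕ) : ℤ)) *
        s ^ (-1 * ((k : ℕ) : ℤ)) := by
      rw [qShift, ← zpow_natCast s 2, ← zpow_sub₀ hs, ← zpow_natCast, ← zpow_mul,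
        ← zpow_add₀ hs]
      congr 1
      push_cast
      ring
    have hsum := sum_abarCoeff hn hs hq j hk
    simp only [Pi.mul_apply]
    rw [Finset.sum_congr rfl fun i _ => show _ = (s ^ (-1 * ((k : ℕ) : ℤ)) / ((k : ℕ) : K) * (-1)) *
      (abarCoeff s i ((k : ℕ) : ℤ) * qHalf s (((k : ℕ) : ℤ) * twoForm i j)) from ?_,
      ← Finset.mul_sum, hsum, e]
    · simp only [delta, eq_comm (a := (0 : Fin n))]
      split_ifs
      · push_cast
        field_simp
      · simp
    · rw [qHalf_neg, abarCoeff_neg, twoForm_comm j i]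
      push_cast
      field_simp⟩
  expo γ := by
    change -(-1) * twoA0 j (γ.translate (Pi.single 0 1, 0)) = -(-1) * twoA0 j γ + _
    rw [twoA0_translate]
    simp [Pi.single_apply]
  coef γ := (one_mul _).symm

/-- The components of `Φ_{\bar 1}`. -/
def phiComp (s : K) (κ : ZMod 2 × Bool → ℤ) (c : ZMod 2 × Bool → K) (u : K) : NExp K n :=
  (phiA s κ c).mul ((Zop K 1 (0 : Fin n)).rescale (u * qShift s n))

end Phi

-- Operator products of the vertex operator with the currents.

section PhiContractions

variable {K : Type*} [Field K] [CharZero K] {n : ℕ} [NeZero n] {s : K}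
  (κ : ZMod 2 × Bool → ℤ) (c : ZMod 2 × Bool → K)

theorem pairing_phi_Zop (hs : s ≠ 0) (τ : ℤ) (l : Fin n) {u : K} (hu : u ≠ 0) :
    (phiComp s κ c u).Pairing (Zop K τ l) (fun k => ((u * qShift s n) ^ k)⁻¹ * (-(τ * delta 0 l) : ℤ))
      (τ * delta 0 l) ((u * qShift s n) ^ (τ * delta 0 l)) :=
  ((pairing_phiA_Zop s κ c τ l).mul_left ((pairing_Zop_Zop 1 τ 0 l).rescale_left
    (mul_ne_zero hu (qShift_ne_zero hs)))).congr (fun k => by simp) (by simp) (by simp)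

theorem pairing_phi_Yop (hn : 2 ≤ n) (hs : s ≠ 0) (hq : ∀ k : ℤ, k ≠ 0 → qHalf s k ≠ 0) (l : Fin n)
    {u : K} (hu : u ≠ 0) :
    (phiComp s κ c u).Pairing (Yop s (-1) l)
      (fun k => -(delta 0 l : ℤ) * ((s ^ 2 * qShift s n) ^ k)⁻¹)
      (simpleRoot l 0) (qShift s n ^ simpleRoot l 0) :=
  ((pairing_phiA_Yop hn hs hq κ c l).mul_left ((pairing_Zop_Yop s 1 (-1) 0 l).rescale_left
    (mul_ne_zero hu (qShift_ne_zero hs)))).congr (fun k => by simp) (by simp) (by simp)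

omit [CharZero K] in
theorem NExp.Pairing.phi {U : NExp K n} {g₁ g₂ : ℕ → K} {e₁ e₂ : ℤ} {κ₁ κ₂ : K}
    (h₁ : U.Pairing (phiA s κ c) g₁ e₁ κ₁) (h₂ : U.Pairing (Zop K 1 0) g₂ e₂ κ₂) (u : K) :
    U.Pairing (phiComp s κ c u) (fun k => g₁ k + (u * qShift s n) ^ k * g₂ k) (e₁ + e₂) (κ₁ * κ₂) :=
  h₁.mul_right (h₂.rescale_right _)

theorem pairing_short_phiA (hn : 2 ≤ n) (hs : s ≠ 0) (hq : ∀ k : ℤ, k ≠ 0 → qHalf s k ≠ 0)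
    (i j : Fin n) {v : K} (hv : v ≠ 0) :
    (shortComp s i j v).Pairing (phiA s κ c) (fun k => -(delta 0 i : ℤ) * (qShift s n / s ^ 2) ^ k)
      (simpleRoot i 0) 1 :=
  (((pairing_Zop_phiA s κ c (-1) i).mul_left ((pairing_Zop_phiA s κ c 1 j).rescale_left hv)).mul_left
    (pairing_Yop_phiA hn hs hq κ c i)).congr (fun k => by simp) (by simp) (by simp)

theorem pairing_long_phiA (hn : 2 ≤ n) (hs : s ≠ 0) (hq : ∀ k : ℤ, k ≠ 0 → qHalf s k ≠ 0)
    (i : Fin n) :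
    (longComp s i).Pairing (phiA s κ c) (fun k => -(delta 0 i : ℤ) * (qShift s n / s ^ 2) ^ k)
      (simpleRoot i 0) 1 :=
  ((((pairing_Zop_phiA s κ c (-1) i).rescale_left (pow_ne_zero 2 hs)).mul_left
    ((pairing_Zop_phiA s κ c (-1) i).rescale_left (inv_ne_zero (pow_ne_zero 2 hs)))).mul_left
    (pairing_Yop_phiA hn hs hq κ c i)).congr (fun k => by simp) (by simp) (by simp)

variable (hn : 2 ≤ n) (hs : s ≠ 0) (hq : ∀ k : ℤ, k ≠ 0 → qHalf s k ≠ 0)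
include hn hs hq

/-- The exponents `-1` from `Z_1^-` and `1` from `Y_1^-` cancel, so the product is a pure ratio; it
is trivial for `u = q^{1/2}`. -/
theorem ope_phi_short_zero {i j : Fin n} (hi : i = 0) (h : (j : ℕ) = i + 1) {u a b : K} (hu : u ≠ 0)
    (v : K) (hab : ∀ k, ((u * qShift s n) ^ k)⁻¹ - ((s ^ 2 * qShift s n) ^ k)⁻¹ = b ^ k - a ^ k) :
    (phiComp s κ c u).OPE (shortComp s i j v) a b u⁻¹ := by
  have hij : i ≠ j := fun e => by rw [e] at h; omega
  have hr : simpleRoot i i = 1 := by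
    rw [simpleRoot_of_succ h]
    simp [delta, hij.symm]
  have hQ := qShift_ne_zero (n := n) hs
  refine ((pairing_phi_Zop κ c hs (-1) i hu).short (pairing_phi_Zop κ c hs 1 j hu)
    (pairing_phi_Yop κ c hn hs hq i hu) v).ope ?_ ?_ ?_
  · simp [hr, ← hi, delta, hij]
  · intro k hk
    simp only [← hi, delta, hij, ← hab]
    simp
    ring
  · simp only [hr, ← hi, delta, hij]
    simp
    field_simp

theorem ope_short_zero_phi {i j : Fin n} (hi : i = 0) (h : (j : ℕ) = i + 1) {u v a b : K} (hv : v ≠ 0)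
    (hab : ∀ k, (u * qShift s n) ^ k - (qShift s n / s ^ 2) ^ k = b ^ k - a ^ k) :
    (shortComp s i j v).OPE (phiComp s κ c u) a b 1 := by
  have hij : i ≠ j := fun e => by rw [e] at h; omega
  have hr : simpleRoot i i = 1 := by
    rw [simpleRoot_of_succ h]
    simp [delta, hij.symm]
  refine ((pairing_short_phiA κ c hn hs hq i j hv).phi κ c (pairing_short_Zop i j 0 1 hv) u).ope ?_ ?_ ?_
  · simp [hr, ← hi, delta, hij.symm]
  · intro k hk
    simp only [← hi, delta, hij.symm, ← hab]
    simp
    ring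
  · simp [← hi, delta, hij.symm]

theorem ope_phi_short {i j : Fin n} (hi : i ≠ 0) (h : (j : ℕ) = i + 1) {u : K} (hu : u ≠ 0)
    (v : K) : (phiComp s κ c u).OPE (shortComp s i j v) 0 0 1 := by
  have hj : j ≠ 0 := fun e => by rw [e, Fin.val_zero] at h; omega
  have hr : simpleRoot i 0 = 0 := by
    rw [simpleRoot_of_succ h]
    simp [delta, hi, hj]
  refine ((pairing_phi_Zop κ c hs (-1) i hu).short (pairing_phi_Zop κ c hs 1 j hu)
    (pairing_phi_Yop κ c hn hs hq i hu) v).ope_zero ?_ ?_ ?_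
  · simp [hr, delta, hi.symm, hj.symm]
  · intro k hk
    simp [delta, hi.symm, hj.symm]
  · simp [hr, delta, hi.symm, hj.symm]

theorem ope_short_phi {i j : Fin n} (hi : i ≠ 0) (h : (j : ℕ) = i + 1) (u : K) {v : K} (hv : v ≠ 0) :
    (shortComp s i j v).OPE (phiComp s κ c u) 0 0 1 := by
  have hj : j ≠ 0 := fun e => by rw [e, Fin.val_zero] at h; omega
  have hr : simpleRoot i 0 = 0 := by
    rw [simpleRoot_of_succ h]
    simp [delta, hi, hj]
  refine ((pairing_short_phiA κ c hn hs hq i j hv).phi κ c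
    (pairing_short_Zop i j 0 1 hv) u).ope_zero ?_ ?_ ?_
  · simp [hr, delta, hi, hj]
  · intro k hk
    simp [delta, hi, hi.symm, hj]
  · simp [delta, hj]

theorem ope_phi_long {i : Fin n} (h : (i : ℕ) + 1 = n) {u : K} (hu : u ≠ 0) :
    (phiComp s κ c u).OPE (longComp s i) 0 0 1 := by
  have hi : i ≠ 0 := fun e => by rw [e, Fin.val_zero] at h; omega
  have hr : simpleRoot i 0 = 0 := by
    rw [simpleRoot_of_last h]
    simp [delta, hi]
  refine ((pairing_phi_Zop κ c hs (-1) i hu).long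
    (pairing_phi_Yop κ c hn hs hq i hu)).ope_zero ?_ ?_ ?_
  · simp [hr, delta, hi.symm]
  · intro k hk
    simp [delta, hi.symm]
  · simp [hr, delta, hi.symm]

theorem ope_long_phi {i : Fin n} (h : (i : ℕ) + 1 = n) (u : K) :
    (longComp s i).OPE (phiComp s κ c u) 0 0 1 := by
  have hi : i ≠ 0 := fun e => by rw [e, Fin.val_zero] at h; omega
  have hr : simpleRoot i 0 = 0 := by
    rw [simpleRoot_of_last h]
    simp [delta, hi]
  refine ((pairing_long_phiA κ c hn hs hq i).phi κ c (pairing_long_Zop hs i 0 1) u).ope_zero ?_ ?_ ?_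
  · simp [hr, delta, hi]
  · intro k hk
    simp [delta, hi, hi.symm]
  · simp

end PhiContractions

-- Relations between the currents.

section Relations

variable {K : Type*} [Field K] {n : ℕ} {s : K}

theorem xMinus_short (s : K) {i j : Fin n} (h : (j : ℕ) = i + 1) (m : ℤ) :
    xMinus s i m = (s ^ 2 - (s ^ 2)⁻¹)⁻¹ •
      ((shortComp s i j (s ^ 2)).field (-m) - (shortComp s i j (s ^ 2)⁻¹).field (-m)) := by
  have hi : (i : ℕ) + 1 < n := h ▸ j.isLt
  obtain rfl : j = ⟨i + 1, hi⟩ := Fin.ext h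
  have e : (s : K) ^ (-2 : ℤ) = (s ^ 2)⁻¹ := by rw [zpow_neg]; norm_cast
  have e' : (s : K) ^ (2 : ℤ) = s ^ 2 := by norm_cast
  rw [xMinus, dif_pos hi]
  simp only [e, e']
  rfl

theorem xMinus_long (s : K) {i : Fin n} (h : (i : ℕ) + 1 = n) (m : ℤ) :
    xMinus s i m = (s ^ 2 + (s ^ 2)⁻¹)⁻¹ • (longComp s i).field (-m - 1) := by
  have e : (s : K) ^ (-2 : ℤ) = (s ^ 2)⁻¹ := by rw [zpow_neg]; norm_cast
  have e' : (s : K) ^ (2 : ℤ) = s ^ 2 := by norm_cast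
  rw [xMinus, dif_neg (by omega)]
  simp only [e, e']
  rfl

theorem mul_comm_smul {V : Type*} [AddCommGroup V] [Module K V] {T A : Module.End K V} (x : K)
    (hA : T * A = A * T) : T * (x • A) = x • A * T := by
  rw [mul_smul_comm, smul_mul_assoc, hA]

theorem mul_comm_smul_sub {V : Type*} [AddCommGroup V] [Module K V] {T A B : Module.End K V} (x : K)
    (hA : T * A = A * T) (hB : T * B = B * T) : T * (x • (A - B)) = x • (A - B) * T :=
  mul_comm_smul x (by rw [mul_sub, sub_mul, hA, hB])

variable [CharZero K] (hs : s ≠ 0) (hq : ∀ k : ℕ, 0 < k → qHalf s k ≠ 0)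
include hs hq

theorem commute_xMinus {i j : Fin n} (hij : (i : ℕ) + 2 ≤ j) (m m' : ℤ) :
    xMinus s i m * xMinus s j m' = xMinus s j m' * xMinus s i m := by
  have hjn := j.isLt
  have hp : s ^ 2 ≠ 0 := pow_ne_zero 2 hs
  have hp' : (s ^ 2)⁻¹ ≠ 0 := inv_ne_zero hp
  obtain ⟨i', hi'⟩ : ∃ i' : Fin n, (i' : ℕ) = i + 1 := ⟨⟨i + 1, by omega⟩, rfl⟩
  have h1 : i ≠ j := fun e => by rw [e] at hij; omega
  have h2 : i' ≠ j := fun e => by rw [e] at hi'; omega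
  rw [xMinus_short s hi']
  rcases Nat.lt_or_ge (j + 1) n with hj | hj
  · obtain ⟨j', hj'⟩ : ∃ j' : Fin n, (j' : ℕ) = j + 1 := ⟨⟨j + 1, hj⟩, rfl⟩
    have h3 : i ≠ j' := fun e => by rw [← e] at hj'; omega
    rw [xMinus_short s hj']
    have key : ∀ {u v : K}, u ≠ 0 → v ≠ 0 →
        (shortComp s j j' v).field (-m') * (shortComp s i i' u).field (-m) =
          (shortComp s i i' u).field (-m) * (shortComp s j j' v).field (-m') :=
      fun {u v} hu hv => ((ope_short_far hq hj' hi' h1.symm h3.symm h2.symm hv u).field_comm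
        (ope_short_far hq hi' hj' h1 h2 h3 hu v)) _ _
    exact mul_comm_smul_sub _ (mul_comm_smul_sub _ (key hp hp) (key hp' hp)).symm
      (mul_comm_smul_sub _ (key hp hp') (key hp' hp')).symm
  · have hj : (j : ℕ) + 1 = n := by omega
    rw [xMinus_long s hj]
    have key : ∀ {u : K}, u ≠ 0 →
        (longComp s j).field (-m' - 1) * (shortComp s i i' u).field (-m) =
          (shortComp s i i' u).field (-m) * (longComp s j).field (-m' - 1) :=
      fun {u} hu => ((ope_long_short_far hs hq hi' hj h2 u).field_comm
        (ope_short_long_far hq hi' hj h2 hu)) _ _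
    exact mul_comm_smul _ (mul_comm_smul_sub _ (key hp) (key hp')).symm

/-- Relative to `x_{i+1}^-`, the current `x_i^-` behaves like the vertex operator relative to
`x_1^-`, with `μ = 1`. -/
theorem shortPair_xMinus {i j l : Fin n} (h : (j : ℕ) = i + 1) (h' : (l : ℕ) = j + 1) :
    ShortPair (s ^ 2) 1 (s ^ 2)⁻¹ 1 (shortComp s j l) (shortComp s i j) := by
  have hp : s ^ 2 ≠ 0 := pow_ne_zero 2 hs
  have hp' : (s ^ 2)⁻¹ ≠ 0 := inv_ne_zero hp
  have h0 : ∀ {u : K}, u = s ^ 2 ∨ u = (s ^ 2)⁻¹ → u ≠ 0 := by rintro u (rfl | rfl) <;> assumption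
  constructor
  · intro u v hu _
    exact ope_short_self hs hq h' (h0 hu) v
  · intro u hu
    rw [mul_inv_cancel₀ hp, div_one, div_one]
    exact ope_succ_short hq h h' (h0 hu) fun k => by rw [inv_pow]
  · intro u hu
    exact ope_short_succ hq h h' hp u fun k => by simp
  · intro u hu
    exact ope_succ_short hq h h' (h0 hu) fun k => by simp
  · intro u hu
    have := ope_short_succ hq h h' hp' u (a := 1 / s ^ 2) (b := s ^ 2 * 1) fun k => by simp
    simpa using this

theorem exchangeRel_short_long {i j : Fin n} (h : (j : ℕ) = i + 1) (h' : (j : ℕ) + 1 = n)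
    {u : K} (hu : u = s ^ 2 ∨ u = (s ^ 2)⁻¹) :
    ExchangeRel ((s ^ 2) ^ 2) (shortComp s i j u).field (longComp s j).field := by
  have hp : s ^ 2 ≠ 0 := pow_ne_zero 2 hs
  have hp' : (s ^ 2)⁻¹ ≠ 0 := inv_ne_zero hp
  have e1 : ∀ k, ((s ^ 2) ^ k + ((s ^ 2) ^ k)⁻¹) * (s ^ 2) ^ k - (1 + (((s ^ 2) ^ 2) ^ k)⁻¹) =
      ((s ^ 2) ^ 2) ^ k - (((s ^ 2) ^ 2)⁻¹) ^ k := fun k => by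
    have : (s ^ 2) ^ k ≠ 0 := pow_ne_zero k hp
    rw [inv_pow, ← pow_mul (s ^ 2) 2, mul_comm 2 k, pow_mul]
    field_simp
    ring
  have e2 : ∀ k, ((s ^ 2) ^ k + ((s ^ 2) ^ k)⁻¹) * ((s ^ 2) ^ k)⁻¹ - (1 + (((s ^ 2) ^ 2) ^ k)⁻¹) =
      0 ^ k - 0 ^ k := fun k => by
    have : (s ^ 2) ^ k ≠ 0 := pow_ne_zero k hp
    rw [← pow_mul (s ^ 2) 2, mul_comm 2 k, pow_mul]
    field_simp
    ring
  have key : ExchangeRel ((s ^ 2) ^ 2) (shortComp s i j u).field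
      (fun r => (1 : K) ^ r • (longComp s j).field r) := by
    obtain rfl | rfl := hu
    · exact (ope_short_long hs hq h h' hp e2).exchangeRel_left
        (ope_long_short hs hq h h' e1) one_ne_zero (pow_ne_zero 2 hp)
        (inv_mul_cancel₀ (pow_ne_zero 2 hp)) (mul_one _).symm (by field_simp)
    · exact (ope_short_long hs hq h h' hp' (fun k => by rw [inv_pow, inv_inv]; exact e1 k)).exchangeRel_right
        (ope_long_short hs hq h h' (fun k => by rw [inv_pow]; exact e2 k)) one_ne_zero
        (pow_ne_zero 2 hp) (mul_one _) (mul_one _) (by simp)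
  simpa only [one_zpow, one_smul] using key

end Relations

-- Mode relations required by the algebraic part.

section Assembly

variable {K : Type*} [Field K] {n : ℕ} [NeZero n] {s : K}

theorem zpow_ne_one {s : K} (hs : ∀ k : ℕ, 0 < k → s ^ k ≠ 1) {k : ℤ} (hk : k ≠ 0) :
    s ^ k ≠ 1 := by
  intro h
  refine hs k.natAbs (Int.natAbs_pos.2 hk) ?_
  obtain e | e := Int.natAbs_eq k
  · rw [e, zpow_natCast] at h
    exact h
  · rw [e, zpow_neg, zpow_natCast, inv_eq_one] at h
    exact h

theorem qHalf_ne_zero {s : K} (hs0 : s ≠ 0) (hs : ∀ k : ℕ, 0 < k → s ^ k ≠ 1) {k : ℤ} (hk : k ≠ 0) :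
    qHalf s k ≠ 0 := by
  have key : ∀ {m : ℤ}, m ≠ 0 → s ^ m - s ^ (-m) ≠ 0 := fun {m} hm h => by
    refine zpow_ne_one hs (k := m + m) (by omega) ?_
    rw [zpow_add₀ hs0]
    nth_rw 2 [sub_eq_zero.1 h]
    rw [← zpow_add₀ hs0, add_neg_cancel, zpow_zero]
  exact div_ne_zero (key (by omega)) (key (by norm_num))

theorem val_ofNat {i : ℕ} (h : i < n) : ((Fin.ofNat n i : Fin n) : ℕ) = i := Nat.mod_eq_of_lt h

/-- The four terms of the exchange relation are grouped by their modes; the bracket can be written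
in either order. -/
theorem ExchangeRel.qComm_eq {V : Type*} [AddCommGroup V] [Module K V] {p : K} (hp : p ≠ 0)
    {X Y : ℤ → Module.End K V} (h : ExchangeRel p X Y) (i r : ℤ) :
    qComm p⁻¹ (Y r) (X (i - 1)) = p⁻¹ • qComm p (Y (r - 1)) (X i) ∧
      qComm p⁻¹ (X i) (Y (r - 1)) = p⁻¹ • qComm p (X (i - 1)) (Y r) := by
  have e := h i r
  unfold qComm
  constructor
  · linear_combination (norm := skip) -p⁻¹ • e
    match_scalars <;> field_simp <;> ring
  · linear_combination (norm := skip) -p⁻¹ • e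
    match_scalars <;> field_simp <;> ring

theorem qComm_smul_left {R : Type*} [Ring R] [Algebra K R] (v x : K) (a b : R) :
    qComm v (x • a) b = x • qComm v a b := by
  unfold qComm
  rw [smul_mul_assoc, mul_smul_comm]
  module

theorem phiBarOne_eq (s : K) (κ : ZMod 2 × Bool → ℤ) (c : ZMod 2 × Bool → K) (r : ℤ) :
    phiBarOne (n := n) s κ c r = ((s ^ 2 - (s ^ 2)⁻¹) * qShift s n)⁻¹ •
      ((phiComp s κ c (s ^ 2)).field (r + 1) - (phiComp s κ c (s ^ 2)⁻¹).field (r + 1)) := by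
  have e : (s : K) ^ (-2 : ℤ) = (s ^ 2)⁻¹ := by rw [zpow_neg]; norm_cast
  have e' : (s : K) ^ (2 : ℤ) = s ^ 2 := by norm_cast
  simp only [phiBarOne, e, e']
  rfl

variable [CharZero K] (hn : 2 ≤ n) (hs : s ≠ 0) (hq : ∀ k : ℤ, k ≠ 0 → qHalf s k ≠ 0)
include hs hq

theorem currentRels : CurrentRels (s ^ 2) n (fOp s n) (xOne s n) := by
  have hq' : ∀ k : ℕ, 0 < k → qHalf s k ≠ 0 := fun k hk => hq k (by omega)
  have hp : s ^ 2 ≠ 0 := pow_ne_zero 2 hs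
  constructor
  · intro i j hij hj
    refine commute_xMinus hs hq' ?_ 0 0
    rwa [val_ofNat hj, val_ofNat (by omega)]
  · intro i j hij hj
    refine commute_xMinus hs hq' ?_ 0 1
    rwa [val_ofNat hj, val_ofNat (by omega)]
  · intro i hi
    have h1 : ((Fin.ofNat n (i + 1) : Fin n) : ℕ) = (Fin.ofNat n i : Fin n) + 1 := by
      rw [val_ofNat (by omega), val_ofNat (by omega)]
    have h2 : ((Fin.ofNat n (i + 2) : Fin n) : ℕ) = (Fin.ofNat n (i + 1) : Fin n) + 1 := by
      rw [val_ofNat (by omega), val_ofNat (by omega)]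
    rw [fOp, fOp, xMinus_short s h1, xMinus_short s h2]
    exact (shortPair_xMinus hs hq' h1 h2).serreRel hp one_ne_zero _ _ _ _
  · intro i hi
    have h1 : ((Fin.ofNat n (i + 1) : Fin n) : ℕ) = (Fin.ofNat n i : Fin n) + 1 := by
      rw [val_ofNat (by omega), val_ofNat (by omega)]
    have h2 : ((Fin.ofNat n (i + 2) : Fin n) : ℕ) = (Fin.ofNat n (i + 1) : Fin n) + 1 := by
      rw [val_ofNat (by omega), val_ofNat (by omega)]
    have := (((shortPair_xMinus hs hq' h1 h2).exchangeRel hp one_ne_zero (s ^ 2 - (s ^ 2)⁻¹)⁻¹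
      (s ^ 2 - (s ^ 2)⁻¹)⁻¹).qComm_eq hp 0 0).2
    simp only [one_zpow, one_smul] at this
    rw [fOp, fOp, xOne, xOne, xMinus_short s h1, xMinus_short s h2, xMinus_short s h1,
      xMinus_short s h2]
    exact this
  · intro i hi
    have h1 : ((Fin.ofNat n (i + 1) : Fin n) : ℕ) = (Fin.ofNat n i : Fin n) + 1 := by
      rw [val_ofNat (by omega), val_ofNat (by omega)]
    have h2 : ((Fin.ofNat n (i + 1) : Fin n) : ℕ) + 1 = n := by
      rw [val_ofNat (by omega)]
      omega
    have key := fun {u : K} hu => exchangeRel_short_long hs hq' h1 h2 (u := u) hu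
    have key2 := (key (.inl rfl)).sub_left (s ^ 2 - (s ^ 2)⁻¹)⁻¹ (key (.inr rfl))
    -- The long current involves no difference operator, so `x_n^-(0)` is the mode `-1` of its
    -- exponential, while for short currents it is the mode 0.
    have := (key2.qComm_eq (pow_ne_zero 2 hp) 0 (-1)).1
    rw [fOp, fOp, xOne, xOne, xMinus_short s h1, xMinus_long s h2, xMinus_short s h1,
      xMinus_long s h2]
    rw [qComm_smul_left, qComm_smul_left, smul_comm]
    exact congrArg _ this

include hn

theorem shortPair_phi (κ : ZMod 2 × Bool → ℤ) (c : ZMod 2 × Bool → K) {i j : Fin n} (hi : i = 0)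
    (h : (j : ℕ) = i + 1) :
    ShortPair (s ^ 2) (qShift s n)⁻¹ (s ^ 2)⁻¹ 1 (shortComp s i j) (phiComp s κ c) := by
  have hq' : ∀ k : ℕ, 0 < k → qHalf s k ≠ 0 := fun k hk => hq k (by omega)
  have hp : s ^ 2 ≠ 0 := pow_ne_zero 2 hs
  have hp' : (s ^ 2)⁻¹ ≠ 0 := inv_ne_zero hp
  have h0 : ∀ {u : K}, u = s ^ 2 ∨ u = (s ^ 2)⁻¹ → u ≠ 0 := by rintro u (rfl | rfl) <;> assumption
  constructor
  · intro u v hu _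
    exact ope_short_self hs hq' h (h0 hu) v
  · intro u hu
    rw [mul_inv_cancel₀ hp]
    exact ope_short_zero_phi κ c hn hs hq hi h (h0 hu) fun k => by
      rw [div_inv_eq_mul, div_inv_eq_mul, div_eq_inv_mul]
  · intro u hu
    exact ope_phi_short_zero κ c hn hs hq hi h hp u fun k => by simp
  · intro u hu
    exact ope_short_zero_phi κ c hn hs hq hi h (h0 hu) fun k => by
      rw [div_eq_inv_mul]
      simp
  · intro u hu
    rw [mul_one]
    have := ope_phi_short_zero κ c hn hs hq hi h hp' u (a := (qShift s n)⁻¹ / s ^ 2)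
      (b := s ^ 2 * (qShift s n)⁻¹) fun k => by
        rw [← inv_pow (_ * _), ← inv_pow (_ * _), mul_inv, mul_inv, inv_inv, div_eq_mul_inv,
          mul_comm (qShift s n)⁻¹]
    rwa [inv_inv] at this

theorem phiBarOne_comm (κ : ZMod 2 × Bool → ℤ) (c : ZMod 2 × Bool → K) {j : Fin n} (hj : j ≠ 0)
    (r m : ℤ) : phiBarOne s κ c r * xMinus s j m = xMinus s j m * phiBarOne s κ c r := by
  have hp : s ^ 2 ≠ 0 := pow_ne_zero 2 hs
  have hp' : (s ^ 2)⁻¹ ≠ 0 := inv_ne_zero hp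
  have hjn := j.isLt
  rw [phiBarOne_eq]
  rcases Nat.lt_or_ge (j + 1) n with h | h
  · obtain ⟨j', hj'⟩ : ∃ j' : Fin n, (j' : ℕ) = j + 1 := ⟨⟨j + 1, h⟩, rfl⟩
    have key : ∀ {u v : K}, u ≠ 0 → v ≠ 0 →
        (shortComp s j j' v).field (-m) * (phiComp s κ c u).field (r + 1) =
          (phiComp s κ c u).field (r + 1) * (shortComp s j j' v).field (-m) := fun {u v} hu hv =>
      (ope_short_phi κ c hn hs hq hj hj' u hv).field_comm (ope_phi_short κ c hn hs hq hj hj' hu v) _ _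
    rw [xMinus_short s hj']
    exact mul_comm_smul_sub _ (mul_comm_smul_sub _ (key hp hp) (key hp' hp)).symm
      (mul_comm_smul_sub _ (key hp hp') (key hp' hp')).symm
  · have hjl : (j : ℕ) + 1 = n := by omega
    rw [xMinus_long s hjl]
    have key : ∀ {u : K}, u ≠ 0 →
        (longComp s j).field (-m - 1) * (phiComp s κ c u).field (r + 1) =
          (phiComp s κ c u).field (r + 1) * (longComp s j).field (-m - 1) := fun {u} hu =>
      (ope_long_phi κ c hn hs hq hjl u).field_comm (ope_phi_long κ c hn hs hq hjl hu) _ _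
    exact mul_comm_smul _ (mul_comm_smul_sub _ (key hp) (key hp')).symm

theorem phiBarOne_serreRel (κ : ZMod 2 × Bool → ℤ) (c : ZMod 2 × Bool → K) (r : ℤ) :
    SerreRel (s ^ 2) (phiBarOne s κ c r) (fOp s n 0) := by
  have hp : s ^ 2 ≠ 0 := pow_ne_zero 2 hs
  have h1 : ((Fin.ofNat n 1 : Fin n) : ℕ) = (Fin.ofNat n 0 : Fin n) + 1 := by
    rw [val_ofNat (by omega), val_ofNat (by omega)]
  rw [phiBarOne_eq, fOp, xMinus_short s h1]
  exact (shortPair_phi hn hs hq κ c (Fin.ext (Nat.zero_mod n)) h1).serreRel hp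
    (inv_ne_zero (qShift_ne_zero hs)) _ _ _ _

/-- Passing from mode `r + 1` to `r` of the rescaled field contributes `q^{n+1/2}`; with the factor
`q^{-1/2}` of the exchange relation this is `q^n`. -/
theorem phiBarOne_xOne (κ : ZMod 2 × Bool → ℤ) (c : ZMod 2 × Bool → K) (r : ℤ) :
    qComm (s ^ 2)⁻¹ (phiBarOne s κ c r) (xOne s n 0) =
      (s ^ 4) ^ n • qComm (s ^ 2) (phiBarOne s κ c (r - 1)) (fOp s n 0) := by
  have hp : s ^ 2 ≠ 0 := pow_ne_zero 2 hs
  have hQ := qShift_ne_zero (n := n) hs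
  have h1 : ((Fin.ofNat n 1 : Fin n) : ℕ) = (Fin.ofNat n 0 : Fin n) + 1 := by
    rw [val_ofNat (by omega), val_ofNat (by omega)]
  have e : (s ^ 4) ^ n = (s ^ 2)⁻¹ * qShift s n := by
    rw [qShift, zpow_add₀ hs, zpow_mul]
    norm_cast
    field_simp
  have key := (((shortPair_phi hn hs hq κ c (Fin.ext (Nat.zero_mod n)) h1).exchangeRel hp
    (inv_ne_zero hQ) (s ^ 2 - (s ^ 2)⁻¹)⁻¹ ((s ^ 2 - (s ^ 2)⁻¹) * qShift s n)⁻¹).qComm_eq hp 0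
      (r + 1)).1
  rw [phiBarOne_eq, phiBarOne_eq, fOp, xOne, xMinus_short s h1, xMinus_short s h1, e]
  have z : (qShift s n)⁻¹ ^ (r + 1) = (qShift s n)⁻¹ ^ r * (qShift s n)⁻¹ :=
    zpow_add_one₀ (inv_ne_zero hQ) r
  have z0 : (qShift s n)⁻¹ ^ r ≠ 0 := zpow_ne_zero r (inv_ne_zero hQ)
  have z1 : (qShift s n)⁻¹ ^ (r + 1) ≠ 0 := zpow_ne_zero _ (inv_ne_zero hQ)
  simp only [add_sub_cancel_right, zero_sub] at key
  rw [qComm_smul_left _ ((qShift s n)⁻¹ ^ (r + 1)), qComm_smul_left _ ((qShift s n)⁻¹ ^ r)] at key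
  rw [sub_add_cancel, neg_zero, ← inv_smul_smul₀ z1 (qComm (s ^ 2)⁻¹ _ _), key, smul_smul, smul_smul, z]
  congr 1
  field_simp

end Assembly

-- Weights under `K_θ` and the passage to `e_0`.

section Weights

variable {K : Type*} [Field K] {n : ℕ} [NeZero n] {s : K}

theorem KthetaInv_single (s : K) (γ : Charge n) (p : Pol K n) :
    KthetaInv s n (Finsupp.single γ p) =
      Finsupp.single γ (s ^ (-(4 * γ.fst 0 + 2 * γ.h)) • p) := by
  simp [KthetaInv]

theorem KthetaInv_mul_field (hs : s ≠ 0) (U : NExp K n) (r : ℤ) :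
    KthetaInv s n * U.field r = s ^ (-4 * U.shift.1 0) • (U.field r * KthetaInv s n) := by
  refine Finsupp.lhom_ext fun γ p => ?_
  rw [LinearMap.smul_apply, Module.End.mul_apply, Module.End.mul_apply, NExp.field_single,
    KthetaInv_single, KthetaInv_single, NExp.field_single, Finsupp.smul_single]
  congr 1
  have e : -(4 * (γ.translate U.shift).fst 0 + 2 * (γ.translate U.shift).h) =
      -4 * U.shift.1 0 + -(4 * γ.fst 0 + 2 * γ.h) := by
    have h1 : (γ.translate U.shift).h = γ.h := rfl
    have h2 : (γ.translate U.shift).fst 0 = γ.fst 0 + U.shift.1 0 := rfl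
    rw [h1, h2]
    ring
  rw [e, zpow_add₀ hs, map_smul, smul_smul, smul_smul, smul_smul]
  congr 1
  ring

theorem qComm_weight {V : Type*} [AddCommGroup V] [Module K V] {T A B : Module.End K V} {a b : K}
    (hA : T * A = a • (A * T)) (hB : T * B = b • (B * T)) (v : K) :
    T * qComm v A B = (a * b) • (qComm v A B * T) := by
  have h1 : T * (A * B) = (a * b) • (A * B * T) := by
    rw [← mul_assoc, hA, smul_mul_assoc, mul_assoc, hB, mul_smul_comm, smul_smul, mul_assoc]
  have h2 : T * (B * A) = (a * b) • (B * A * T) := by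
    rw [← mul_assoc, hB, smul_mul_assoc, mul_assoc, hA, mul_smul_comm, smul_smul, mul_assoc,
      mul_comm a]
  unfold qComm
  rw [mul_sub, mul_smul_comm, h1, h2, sub_mul, smul_mul_assoc]
  module

theorem smul_sub_weight {V : Type*} [AddCommGroup V] [Module K V] {T A B : Module.End K V} {a : K}
    (hA : T * A = a • (A * T)) (hB : T * B = a • (B * T)) (x : K) :
    T * (x • (A - B)) = a • (x • (A - B) * T) := by
  rw [mul_smul_comm, mul_sub, hA, hB, smul_mul_assoc, sub_mul]
  module

theorem KthetaInv_mul_xMinus (hs : s ≠ 0) (j : Fin n) (m : ℤ) :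
    KthetaInv s n * xMinus s j m = s ^ (4 * simpleRoot j 0) • (xMinus s j m * KthetaInv s n) := by
  have hj := j.isLt
  rcases Nat.lt_or_ge (j + 1) n with h | h
  · have hj' : ((⟨j + 1, h⟩ : Fin n) : ℕ) = j + 1 := rfl
    rw [xMinus_short s hj']
    have key := fun u : K => KthetaInv_mul_field hs (shortComp s j ⟨j + 1, h⟩ u) (-m)
    have e : ∀ u : K, -4 * (shortComp s j ⟨j + 1, h⟩ u).shift.1 0 = 4 * simpleRoot j 0 := fun u => by
      simp [shortComp, NExp.mul, NExp.rescale, Zop, Yop]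
    simp only [e] at key
    exact smul_sub_weight (key _) (key _) _
  · rw [xMinus_long s (show (j : ℕ) + 1 = n by omega)]
    have key := KthetaInv_mul_field hs (longComp s j) (-m - 1)
    have e : -4 * (longComp s j).shift.1 0 = 4 * simpleRoot j 0 := by
      simp [longComp, NExp.mul, NExp.rescale, Zop, Yop]
    rw [e] at key
    have := smul_sub_weight key key
    rw [mul_smul_comm, smul_mul_assoc, key, smul_comm]

theorem KthetaInv_mul_fOp_zero (hs : s ≠ 0) (hn : 2 ≤ n) :
    KthetaInv s n * fOp s n 0 = s ^ 4 • (fOp s n 0 * KthetaInv s n) := by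
  have h0 : (Fin.ofNat n 0 : Fin n) = 0 := Fin.ext (Nat.zero_mod n)
  have := KthetaInv_mul_xMinus hs (Fin.ofNat n 0) 0
  have e : simpleRoot (Fin.ofNat n 0) (0 : Fin n) = 1 := by
    rw [h0, simpleRoot, if_neg (by rw [Fin.val_zero]; omega), if_pos rfl]
  rw [e] at this
  exact_mod_cast this

theorem KthetaInv_mul_fOp (hs : s ≠ 0) {i : ℕ} (hi : 0 < i) (hin : i < n) :
    KthetaInv s n * fOp s n i = (1 : K) • (fOp s n i * KthetaInv s n) := by
  have := KthetaInv_mul_xMinus hs (Fin.ofNat n i) 0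
  have h0 : ((Fin.ofNat n i : Fin n) : ℕ) = i := val_ofNat hin
  have e : simpleRoot (Fin.ofNat n i) (0 : Fin n) = 0 := by
    have : (0 : Fin n) ≠ Fin.ofNat n i := fun e => by
      rw [← e, Fin.val_zero] at h0
      omega
    simp only [simpleRoot, if_neg this, Fin.val_zero]
    split_ifs <;> first | rfl | omega
  rw [e, mul_zero, zpow_zero] at this
  exact this

/-- Of all the `f_i` only that of the first node has nonzero weight, and it enters twice, so the
weight changes from `q^{-1}` to `q`. -/
theorem KthetaInv_mul_phiOne (hs : s ≠ 0) (hn : 2 ≤ n) (F : FormalDist K n)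
    (hF : ∀ r, KthetaInv s n * F r = (s ^ 4)⁻¹ • (F r * KthetaInv s n)) (r : ℤ) :
    KthetaInv s n * phiOne s F r = s ^ 4 • (phiOne s F r * KthetaInv s n) := by
  have hs4 : s ^ 4 ≠ 0 := pow_ne_zero 4 hs
  have bar : ∀ k, k + 2 ≤ n → KthetaInv s n * phiBar s F (k + 1) r =
      (1 : K) • (phiBar s F (k + 1) r * KthetaInv s n) := by
    intro k hk
    induction k with
    | zero =>
      have := qComm_weight (hF r) (KthetaInv_mul_fOp_zero hs hn) (s ^ 2)
      rw [inv_mul_cancel₀ hs4] at this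
      rw [phiBar_succ, mul_smul_comm, smul_mul_assoc, smul_comm]
      exact congrArg _ this
    | succ k ih =>
      have := qComm_weight (ih (by omega)) (KthetaInv_mul_fOp hs (i := k + 1) (by omega) (by omega))
        (s ^ 2)
      rw [mul_one] at this
      rw [phiBar_succ, mul_smul_comm, smul_mul_assoc, smul_comm]
      exact congrArg _ this
  obtain ⟨d, rfl⟩ : ∃ d, n = d + 2 := ⟨n - 2, by omega⟩
  have down : ∀ k, k ≤ d → KthetaInv s (d + 2) * phiDown s F k r =
      (1 : K) • (phiDown s F k r * KthetaInv s (d + 2)) := by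
    intro k hk
    induction k with
    | zero =>
      have := qComm_weight (bar d le_rfl) (KthetaInv_mul_fOp hs (i := d + 1) (by omega) (by omega))
        (s ^ 4)
      rw [mul_one] at this
      exact this
    | succ k ih =>
      have := qComm_weight (ih (by omega)) (KthetaInv_mul_fOp (n := d + 2) hs
        (i := d + 2 - 2 - k) (by omega) (by omega)) (s ^ 2)
      rw [mul_one] at this
      exact this
  have := qComm_weight (down d le_rfl) (KthetaInv_mul_fOp_zero hs hn) (s ^ 2)
  rw [one_mul] at this
  have e : d + 2 - 2 - d = 0 := by omega
  simp only [phiOne, show d + 2 - 1 = d + 1 from rfl, phiDown, e]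
  exact this

theorem phiBar_smul (s : K) (F : FormalDist K n) (x : ℤ → K) (k : ℕ) (r : ℤ) :
    phiBar s (fun r => x r • F r) k r = x r • phiBar s F k r := by
  induction k with
  | zero => rfl
  | succ k ih => rw [phiBar_succ, phiBar_succ, ih, qComm_smul_left, smul_comm]

theorem phiDown_smul (s : K) (F : FormalDist K n) (x : ℤ → K) (k : ℕ) (r : ℤ) :
    phiDown s (fun r => x r • F r) k r = x r • phiDown s F k r := by
  induction k with
  | zero =>
    simp only [phiDown]
    rw [phiBar_smul, qComm_smul_left]
  | succ k ih =>
    simp only [phiDown]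
    rw [ih, qComm_smul_left]

theorem phiOne_reflect (s : K) (F : FormalDist K n) (r : ℤ) :
    phiOne s (reflect F) r = (-1 : K) ^ r • phiOne s F r :=
  phiDown_smul s F _ _ r

theorem KthetaInv_mul_phiBarOne (hs : s ≠ 0) (κ : ZMod 2 × Bool → ℤ) (c : ZMod 2 × Bool → K) (r : ℤ) :
    KthetaInv s n * phiBarOne s κ c r = (s ^ 4)⁻¹ • (phiBarOne s κ c r * KthetaInv s n) := by
  have key := fun u : K => KthetaInv_mul_field hs (phiComp (n := n) s κ c u) (r + 1)
  have e : ∀ u : K, s ^ (-4 * (phiComp (n := n) s κ c u).shift.1 0) = (s ^ 4)⁻¹ := fun u => by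
    have : -4 * (phiComp (n := n) s κ c u).shift.1 0 = -(4 : ℕ) := by
      simp [phiComp, NExp.mul, NExp.rescale, Zop, phiA]
    rw [this, zpow_neg, zpow_natCast]
  simp only [e] at key
  rw [phiBarOne_eq]
  exact smul_sub_weight (key _) (key _) _

/-- Moving `T` past `A` costs `a⁻¹`, which is the subscript of the `q`-commutator; moving it past
`B` gives the last factor in `hw`. -/
theorem commutator_of_weight {V : Type*} [AddCommGroup V] [Module K V] {T E A B : Module.End K V}
    {a x y w : K} (ha : a ≠ 0) (hA : T * A = a⁻¹ • (A * T)) (hB : T * B = a • (B * T))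
    (h : qComm a⁻¹ A E = x • B) (hw : y * x * a⁻¹ = -w) :
    A * (y • (E * T)) - y • (E * T) * A = -(w • T * B) := by
  obtain rfl : w = -(y * x * a⁻¹) := by rw [hw, neg_neg]
  have h1 : E * T * A = a⁻¹ • (E * A * T) := by
    rw [mul_assoc, hA, mul_smul_comm, mul_assoc]
  have h2 := congrArg (· * T) h
  simp only [qComm, sub_mul, smul_mul_assoc] at h2
  rw [mul_smul_comm, smul_mul_assoc, smul_mul_assoc, h1, hB, ← mul_assoc]
  linear_combination (norm := skip) y • h2
  match_scalars <;> field_simp <;> ring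

/-- Passing from the `q`-commutator with `ê_0` to the commutator with `e_0`. -/
theorem commutator_eZero (hs : s ≠ 0) (hs4 : s ^ 4 + 1 ≠ 0) (hn : 2 ≤ n) {A B : Module.End K (Fock K n)}
    (hA : KthetaInv s n * A = (s ^ 4)⁻¹ • (A * KthetaInv s n))
    (hB : KthetaInv s n * B = s ^ 4 • (B * KthetaInv s n))
    (h : qComm (s ^ 4)⁻¹ A (eZeroHat s n) = ((-1) ^ (n - 1) * (1 + s ^ 4) : K) • B) :
    A * eZero s n - eZero s n * A = -(tZero s n * B) := by
  have hd : s ^ 2 + (s ^ 2)⁻¹ ≠ 0 := by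
    intro e
    apply hs4
    field_simp at e
    linear_combination e
  have hsign : ((-1) ^ n : K) = -(-1) ^ (n - 1) := by
    obtain ⟨d, rfl⟩ : ∃ d, n = d + 1 := ⟨n - 1, by omega⟩
    rw [Nat.add_sub_cancel, pow_succ]
    ring
  have hsq : ((-1) ^ (n - 1) : K) * (-1) ^ (n - 1) = 1 := by
    rw [← mul_pow]; simp
  have h4 : (-1) ^ n / (s ^ 2 + (s ^ 2)⁻¹) * ((-1) ^ (n - 1) * (1 + s ^ 4)) * (s ^ 4)⁻¹ =
      -(s ^ 2)⁻¹ := by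
    rw [hsign]
    field_simp
    linear_combination (-(1 + s ^ 4)) * hsq
  exact commutator_of_weight (pow_ne_zero 4 hs) hA hB h h4

theorem smul_commutator {V : Type*} [AddCommGroup V] [Module K V] {A E T B : Module.End K V} (x : K)
    (h : A * E - E * A = -(T * B)) : x • A * E - E * (x • A) = T * (-x • B) := by
  rw [smul_mul_assoc, mul_smul_comm, ← smul_sub, h, mul_smul_comm, smul_neg, neg_smul]

end Weights

end QSymp
end

theorem mainTheorem3 {K : Type*} [Field K] [CharZero K] (n : ℕ) [NeZero n] (hn : 2 ≤ n)
    (s : K) (hs0 : s ≠ 0) (hs : ∀ k : ℕ, 0 < k → s ^ k ≠ 1)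
    (κ : ZMod 2 × Bool → ℤ) (c : ZMod 2 × Bool → K)
    (Φ Ψ : QSymp.FormalDist K n)
    (hΦ : Φ = QSymp.phiBarOne s κ c) (hΨ : Ψ = QSymp.reflect Φ) :
    (∀ r : ℤ, QSymp.qComm ((s ^ 4)⁻¹) (Φ r) (QSymp.eZeroHat s n) =
      ((-1) ^ (n - 1) * (1 + s ^ 4) : K) • QSymp.phiOne s Φ (r - 1)) ∧
    (∀ r : ℤ, Φ r * QSymp.eZero s n - QSymp.eZero s n * Φ r =
      -(QSymp.tZero s n * QSymp.phiOne s Φ (r - 1))) ∧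
    (∀ r : ℤ, QSymp.qComm ((s ^ 4)⁻¹) (Ψ r) (QSymp.eZeroHat s n) =
      ((-1) ^ n * (1 + s ^ 4) : K) • QSymp.phiOne s Ψ (r - 1)) ∧
    (∀ r : ℤ, Ψ r * QSymp.eZero s n - QSymp.eZero s n * Ψ r =
      QSymp.tZero s n * QSymp.phiOne s Ψ (r - 1)) := by
  have hq : ∀ k : ℤ, k ≠ 0 → QSymp.qHalf s k ≠ 0 := fun _ => QSymp.qHalf_ne_zero hs0 hs
  -- If `s^4 = -1` then `s^8 = 1`.
  have hs4 : s ^ 4 + 1 ≠ 0 := fun h => hs 8 (by norm_num) (by linear_combination (s ^ 4 - 1) * h)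
  have val_ne : ∀ j, 0 < j → j < n → (Fin.ofNat n j : Fin n) ≠ 0 := fun j h0 hj e => by
    have := congrArg Fin.val e
    rw [QSymp.val_ofNat hj, Fin.val_zero] at this
    omega
  have hat : ∀ r : ℤ, QSymp.qComm ((s ^ 4)⁻¹) (Φ r) (QSymp.eZeroHat s n) =
      ((-1) ^ (n - 1) * (1 + s ^ 4) : K) • QSymp.phiOne s Φ (r - 1) := by
    subst hΦ
    exact QSymp.qComm_eZeroHat hs0 hs4 hn (QSymp.currentRels hs0 hq)
      (fun r j h0 hj => QSymp.phiBarOne_comm hn hs0 hq κ c (val_ne j h0 hj) r 0)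
      (fun r j h0 hj => QSymp.phiBarOne_comm hn hs0 hq κ c (val_ne j h0 hj) r 1)
      (QSymp.phiBarOne_serreRel hn hs0 hq κ c) (QSymp.phiBarOne_xOne hn hs0 hq κ c)
  have hw : ∀ r : ℤ, QSymp.KthetaInv s n * Φ r = (s ^ 4)⁻¹ • (Φ r * QSymp.KthetaInv s n) := by
    subst hΦ
    exact QSymp.KthetaInv_mul_phiBarOne hs0 κ c
  have comm : ∀ r : ℤ, Φ r * QSymp.eZero s n - QSymp.eZero s n * Φ r =
      -(QSymp.tZero s n * QSymp.phiOne s Φ (r - 1)) := fun r =>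
    QSymp.commutator_eZero hs0 hs4 hn (hw r) (QSymp.KthetaInv_mul_phiOne hs0 hn Φ hw _) (hat r)
  have hsign : ((-1) ^ n : K) = -(-1) ^ (n - 1) := by
    obtain ⟨d, rfl⟩ : ∃ d, n = d + 1 := ⟨n - 1, by omega⟩
    rw [Nat.add_sub_cancel, pow_succ]
    ring
  have hr : ∀ r : ℤ, ((-1) ^ (r - 1) : K) = -(-1) ^ r := fun r => by
    rw [zpow_sub_one₀ (by norm_num)]
    norm_num
  have hΨr : ∀ r : ℤ, Ψ r = (-1 : K) ^ r • Φ r := fun r => by rw [hΨ]; rfl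
  -- The recursion is linear in `Φ_{\bar 1}`, so mode `r - 1` acquires `(-1)^{r-1}`, against
  -- `(-1)^r` for `Ψ r`; this is the only change of sign.
  have hΨ1 : ∀ r : ℤ, QSymp.phiOne s Ψ (r - 1) = -(-1 : K) ^ r • QSymp.phiOne s Φ (r - 1) :=
    fun r => by rw [hΨ, QSymp.phiOne_reflect, hr]
  refine ⟨hat, comm, fun r => ?_, fun r => ?_⟩
  · rw [hΨr, hΨ1, QSymp.qComm_smul_left, hat, smul_smul, smul_smul, hsign]
    congr 1
    ring
  · rw [hΨr, hΨ1]
    exact QSymp.smul_commutator _ (comm r)
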